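/- Let $F$ be a non-Archimedean local field with residue field of characteristic $p$, let $D$ be a quaternion division algebra over $F$ (central of dimension $4$), with reduced norm $\mathrm{Nrd}$, and put $v_D=v_F\circ\mathrm{Nrd}$, $U_D=\{x\in D^\times\mid v_D(x)=0\}$ and $U_D^1=\{x\in D^\times\mid x=1\text{ or }v_D(x-1)\ge 1\}$. Representations are over $\overline{\mathbb F}_p$; a representation is smooth if every vector has open stabilizer, and admissible if moreover the fixed vectors of every compact open subgroup form a finite-dimensional space; a (mod $p$) character is a homomorphism to $\overline{\mathbb F}_p^\times$ with open kernel. Let $E/F$ be an unramified quadratic extension. Call a character $\xi$ of $E^\times$ regular if it is not of the form $\varphi\circ \mathrm N_{E/F}$ with $\varphi$ a character of $F^\times$, and irregular otherwise. There is an $F$-embedding $E\to D$. For every such embedding, $E^\times U_D^1=F^\times U_D$ is a subgroup of $D^\times$, and every character $\xi$ of $E^\times$ determines a unique character $\xi^\dagger$ of it with $\xi^\dagger|_{E^\times}=\xi$ and $\xi^\dagger|_{U_D^1}=1$. Let $\pi_\xi=\mathrm{Ind}_{E^\times U_D^1}^{D^\times}\xi^\dagger$ be the smoothly induced representation; it is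 admissible. 1. Up to isomorphism, $\pi_\xi$ does not depend on the choice of the $F$-embedding $E\to D$. 2. $\pi_\xi$ is irreducible if and only if $\xi$ is regular. Every irreducible admissible representation of $D^\times$ of dimension greater than one is isomorphic to $\pi_\xi$ for some regular $\xi$. If $\xi,\xi'$ are regular, then $\pi_\xi\cong\pi_{\xi'}$ if and only if $\xi\circ\theta=\xi'$ for some $\theta\in\mathrm{Gal}(E/F)$. Let $\mathbb P_2(F,\overline{\mathbb F}_p)$ be the set of isomorphism classes of admissible pairs $(E'/F,\chi)$: here $E'/F$ is a tamely ramified (possibly unramified) quadratic extension and $\chi$ is a character of $E'^\times$ with values in $\overline{\mathbb F}_p^\times$ which does not factor through $\mathrm N_{E'/F}$ and is such that $E'/F$ is unramified if the restriction $\chi|_{1+\mathfrak p_{E'}}$ factors through $\mathrm N_{E'/F}$ (i.e. coincides with the restriction of $\varphi\circ \mathrm N_{E'/F}$ for some character $\varphi$ of $F^\times$); $(E'/F,\chi)$ and $(E''/F,\chi')$ are isomorphic if $\chi=\chi'\circ j$ for some $F$-isomorphism $j:E'\to E''$. In every such pair $E'/F$ is unramified and $E'$ embeds in $D$ over $F$,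 and $[(E'/F,\chi)]\mapsto[\pi_\chi]$ is a well-defined bijection from $\mathbb P_2(F,\overline{\mathbb F}_p)$ onto the set $\mathcal A_1^0(D,\overline{\mathbb F}_p)$ of isomorphism classes of irreducible admissible representations of $D^\times$ over $\overline{\mathbb F}_p$ of dimension greater than one. In particular, every irreducible admissible representation of $D^\times$ over $\overline{\mathbb F}_p$ has dimension one or two. 3. Let $\xi$ be irregular. If $p\ne 2$, there are exactly two characters $\tilde\xi_1\neq\tilde\xi_2$ of $D^\times$ extending $\xi^\dagger$, and $\pi_\xi\cong\tilde\xi_1\oplus\tilde\xi_2$. If $p=2$, there is exactly one character $\tilde\xi$ of $D^\times$ extending $\xi^\dagger$, and $\pi_\xi$ is a non-split extension of $\tilde\xi$ by itself. -/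

import Mathlib

open ValuativeRel
open scoped Pointwise

universe u w

namespace QuatModP

/-! ### Smooth representations and smooth characters of topological groups -/

section Smooth

variable {G : Type*} [Group G] {k : Type*} [Field k] {V : Type*} [AddCommGroup V] [Module k V]

/-- The stabilizer in `G` of a vector of a representation of `G`. -/
def vecStab (ρ : Representation k G V) (v : V) : Subgroup G where
  carrier := {g | ρ g v = v}
  one_mem' := by simp
  mul_mem' := by
    intro a b ha hb
    simp only [Set.mem_ofPred_eq] at ha hb ⊢
    rw [map_mul, Module.End.mul_apply, hb, ha]
  inv_mem' := by
    intro a ha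
    simp only [Set.mem_ofPred_eq] at ha ⊢
    calc ρ a⁻¹ v = ρ a⁻¹ (ρ a v) := by rw [ha]
      _ = v := by simp

variable [TopologicalSpace G]

/-- A representation is smooth if every vector has an open stabilizer. -/
def IsSmooth (ρ : Representation k G V) : Prop :=
  ∀ v : V, IsOpen (vecStab ρ v : Set G)

/-- A representation is admissible if it is smooth and, for every compact open subgroup `K`,
the space of `K`-fixed vectors is finite-dimensional. -/
def IsAdmissible (ρ : Representation k G V) : Prop :=
  IsSmooth ρ ∧ ∀ K : Subgroup G, IsOpen (K : Set G) → IsCompact (K : Set G) →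
    FiniteDimensional k (Representation.invariants (ρ.comp K.subtype))

/-- The subrepresentation of smooth vectors. -/
def smoothVectors [IsTopologicalGroup G] (ρ : Representation k G V) : Subrepresentation ρ where
  toSubmodule :=
    { carrier := {v | IsOpen (vecStab ρ v : Set G)}
      zero_mem' := by
        have h : (vecStab ρ 0 : Set G) = Set.univ := by
          ext g; simp [vecStab]
        simp only [Set.mem_ofPred_eq, h, isOpen_univ]
      add_mem' := by
        intro a b ha hb
        refine Subgroup.isOpen_mono (H₁ := vecStab ρ a ⊓ vecStab ρ b) ?_ (ha.inter hb)
        rintro g ⟨h₁, h₂⟩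
        change ρ g (a + b) = a + b
        rw [map_add]
        exact congrArg₂ (· + ·) h₁ h₂
      smul_mem' := by
        intro c a ha
        refine Subgroup.isOpen_mono (H₁ := vecStab ρ a) ?_ ha
        intro g h
        change ρ g (c • a) = c • a
        rw [map_smul]
        exact congrArg (c • ·) h }
  apply_mem_toSubmodule := by
    intro g v hv
    have h : (vecStab ρ (ρ g v) : Set G) = (fun x => g⁻¹ * x * g) ⁻¹' (vecStab ρ v : Set G) := by
      ext x
      change ρ x (ρ g v) = ρ g v ↔ ρ (g⁻¹ * x * g) v = v
      rw [map_mul, map_mul, Module.End.mul_apply, Module.End.mul_apply]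
      constructor
      · intro h; rw [h]; simp
      · intro h
        have h' := congrArg (ρ g) h
        simpa using h'
    change IsOpen (vecStab ρ (ρ g v) : Set G)
    rw [h]
    exact IsOpen.preimage (by fun_prop) hv

/-- Smooth induction from a subgroup `H` to `G`: the smooth vectors, under right translation, in
the space of all functions `f : G → V` with `f (h * g) = σ h (f g)` for `h ∈ H`, `g ∈ G`. -/
def smoothInd [IsTopologicalGroup G] (H : Subgroup G) (σ : Representation k H V) :
    Representation k G (smoothVectors (Representation.coind H.subtype σ)).toSubmodule :=
  (smoothVectors (Representation.coind H.subtype σ)).toRepresentation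

variable (G k) in
/-- Characters: homomorphisms to `kˣ` with open kernel, i.e. continuous for the discrete topology
on `kˣ`. -/
abbrev SmoothChar := {χ : G →* kˣ // IsOpen (χ.ker : Set G)}

/-- A character, viewed as a representation on the one-dimensional space `k`. -/
def charRep (χ : SmoothChar G k) : Representation k G k where
  toFun g := (χ.1 g : k) • LinearMap.id
  map_one' := by ext; simp
  map_mul' a b := by ext; simp [mul_comm]

end Smooth

/-! ### Quadratic extensions of local fields -/

section Ext

variable (F : Type*) [Field F] [ValuativeRel F]
variable (E : Type*) [Field E] [ValuativeRel E] [Algebra F E] [ValuativeExtension F E]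

/-- The ramification index: the index of the value group of `F` in that of `E`. -/
noncomputable def ramIdx : ℕ :=
  (Units.map (ValuativeExtension.mapValueGroupWithZero F E :
    ValueGroupWithZero F →* ValueGroupWithZero E)).range.index

/-- `E/F` is unramified. (Residue fields being finite, residue extensions are separable.) -/
def IsUnramifiedExt : Prop := ramIdx F E = 1

/-- `E/F` is tamely ramified: the residue characteristic does not divide the ramification index.
Unramified extensions are included. -/
def IsTameExt : Prop := ¬ ringChar 𝓀[F] ∣ ramIdx F E

/-- The norm map `N_{E/F} : Eˣ → Fˣ`. -/
noncomputable def normUnits : Eˣ →* Fˣ := Units.map (Algebra.norm F)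

variable {E} [TopologicalSpace F] [TopologicalSpace E] {k : Type*} [Field k]

/-- A character of `Eˣ` is regular if it is not `φ ∘ N_{E/F}` for a character `φ` of `Fˣ`. -/
def IsRegularChar (ξ : SmoothChar Eˣ k) : Prop :=
  ¬ ∃ φ : SmoothChar Fˣ k, ∀ x : Eˣ, ξ.1 x = φ.1 (normUnits F E x)

variable {F} in
/-- The conjugate `ξ ∘ θ` of a character `ξ` of `Eˣ` under `θ ∈ Gal(E/F)`. -/
def galConj (θ : E ≃ₐ[F] E) (ξ : SmoothChar Eˣ k) : Eˣ →* kˣ :=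
  ξ.1.comp (Units.map (θ : E →* E))

end Ext

section Pairs

variable (F : Type u) [Field F] [ValuativeRel F] [TopologicalSpace F]
  [IsNonarchimedeanLocalField F] (K : Type*) [Field K]

/-- Admissible pairs `(E/F, χ)` with values in `K`. -/
structure AdmissiblePair where
  E : Type u
  [field : Field E]
  [valuativeRel : ValuativeRel E]
  [topologicalSpace : TopologicalSpace E]
  [isLocalField : IsNonarchimedeanLocalField E]
  [algebra : Algebra F E]
  [valuativeExtension : ValuativeExtension F E]
  [isQuadratic : Algebra.IsQuadraticExtension F E]
  tame : IsTameExt F E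
  χ : SmoothChar Eˣ K
  not_factor : ¬ ∃ φ : SmoothChar Fˣ K, ∀ x : Eˣ, χ.1 x = φ.1 (normUnits F E x)
  unram_of_factor :
    (∃ φ : SmoothChar Fˣ K, ∀ x : Eˣ, valuation E ((x : E) - 1) < 1 →
      χ.1 x = φ.1 (normUnits F E x)) → IsUnramifiedExt F E

attribute [instance] AdmissiblePair.field AdmissiblePair.valuativeRel
  AdmissiblePair.topologicalSpace AdmissiblePair.isLocalField AdmissiblePair.algebra
  AdmissiblePair.valuativeExtension AdmissiblePair.isQuadratic

/-- `F`-isomorphism of admissible pairs: an `F`-isomorphism `j : E → E'` with `χ = χ' ∘ j`. -/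
instance AdmissiblePair.setoid : Setoid (AdmissiblePair F K) where
  r P Q := ∃ j : P.E ≃ₐ[F] Q.E, P.χ.1 = Q.χ.1.comp (Units.map (j : P.E →* Q.E))
  iseqv :=
    { refl := fun P => ⟨AlgEquiv.refl, by ext x; rfl⟩
      symm := by
        rintro P Q ⟨j, hj⟩
        refine ⟨j.symm, ?_⟩
        rw [hj]
        ext x
        change _ = ((Q.χ.1 (Units.map (j : P.E →* Q.E)
          (Units.map (j.symm : Q.E →* P.E) x)) : Kˣ) : K)
        congr 2
        ext
        simp
      trans := by
        rintro P Q R ⟨j, hj⟩ ⟨l, hl⟩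
        refine ⟨j.trans l, ?_⟩
        rw [hj, hl]
        ext x
        rfl }

/-- The set `ℙ₂(F, K)` of `F`-isomorphism classes of admissible pairs with values in `K`. -/
abbrev PairClasses := Quotient (AdmissiblePair.setoid F K)

end Pairs

/-! ### The quaternion division algebra -/

section Quaternion

variable (F : Type*) [Field F] {D : Type*} [DivisionRing D] [Algebra F D]

/-- The reduced norm of a quaternion division algebra `D` over `F`. The reduced characteristic
polynomial of `x` is the power of degree `2` of the minimal polynomial of `x` over `F` (which has
degree `1` or `2`), and the reduced norm is its constant coefficient. -/
noncomputable def redNorm (x : D) : F :=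
  ((minpoly F x) ^ (2 / (minpoly F x).natDegree)).coeff 0

variable (D) [ValuativeRel F]

/-- `U_D = {x ∈ Dˣ | v_D(x) = 0}` where `v_D = v_F ∘ Nrd`. -/
def unitsD : Set Dˣ := {x | valuation F (redNorm F (x : D)) = 1}

/-- `U_D¹ = 1 + 𝔮`, where `𝔮 = {x ∈ D | v_D(x) ≥ 1}` (with `0 ∈ 𝔮`). -/
def unitsD1 : Set Dˣ := {x | valuation F (redNorm F ((x : D) - 1)) < 1}

variable {F} {D}
variable {E : Type*} [Field E] [Algebra F E]

/-- The map `Eˣ → Dˣ` induced by an embedding `E → D`. -/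
def embUnits (ι : E →ₐ[F] D) : Eˣ →* Dˣ := Units.map (ι : E →* D)

/-- The subgroup `Eˣ U_D¹` of `Dˣ`. -/
def groupJ (ι : E →ₐ[F] D) : Subgroup Dˣ :=
  (embUnits ι).range ⊔ Subgroup.closure (unitsD1 F D)

variable {k : Type*} [Field k] [TopologicalSpace D] [TopologicalSpace E]

/-- `χ` is a character of `Eˣ U_D¹` which restricts to `ξ` on `Eˣ` and to `1` on `U_D¹`. -/
def IsDagger (ι : E →ₐ[F] D) (ξ : SmoothChar Eˣ k) (χ : SmoothChar (groupJ ι) k) : Prop :=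
  (∀ (x : groupJ ι) (e : Eˣ), (x : Dˣ) = embUnits ι e → χ.1 x = ξ.1 e) ∧
  (∀ x : groupJ ι, (x : Dˣ) ∈ unitsD1 F D → χ.1 x = 1)

open Classical in
/-- The character `ξ†` of `Eˣ U_D¹` with `ξ†|_{Eˣ} = ξ` and `ξ†|_{U_D¹} = 1`
(its existence and uniqueness are asserted separately; the value `1` is a default). -/
noncomputable def dagger (ι : E →ₐ[F] D) (ξ : SmoothChar Eˣ k) : SmoothChar (groupJ ι) k :=
  if h : ∃ χ, IsDagger ι ξ χ then h.choose else ⟨1, by simp [MonoidHom.ker_one]⟩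

/-- `π_ξ`, the representation of `Dˣ` smoothly induced from `ξ†`. -/
noncomputable def piRep [IsTopologicalRing D] (ι : E →ₐ[F] D) (ξ : SmoothChar Eˣ k) :=
  smoothInd (groupJ ι) (charRep (dagger ι ξ))

/-- `χ` is a character of `Dˣ` extending `ξ†`. -/
def ExtendsDagger (ι : E →ₐ[F] D) (ξ : SmoothChar Eˣ k) (χ : SmoothChar Dˣ k) : Prop :=
  ∀ x : groupJ ι, χ.1 (x : Dˣ) = (dagger ι ξ).1 x

end Quaternion

section Irr

variable (D : Type u) [DivisionRing D] [TopologicalSpace D] (k : Type*) [Field k]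

/-- Irreducible admissible representations of `Dˣ` over `k` of dimension greater than one. -/
structure IrrRep where
  V : Type u
  [addCommGroup : AddCommGroup V]
  [module : Module k V]
  ρ : Representation k Dˣ V
  irreducible : ρ.IsIrreducible
  admissible : IsAdmissible ρ
  one_lt_rank : 1 < Module.rank k V

attribute [instance] IrrRep.addCommGroup IrrRep.module

/-- Isomorphism of representations. -/
instance IrrRep.setoid : Setoid (IrrRep D k) where
  r R S := Nonempty (R.ρ.Equiv S.ρ)
  iseqv :=
    { refl := fun R => ⟨Representation.Equiv.refl R.ρ⟩
      symm := fun ⟨e⟩ => ⟨e.symm⟩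
      trans := fun ⟨e⟩ ⟨f⟩ => ⟨e.trans f⟩ }

/-- The set `𝒜₁⁰(D, k)` of isomorphism classes of irreducible admissible representations of `Dˣ`
over `k` of dimension greater than one. -/
abbrev IrrClasses := Quotient (IrrRep.setoid D k)

end Irr

/-- `ρ` is a non-split extension of the character `χ` by itself: there is a short exact sequence
`0 → χ → ρ → χ → 0` of representations that has no splitting. -/
def IsNonsplitSelfExtension {G : Type*} [Group G] [TopologicalSpace G] {k : Type*} [Field k]
    {V : Type*} [AddCommGroup V] [Module k V] (χ : SmoothChar G k)
    (ρ : Representation k G V) : Prop :=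
  ∃ (i : (charRep χ).IntertwiningMap ρ) (q : ρ.IntertwiningMap (charRep χ)),
    Function.Injective i ∧ Function.Exact i q ∧ Function.Surjective q ∧
    ¬ ∃ s : (charRep χ).IntertwiningMap ρ, ∀ x, q (s x) = x

end QuatModP

open QuatModP

/-!
Every element `x` of a quaternion division algebra `D` over the local field `F` satisfies a
quadratic equation `x² - t x + Nrd x = 0`. Hensel's lemma applied to this equation shows that
`v ∘ Nrd` is a valuation of `D` (`nrdVal`); by compactness its balls define the module topology,
and `U_D¹` is a compact, open, normal pro-`p` subgroup.

*Geometry of `Dˣ`.* If every integral element of `D` were congruent to an element of `F`, then `D`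
would be generated by a uniformizer and hence commutative. So `D` contains an integral element
generating a quadratic extension of the residue field (`exists_nrdVal_residue_generator`), and the
unramified quadratic extension `E` embeds in `D`. Its Galois automorphism `θ` is induced by
conjugation with some `g` (`exists_twist`), and `D = E + E g`. The valuation of `g` is odd
(`nrdVal_ne_sq_of_twist`), while that of every element of `E` is even, so that in `a + d g` one of
the two terms dominates. It follows that `Eˣ U_D¹` is the group of all elements of even valuation
(`groupJ_eq_evenUnits`), a normal subgroup of index two which does not depend on the embedding, and
that `g` lies outside it.

*Characters.* A character with values in characteristic `p` kills every principal unit, because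
a `p`-power of it lies in the open kernel and `x ↦ x ^ p` is injective in characteristic `p`. So
`ξ ↦ ξ†` is a bijection from the characters of `Eˣ` onto those of `Eˣ U_D¹`, and conjugation
by `g` on the latter corresponds to `ξ ↦ ξ ∘ θ` (`conjHom_dagger_eq_iff`). By an approximate form of
Hilbert's Theorem 90 a Galois-invariant `ξ` kills all elements whose norm is a principal unit;
since the group of units of an algebraically closed field is divisible, `ξ` then factors through
the norm. Hence `ξ` is regular if and only if `ξ ∘ θ ≠ ξ` (`not_isRegularChar_iff`).

*Induction from index two.* Let `J` have index two, with `g ∉ J`, and let `χ` be a character of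
`J`. The induced representation has dimension two and its restriction to `J` has the constituents
`χ` and its conjugate by `g`. If these differ, it is irreducible and determines the pair
(`isIrreducible_smoothInd`, `eq_or_eq_conjHom_of_equiv`). If they agree, `χ` extends, the extensions
being given by the square roots of `χ (g²)`: there are two of them when `p ≠ 2`, and the induced
representation is their sum (`nonempty_equiv_prod`); there is only one when `p = 2`, and the induced
representation is a non-split extension of it by itself (`isNonsplitSelfExtension_of_charP_two`).

*Exhaustion.* The pro-`p` group `U_D¹` fixes a non-zero vector of any smooth representation in
characteristic `p` (`exists_ne_zero_fixed_of_isSmooth`). On an irreducible admissible representation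
it therefore acts trivially, the dimension is finite, and the abelian group `Eˣ U_D¹ / U_D¹` has
an eigenfunctional; Frobenius reciprocity maps the representation to some `π_ξ`
(`finrank_eq_one_or_exists_equiv`).

*Embeddings and pairs.* The theorem of Skolem and Noether for quadratic subfields
(`exists_mul_eq_mul_of_algHom`) shows that `π_ξ` does not depend on the embedding. As characters
kill principal units, the extension in an admissible pair is unramified, and unramified quadratic
extensions are isomorphic; so the pairs up to isomorphism are the regular characters of one such
`E` up to the Galois action (`exists_pairClasses_equiv_irrClasses`).
-/

namespace QuatModP

open scoped Topology

/-! ### Division algebras all of whose elements are quadratic -/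

/-- A finite-dimensional division algebra over `F` in which every element has degree at most two.
Quadratic field extensions and quaternion division algebras are of this kind. -/
class IsQuadraticDivisionAlgebra (F A : Type*) [Field F] [DivisionRing A] [Algebra F A] :
    Prop where
  finite : FiniteDimensional F A
  natDegree_minpoly_le : ∀ x : A, (minpoly F x).natDegree ≤ 2

attribute [instance] IsQuadraticDivisionAlgebra.finite

theorem exists_algHom_adjoinRoot {F A : Type*} [Field F] [Ring A] [Algebra F A]
    {f : Polynomial F} {x : A} (h : Polynomial.aeval x f = 0) :
    ∃ φ : AdjoinRoot f →ₐ[F] A, φ (AdjoinRoot.root f) = x := by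
  have hI : ∀ g : Polynomial F, g ∈ Ideal.span {f} → Polynomial.aeval x g = 0 := by
    intro g hg
    obtain ⟨k, rfl⟩ := Ideal.mem_span_singleton.1 hg
    simp [h]
  refine ⟨(Ideal.Quotient.liftₐ (Ideal.span {f}) (Polynomial.aeval x) hI :
    (Polynomial F ⧸ Ideal.span {f}) →ₐ[F] A), ?_⟩
  have := DFunLike.congr_fun (Ideal.Quotient.liftₐ_comp (Ideal.span {f}) (Polynomial.aeval x) hI)
    Polynomial.X
  exact this.trans (by simp)

section DegreeDvd

variable {F A : Type*} [Field F] [DivisionRing A] [Algebra F A] [FiniteDimensional F A]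

/-- The degree of `x` divides the dimension, and the norm of `x` is read off from the constant
coefficient of its minimal polynomial: `A` is a vector space over the field `F[X]/(minpoly x)`. -/
theorem exists_natDegree_mul_eq_and_norm_eq (x : A) :
    ∃ m : ℕ, (minpoly F x).natDegree * m = Module.finrank F A ∧
      Algebra.norm F x = ((-1) ^ (minpoly F x).natDegree * (minpoly F x).coeff 0) ^ m := by
  have hx : IsIntegral F x := Algebra.IsIntegral.isIntegral x
  have hirr : Irreducible (minpoly F x) := minpoly.irreducible hx
  have : Fact (Irreducible (minpoly F x)) := ⟨hirr⟩
  let K := AdjoinRoot (minpoly F x)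
  obtain ⟨φ, hφ⟩ := exists_algHom_adjoinRoot (minpoly.aeval F x)
  let : Module K A := Module.compHom A φ.toRingHom
  have hsmul : ∀ (c : K) (a : A), c • a = φ c * a := fun _ _ => rfl
  have : IsScalarTower F K A := ⟨fun r c a => by
    rw [hsmul, hsmul, map_smul, smul_mul_assoc]⟩
  let pb := AdjoinRoot.powerBasis hirr.ne_zero
  have : FiniteDimensional F K := pb.finite
  have : FiniteDimensional K A := FiniteDimensional.right F K A
  have hdim : Module.finrank F K = (minpoly F x).natDegree := by
    rw [pb.finrank, AdjoinRoot.powerBasis_dim]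
  refine ⟨Module.finrank K A, by rw [← hdim, Module.finrank_mul_finrank], ?_⟩
  have h1 : (Algebra.lmul F A x : A →ₗ[F] A)
      = ((AdjoinRoot.root (minpoly F x) : K) • (LinearMap.id : A →ₗ[K] A)).restrictScalars F := by
    ext a
    simp [hsmul, hφ]
  rw [Algebra.norm_apply, h1, LinearMap.det_restrictScalars, LinearMap.det_smul, LinearMap.det_id,
    mul_one, map_pow]
  congr 1
  have := Algebra.PowerBasis.norm_gen_eq_coeff_zero_minpoly pb
  rw [AdjoinRoot.powerBasis_gen, AdjoinRoot.powerBasis_dim] at this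
  rw [this, AdjoinRoot.minpoly_root hirr.ne_zero, minpoly.monic hx]
  simp

/-- An element of maximal degree generates the algebra. -/
theorem commute_of_natDegree_minpoly_eq_finrank {x : A}
    (h : (minpoly F x).natDegree = Module.finrank F A) (y z : A) : y * z = z * y := by
  have hx : IsIntegral F x := Algebra.IsIntegral.isIntegral x
  have hirr : Irreducible (minpoly F x) := minpoly.irreducible hx
  have : Fact (Irreducible (minpoly F x)) := ⟨hirr⟩
  obtain ⟨φ, hφ⟩ := exists_algHom_adjoinRoot (minpoly.aeval F x)
  let pb := AdjoinRoot.powerBasis hirr.ne_zero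
  have : FiniteDimensional F (AdjoinRoot (minpoly F x)) := pb.finite
  have hsurj : Function.Surjective φ :=
    (LinearMap.injective_iff_surjective_of_finrank_eq_finrank (f := φ.toLinearMap)
      (by rw [pb.finrank, AdjoinRoot.powerBasis_dim, h])).1 φ.toRingHom.injective
  obtain ⟨y, rfl⟩ := hsurj y
  obtain ⟨z, rfl⟩ := hsurj z
  rw [← map_mul, mul_comm, map_mul]

end DegreeDvd

theorem not_forall_commute_of_finrank_eq_four {F D : Type*} [Field F] [DivisionRing D]
    [Algebra F D] [Algebra.IsCentral F D] (hD : Module.finrank F D = 4) :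
    ¬ ∀ y z : D, y * z = z * y := by
  intro h
  have h1 : Function.Surjective (algebraMap F D) := fun y => by
    have hy : y ∈ Subalgebra.center F D := Subalgebra.mem_center_iff.2 fun z => h z y
    rwa [Algebra.IsCentral.center_eq_bot, Algebra.mem_bot] at hy
  have h2 := LinearMap.finrank_le_finrank_of_surjective (f := Algebra.linearMap F D) h1
  rw [hD, Module.finrank_self] at h2
  omega

/-- Every element of a quaternion division algebra has degree at most two: an element of degree
four would generate the algebra, making it commutative. -/
theorem isQuadraticDivisionAlgebra_of_finrank_eq_four {F D : Type*} [Field F] [DivisionRing D]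
    [Algebra F D] [Algebra.IsCentral F D] (hD : Module.finrank F D = 4) :
    IsQuadraticDivisionAlgebra F D := by
  have : FiniteDimensional F D := Module.finite_of_finrank_pos (by omega)
  refine ⟨inferInstance, fun x => ?_⟩
  obtain ⟨m, hm, -⟩ := exists_natDegree_mul_eq_and_norm_eq (F := F) x
  rw [hD] at hm
  by_contra! hlt
  have hdeg : (minpoly F x).natDegree = 4 := by
    have : (minpoly F x).natDegree ∣ 4 := ⟨m, hm.symm⟩
    have hle := Nat.le_of_dvd (by norm_num) this
    interval_cases (minpoly F x).natDegree <;> omega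
  exact not_forall_commute_of_finrank_eq_four hD
    (commute_of_natDegree_minpoly_eq_finrank (hdeg.trans hD.symm))

instance {F E : Type*} [Field F] [Field E] [Algebra F E] [Algebra.IsQuadraticExtension F E] :
    IsQuadraticDivisionAlgebra F E where
  finite := inferInstance
  natDegree_minpoly_le x := by
    rw [← Algebra.IsQuadraticExtension.finrank_eq_two F E]
    exact minpoly.natDegree_le x

section RedNorm

variable {F A : Type*} [Field F] [DivisionRing A] [Algebra F A]

theorem redNorm_algebraMap (a : F) : redNorm F (algebraMap F A a) = a ^ 2 := by
  have : (algebraMap F A).toFun.Injective := (algebraMap F A).injective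
  simp [redNorm, minpoly.eq_X_sub_C, Polynomial.coeff_zero_eq_eval_zero]

theorem redNorm_zero : redNorm F (0 : A) = 0 := by
  simpa using redNorm_algebraMap (A := A) (0 : F)

theorem redNorm_one : redNorm F (1 : A) = 1 := by
  simpa using redNorm_algebraMap (A := A) (1 : F)

theorem redNorm_algHom {E : Type*} [Field E] [Algebra F E] (ι : E →ₐ[F] A) (x : E) :
    redNorm F (ι x) = redNorm F x := by
  rw [redNorm, redNorm, minpoly.algHom_eq ι ι.toRingHom.injective]

theorem minpoly_eq_of_mul_self_eq {x : A} (hx : x ∉ Set.range (algebraMap F A)) {t c : F}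
    (h : x * x = t • x - algebraMap F A c) :
    minpoly F x = Polynomial.X ^ 2 - Polynomial.C t * Polynomial.X + Polynomial.C c := by
  symm
  have hdeg : (Polynomial.X ^ 2 - Polynomial.C t * Polynomial.X + Polynomial.C c).natDegree = 2 := by
    compute_degree!
  have hmon : (Polynomial.X ^ 2 - Polynomial.C t * Polynomial.X + Polynomial.C c).Monic := by
    monicity!
  have hroot : Polynomial.aeval x
      (Polynomial.X ^ 2 - Polynomial.C t * Polynomial.X + Polynomial.C c) = 0 := by
    simp only [map_add, map_sub, map_mul, map_pow, Polynomial.aeval_X, Polynomial.aeval_C]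
    rw [pow_two, h, Algebra.smul_def]
    abel
  have hint : IsIntegral F x := ⟨_, hmon, hroot⟩
  have h2 : 2 ≤ (minpoly F x).natDegree := (minpoly.two_le_natDegree_iff hint).2 hx
  exact Polynomial.eq_of_monic_of_dvd_of_natDegree_le (minpoly.monic hint) hmon
    (minpoly.dvd F x hroot) (by omega) |>.symm ▸ rfl

theorem redNorm_eq_of_mul_self_eq {x : A} (hx : x ∉ Set.range (algebraMap F A)) {t c : F}
    (h : x * x = t • x - algebraMap F A c) : redNorm F x = c := by
  rw [redNorm, minpoly_eq_of_mul_self_eq hx h]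
  have hdeg : (Polynomial.X ^ 2 - Polynomial.C t * Polynomial.X + Polynomial.C c).natDegree = 2 := by
    compute_degree!
  rw [hdeg]
  simp

variable [IsQuadraticDivisionAlgebra F A]

theorem natDegree_minpoly_eq_two {x : A} (hx : x ∉ Set.range (algebraMap F A)) :
    (minpoly F x).natDegree = 2 :=
  le_antisymm (IsQuadraticDivisionAlgebra.natDegree_minpoly_le x)
    ((minpoly.two_le_natDegree_iff (Algebra.IsIntegral.isIntegral x)).2 hx)

/-- The quadratic equation of an element, with its reduced norm as constant coefficient. -/
theorem exists_minpoly_eq {x : A} (hx : x ∉ Set.range (algebraMap F A)) :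
    ∃ t : F, x * x = t • x - algebraMap F A (redNorm F x) ∧
      minpoly F x = Polynomial.X ^ 2 - Polynomial.C t * Polynomial.X
        + Polynomial.C (redNorm F x) := by
  have hdeg := natDegree_minpoly_eq_two (F := F) hx
  have hmon : (minpoly F x).Monic := minpoly.monic (Algebra.IsIntegral.isIntegral x)
  have hlead : (minpoly F x).coeff 2 = 1 := by rw [← hdeg]; exact hmon
  have hred : redNorm F x = (minpoly F x).coeff 0 := by simp [redNorm, hdeg]
  have heq : minpoly F x = Polynomial.X ^ 2 - Polynomial.C (-(minpoly F x).coeff 1) * Polynomial.X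
      + Polynomial.C (redNorm F x) := by
    conv_lhs => rw [(minpoly F x).as_sum_range_C_mul_X_pow, hdeg]
    simp only [Finset.sum_range_succ, Finset.sum_range_zero, hlead, hred]
    simp
    ring
  refine ⟨-(minpoly F x).coeff 1, ?_, heq⟩
  have h0 := minpoly.aeval F x
  rw [heq] at h0
  simp only [map_add, map_sub, map_mul, map_pow, Polynomial.aeval_X, Polynomial.aeval_C,
    ← Algebra.smul_def] at h0
  rw [← pow_two]
  rw [← sub_eq_zero, ← h0]
  abel

theorem norm_sq_eq_redNorm_pow (x : A) :
    Algebra.norm F x ^ 2 = redNorm F x ^ Module.finrank F A := by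
  by_cases hx : x ∈ Set.range (algebraMap F A)
  · obtain ⟨a, rfl⟩ := hx
    rw [redNorm_algebraMap, Algebra.norm_algebraMap, ← pow_mul, ← pow_mul, mul_comm]
  · have hdeg := natDegree_minpoly_eq_two (F := F) hx
    obtain ⟨m, hm, hn⟩ := exists_natDegree_mul_eq_and_norm_eq (F := F) x
    have hred : redNorm F x = (minpoly F x).coeff 0 := by simp [redNorm, hdeg]
    rw [hn, ← hm, hdeg, hred]
    ring

theorem redNorm_eq_zero_iff {x : A} : redNorm F x = 0 ↔ x = 0 := by
  have h := norm_sq_eq_redNorm_pow (F := F) x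
  have hn : Module.finrank F A ≠ 0 := Module.finrank_pos.ne'
  rw [← pow_eq_zero_iff hn, ← h, pow_eq_zero_iff two_ne_zero, Algebra.norm_eq_zero_iff]

end RedNorm

/-! ### The valuation `v ∘ Nrd` -/

section NoRoot

variable {F : Type*} [Field F] {A : Type*} [DivisionRing A] [Algebra F A]

theorem no_root_of_minpoly_eq {x : A} (hx : x ∉ Set.range (algebraMap F A)) {t c : F}
    (h : x * x = t • x - algebraMap F A c) (s : F) : s ^ 2 - t * s + c ≠ 0 := by
  intro hs
  have h0 : (x - algebraMap F A s) * (x - algebraMap F A (t - s)) = 0 := by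
    have hc : c = t * s - s ^ 2 := by linear_combination hs
    rw [sub_mul, mul_sub, mul_sub, h, hc, Algebra.smul_def]
    simp only [map_sub, map_mul, map_pow]
    rw [mul_sub x, ← Algebra.commutes t x, ← Algebra.commutes s x, mul_sub, ← Algebra.commutes s,
      pow_two]
    abel
  rcases mul_eq_zero.1 h0 with h1 | h1
  · exact hx ⟨s, (sub_eq_zero.1 h1).symm⟩
  · exact hx ⟨t - s, (sub_eq_zero.1 h1).symm⟩

end NoRoot

section Multiplicativity

variable {F : Type*} [Field F] [ValuativeRel F] {A : Type*} [DivisionRing A] [Algebra F A]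
  [IsQuadraticDivisionAlgebra F A]

theorem valuation_redNorm_mul (x y : A) : valuation F (redNorm F (x * y))
    = valuation F (redNorm F x) * valuation F (redNorm F y) := by
  have hn : Module.finrank F A ≠ 0 := Module.finrank_pos.ne'
  apply (pow_left_inj₀ zero_le zero_le hn).1
  rw [mul_pow, ← map_pow, ← map_pow, ← map_pow, ← map_mul, ← norm_sq_eq_redNorm_pow,
    ← norm_sq_eq_redNorm_pow, ← norm_sq_eq_redNorm_pow, map_mul, mul_pow]

end Multiplicativity

section LocalField

variable (F : Type*) [Field F] [ValuativeRel F] [TopologicalSpace F] [IsNonarchimedeanLocalField F]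

theorem henselianLocalRing_integer : HenselianLocalRing 𝒪[F] := by
  let := IsTopologicalAddGroup.rightUniformSpace F
  have := isUniformAddGroup_of_addCommGroup (G := F)
  have h : HenselianRing 𝒪[F] (IsLocalRing.maximalIdeal 𝒪[F]) := inferInstance
  refine { is_henselian := fun f hf a h1 h2 => ?_ }
  exact h.is_henselian f hf a h1 (h2.map _)

variable {F}

theorem mem_maximalIdeal_integer_iff {x : 𝒪[F]} :
    x ∈ IsLocalRing.maximalIdeal 𝒪[F] ↔ valuation F (x : F) < 1 := by
  rw [IsLocalRing.mem_maximalIdeal, mem_nonunits_iff,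
    Valuation.Integers.isUnit_iff_valuation_eq_one (Valuation.integer.integers (valuation F))]
  have : valuation F (x : F) ≤ 1 := x.2
  exact ⟨fun h => lt_of_le_of_ne this h, fun h => h.ne⟩

/-- A quadratic polynomial with integral constant coefficient and no root has integral linear
coefficient: otherwise it has, after rescaling, a simple root modulo the maximal ideal. -/
theorem valuation_le_one_of_no_root {t c : F} (hc : valuation F c ≤ 1)
    (h : ∀ s : F, s ^ 2 - t * s + c ≠ 0) : valuation F t ≤ 1 := by
  by_contra! ht
  have := henselianLocalRing_integer F
  have ht0 : t ≠ 0 := by rintro rfl; simp at ht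
  have hd : valuation F (c / t ^ 2) < 1 := by
    rw [map_div₀, map_pow]
    refine (div_lt_one₀ (pow_pos (zero_lt_one.trans ht) 2)).2 (hc.trans_lt ?_)
    exact one_lt_pow₀ ht two_ne_zero
  let d : 𝒪[F] := ⟨c / t ^ 2, hd.le⟩
  obtain ⟨a, ha, -⟩ := HenselianLocalRing.is_henselian
    (Polynomial.X ^ 2 - Polynomial.X + Polynomial.C d) (by monicity!) 0
    (by
      rw [mem_maximalIdeal_integer_iff]
      simpa [d] using hd) (by simp)
  have ha' : (a : F) ^ 2 - a + c / t ^ 2 = 0 := by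
    have := congrArg (Subtype.val) ha
    simpa [d] using this
  apply h (t * a)
  field_simp at ha'
  linear_combination ha'

end LocalField

section QuadVal

variable {F : Type*} [Field F] [ValuativeRel F] [TopologicalSpace F]
  [IsNonarchimedeanLocalField F] {A : Type*} [DivisionRing A] [Algebra F A]
  [IsQuadraticDivisionAlgebra F A]

/-- An integral quadratic equation for an element of integral reduced norm. -/
theorem exists_integral_equation {x : A} (hx : valuation F (redNorm F x) ≤ 1) :
    ∃ t : F, valuation F t ≤ 1 ∧ x * x = t • x - algebraMap F A (redNorm F x) := by
  by_cases h : x ∈ Set.range (algebraMap F A)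
  · obtain ⟨a, rfl⟩ := h
    rw [redNorm_algebraMap] at hx ⊢
    have ha : valuation F a ≤ 1 := by
      rw [map_pow] at hx
      exact (pow_le_one_iff two_ne_zero).1 hx
    refine ⟨a + a, (Valuation.map_add_le _ ha ha), ?_⟩
    rw [add_smul, Algebra.smul_def, pow_two, map_mul, add_sub_cancel_right]
  · obtain ⟨t, ht, -⟩ := exists_minpoly_eq (F := F) h
    exact ⟨t, valuation_le_one_of_no_root hx (no_root_of_minpoly_eq h ht), ht⟩

theorem valuation_redNorm_one_add_le {x : A} (hx : valuation F (redNorm F x) ≤ 1) :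
    valuation F (redNorm F (1 + x)) ≤ 1 := by
  by_cases h : x ∈ Set.range (algebraMap F A)
  · obtain ⟨a, rfl⟩ := h
    rw [redNorm_algebraMap] at hx
    have ha : valuation F a ≤ 1 := by
      rw [map_pow] at hx
      exact (pow_le_one_iff two_ne_zero).1 hx
    rw [← map_one (algebraMap F A), ← map_add, redNorm_algebraMap, map_pow]
    exact pow_le_one₀ zero_le (Valuation.map_add_le _ (by simp) ha)
  · obtain ⟨t, ht, hxt⟩ := exists_integral_equation hx
    have h' : 1 + x ∉ Set.range (algebraMap F A) := by
      rintro ⟨a, ha⟩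
      exact h ⟨a - 1, by rw [map_sub, ha, map_one]; abel⟩
    rw [redNorm_eq_of_mul_self_eq h' (t := t + 2) (c := 1 + t + redNorm F x)]
    · exact Valuation.map_add_le _ (Valuation.map_add_le _ (by simp) ht) hx
    · rw [mul_add, add_mul, add_mul, hxt]
      simp only [map_add, map_one, Algebra.smul_def, mul_add, add_mul, one_mul, mul_one,
        ← one_add_one_eq_two]
      abel

variable (F A) in
/-- The valuation `v ∘ Nrd` of a quadratic division algebra. -/
noncomputable def nrdVal : Valuation A (ValueGroupWithZero F) where
  toFun x := valuation F (redNorm F x)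
  map_zero' := by rw [redNorm_zero, map_zero]
  map_one' := by rw [redNorm_one, map_one]
  map_mul' := valuation_redNorm_mul
  map_add_le_max' := by
    -- dividing by the larger term reduces the claim to the integrality of `1 + x`
    have key : ∀ x y : A, valuation F (redNorm F x) ≤ valuation F (redNorm F y) →
        valuation F (redNorm F (x + y)) ≤ valuation F (redNorm F y) := by
      intro x y h
      rcases eq_or_ne y 0 with rfl | hy
      · have hx : x = 0 := by
          rw [redNorm_zero, map_zero, le_zero_iff, map_eq_zero, redNorm_eq_zero_iff] at h
          exact h
        rw [hx, add_zero]
      · have hxy : x + y = y * (1 + y⁻¹ * x) := by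
          rw [mul_add, mul_one, mul_inv_cancel_left₀ hy, add_comm]
        rw [hxy, valuation_redNorm_mul]
        refine mul_le_of_le_one_right' (valuation_redNorm_one_add_le ?_)
        have hy0 : valuation F (redNorm F y) ≠ 0 := by
          rw [map_ne_zero, Ne, redNorm_eq_zero_iff]; exact hy
        rw [← mul_le_mul_iff_right₀ (zero_lt_iff.2 hy0), ← valuation_redNorm_mul,
          mul_inv_cancel_left₀ hy, mul_one]
        exact h
    intro x y
    rcases le_total (valuation F (redNorm F x)) (valuation F (redNorm F y)) with h | h
    · exact (key x y h).trans (le_max_right _ _)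
    · rw [add_comm]
      exact (key y x h).trans (le_max_left _ _)

theorem nrdVal_apply (x : A) : nrdVal F A x = valuation F (redNorm F x) := rfl

theorem nrdVal_algebraMap (a : F) : nrdVal F A (algebraMap F A a) = valuation F a ^ 2 := by
  rw [nrdVal_apply, redNorm_algebraMap, map_pow]

theorem nrdVal_algHom {E : Type*} [Field E] [Algebra F E] [IsQuadraticDivisionAlgebra F E]
    (ι : E →ₐ[F] A) (x : E) : nrdVal F A (ι x) = nrdVal F E x := by
  rw [nrdVal_apply, nrdVal_apply, redNorm_algHom]

theorem nrdVal_pow_finrank (x : A) :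
    nrdVal F A x ^ Module.finrank F A = valuation F (Algebra.norm F x) ^ 2 := by
  rw [nrdVal_apply, ← map_pow, ← map_pow, norm_sq_eq_redNorm_pow]

theorem nrdVal_le_one_iff {x : A} : nrdVal F A x ≤ 1 ↔ valuation F (Algebra.norm F x) ≤ 1 := by
  rw [← pow_le_one_iff (M := ValueGroupWithZero F) (n := Module.finrank F A)
    Module.finrank_pos.ne', nrdVal_pow_finrank, pow_le_one_iff two_ne_zero]

theorem exists_nrdVal_integral_equation {x : A} (hx : nrdVal F A x ≤ 1) :
    ∃ t : F, valuation F t ≤ 1 ∧ x * x = t • x - algebraMap F A (redNorm F x) :=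
  exists_integral_equation hx

end QuadVal

/-! ### Principal units of a division ring with a valuation topology -/

section Ball

variable {A : Type*} [DivisionRing A] {Γ : Type*} [LinearOrderedCommGroupWithZero Γ]
  (w : Valuation A Γ)

/-- The topology of `A` is the one defined by the valuation `w`: the open balls around `0` form a
basis of neighbourhoods of `0`. -/
def HasBallTopology [TopologicalSpace A] : Prop :=
  (𝓝 (0 : A)).HasBasis (fun γ : Γ => γ ≠ 0) (fun γ => {x | w x < γ})

theorem valuation_inv_sub_one {x : A} (hx : w (x - 1) < 1) : w (x⁻¹ - 1) = w (x - 1) := by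
  have h1 : w x = 1 := by
    have := Valuation.map_one_add_of_lt w hx
    rwa [add_sub_cancel] at this
  have hx0 : x ≠ 0 := by rintro rfl; simp at h1
  have : x⁻¹ - 1 = -(x⁻¹ * (x - 1)) := by
    rw [mul_sub, inv_mul_cancel₀ hx0, mul_one, neg_sub]
  rw [this, Valuation.map_neg, map_mul, map_inv₀, h1, inv_one, one_mul]

/-- The group of principal units of a valuation on a division ring, a normal subgroup. -/
def principalUnits : Subgroup Aˣ where
  carrier := {x | w ((x : A) - 1) < 1}
  one_mem' := by simp
  mul_mem' := by
    intro x y hx hy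
    change w (((x * y : Aˣ) : A) - 1) < 1
    have : ((x * y : Aˣ) : A) - 1 = ((x : A) - 1) * ((y : A) - 1) + ((x : A) - 1) + ((y : A) - 1) := by
      rw [Units.val_mul]; noncomm_ring
    rw [this]
    refine Valuation.map_add_lt w (Valuation.map_add_lt w ?_ hx) hy
    rw [map_mul]
    exact mul_lt_one' hx hy
  inv_mem' := by
    intro x hx
    change w (((x⁻¹ : Aˣ) : A) - 1) < 1
    rw [Units.val_inv_eq_inv_val, valuation_inv_sub_one w hx]
    exact hx

variable {w}

theorem mem_principalUnits {x : Aˣ} : x ∈ principalUnits w ↔ w ((x : A) - 1) < 1 := Iff.rfl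

theorem valuation_conj_sub_one (g x : Aˣ) :
    w (((g * x * g⁻¹ : Aˣ) : A) - 1) = w ((x : A) - 1) := by
  have : ((g * x * g⁻¹ : Aˣ) : A) - 1 = g * ((x : A) - 1) * (g⁻¹ : Aˣ) := by
    rw [mul_sub, sub_mul, mul_one, ← Units.val_mul g g⁻¹, mul_inv_cancel, Units.val_one,
      Units.val_mul, Units.val_mul]
  rw [this, map_mul, map_mul, mul_right_comm, ← map_mul, ← Units.val_mul, mul_inv_cancel,
    Units.val_one, map_one, one_mul]

theorem conj_mem_principalUnits (g : Aˣ) {x : Aˣ} (hx : x ∈ principalUnits w) :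
    g * x * g⁻¹ ∈ principalUnits w := by
  rw [mem_principalUnits, valuation_conj_sub_one]
  exact hx

instance : (principalUnits w).Normal := ⟨fun _ hx g => conj_mem_principalUnits g hx⟩

theorem valuation_eq_one_of_mem_principalUnits {x : Aˣ} (hx : x ∈ principalUnits w) :
    w (x : A) = 1 := by
  have := Valuation.map_one_add_of_lt w hx
  rwa [add_sub_cancel] at this

/-- The `p`-th power map contracts the principal units towards `1`. -/
theorem valuation_pow_prime_sub_one_le {p : ℕ} (hp : p.Prime) {δ : Γ} (hδ : δ < 1)
    (hpδ : w (p : A) ≤ δ) {x : A} (hx : w (x - 1) ≤ δ) :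
    w (x ^ p - 1) ≤ δ * w (x - 1) := by
  have hint : w (x - 1) ≤ 1 := hx.trans hδ.le
  let y : w.integer := ⟨x - 1, hint⟩
  obtain ⟨r, hr⟩ := (Commute.one_right y).exists_add_pow_prime_eq hp
  have hr' : x ^ p - 1 = (x - 1) ^ p + p * (x - 1) * r := by
    have := congrArg Subtype.val hr
    simp only [y, Subring.coe_pow, Subring.coe_add, Subring.coe_mul, Subring.coe_one,
      sub_add_cancel, one_pow, mul_one, Subring.coe_natCast] at this
    rw [this]
    abel
  rw [hr']
  refine Valuation.map_add_le w ?_ ?_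
  · obtain ⟨n, rfl⟩ : ∃ n, p = n + 2 := ⟨p - 2, by have := hp.two_le; omega⟩
    rw [map_pow, pow_succ]
    refine mul_le_mul_left ?_ _
    rw [pow_succ]
    exact (mul_le_of_le_one_left' (pow_le_one₀ zero_le hint)).trans hx
  · rw [map_mul, map_mul]
    exact (mul_le_of_le_one_right' r.2).trans (mul_le_mul_left hpδ _)

theorem exists_pow_prime_pow_sub_one_lt [MulArchimedean Γ] {p : ℕ} (hp : p.Prime)
    (hwp : w (p : A) < 1) {x : A} (hx : w (x - 1) < 1) {γ : Γ} (hγ : γ ≠ 0) :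
    ∃ n, w (x ^ p ^ n - 1) < γ := by
  set δ := max (w (p : A)) (w (x - 1)) with hδdef
  have hδ : δ < 1 := max_lt hwp hx
  have key : ∀ n, w (x ^ p ^ n - 1) ≤ δ ^ n * δ := by
    intro n
    induction n with
    | zero => simp [hδdef]
    | succ n ih =>
      have h1 : δ ^ n * δ ≤ δ := mul_le_of_le_one_left' (pow_le_one₀ zero_le hδ.le)
      rw [pow_succ p, pow_mul]
      refine (valuation_pow_prime_sub_one_le hp hδ (le_max_left _ _) (ih.trans h1)).trans ?_
      rw [pow_succ, mul_comm]
      exact mul_le_mul_left ih _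
  obtain ⟨n, hn⟩ := exists_pow_lt₀ hδ (Units.mk0 γ hγ)
  exact ⟨n, (key n).trans_lt ((mul_le_of_le_one_right' hδ.le).trans_lt hn)⟩

variable [TopologicalSpace A]

theorem HasBallTopology.isOpen_ball [IsTopologicalRing A] (h : HasBallTopology w) {γ : Γ}
    (hγ : γ ≠ 0) (a : A) : IsOpen {x | w (x - a) < γ} := by
  rw [isOpen_iff_mem_nhds]
  intro x hx
  have h0 : {y | w y < γ} ∈ 𝓝 (x - x) := by rw [sub_self]; exact h.mem_of_mem hγ
  have hc : ContinuousAt (fun y : A => y - x) x := by fun_prop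
  filter_upwards [hc h0] with y hy
  have : y - a = (y - x) + (x - a) := by abel
  change w (y - a) < γ
  rw [this]
  exact Valuation.map_add_lt w hy hx

theorem HasBallTopology.isClosed_ball [IsTopologicalRing A] (h : HasBallTopology w) {γ : Γ}
    (hγ : γ ≠ 0) (a : A) : IsClosed {x | w (x - a) < γ} := by
  rw [← isOpen_compl_iff, isOpen_iff_mem_nhds]
  intro x hx
  have h0 : {y | w y < γ} ∈ 𝓝 (x - x) := by rw [sub_self]; exact h.mem_of_mem hγ
  have hc : ContinuousAt (fun y : A => y - x) x := by fun_prop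
  filter_upwards [hc h0] with y hy hy'
  apply hx
  have : x - a = (y - a) - (y - x) := by abel
  change w (x - a) < γ
  rw [this]
  exact Valuation.map_sub_lt w hy' hy

theorem HasBallTopology.t2Space [IsTopologicalRing A] (h : HasBallTopology w) : T2Space A := by
  have : T1Space A := by
    refine IsTopologicalAddGroup.t1Space A ?_
    rw [← isOpen_compl_iff, isOpen_iff_mem_nhds]
    intro x hx
    have hx0 : w x ≠ 0 := (Valuation.ne_zero_iff w).2 hx
    filter_upwards [(h.isOpen_ball hx0 x).mem_nhds (by simpa [zero_lt_iff] using hx)] with y hy hy0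
    rw [Set.mem_singleton_iff.1 hy0] at hy
    simp at hy
  infer_instance

/-- The groups `{x | w (x - 1) < γ}` form a basis of neighbourhoods of `1` in `Aˣ`. -/
theorem HasBallTopology.mem_nhds_one_units [IsTopologicalRing A] (h : HasBallTopology w)
    {S : Set Aˣ} (hS : S ∈ 𝓝 (1 : Aˣ)) :
    ∃ γ : Γ, γ ≠ 0 ∧ ∀ x : Aˣ, w ((x : A) - 1) < γ → x ∈ S := by
  have h1 : (𝓝 (1 : A)).HasBasis (fun γ : Γ => γ ≠ 0) (fun γ => {x | w (x - 1) < γ}) := by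
    refine ⟨fun t => ?_⟩
    have : 𝓝 (1 : A) = Filter.comap (fun x => x - 1) (𝓝 0) := by
      have := (Homeomorph.subRight (1 : A)).isInducing.nhds_eq_comap 1
      simpa using this
    rw [this]
    exact (h.comap _).mem_iff
  have hnhds : 𝓝 (1 : Aˣ) = Filter.comap ((↑) : Aˣ → A) (𝓝 1)
      ⊓ Filter.comap (fun x : Aˣ => ((x⁻¹ : Aˣ) : A)) (𝓝 1) := by
    have h2 : 𝓝 (1 : Aˣ) = Filter.comap ((↑) : Aˣ → A) (𝓝 ((1 : Aˣ) : A))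
        ⊓ Filter.comap (fun x : Aˣ => ((x⁻¹ : Aˣ) : A)) (𝓝 (((1 : Aˣ)⁻¹ : Aˣ) : A)) :=
      (congrArg (fun t => @nhds Aˣ t 1) Units.topology_eq_inf).trans
        (nhds_inf.trans (congrArg₂ (· ⊓ ·) (nhds_induced _ _) (nhds_induced _ _)))
    rwa [inv_one, Units.val_one] at h2
  rw [hnhds] at hS
  obtain ⟨T, hT, T', hT', rfl⟩ := Filter.mem_inf_iff.1 hS
  obtain ⟨γ, hγ, hγT⟩ := (h1.comap _).mem_iff.1 hT
  obtain ⟨γ', hγ', hγT'⟩ := (h1.comap _).mem_iff.1 hT'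
  -- a radius at most `1` ensures that `x⁻¹` is as close to `1` as `x`
  refine ⟨min (min γ γ') 1, ?_, fun x hx => ⟨hγT ?_, hγT' ?_⟩⟩
  · rcases min_choice (min γ γ') 1 with h2 | h2 <;> rw [h2]
    · rcases min_choice γ γ' with h3 | h3 <;> rw [h3] <;> assumption
    · exact one_ne_zero
  · exact hx.trans_le ((min_le_left _ _).trans (min_le_left _ _))
  · change w (((x⁻¹ : Aˣ) : A) - 1) < γ'
    rw [Units.val_inv_eq_inv_val, valuation_inv_sub_one w (hx.trans_le (min_le_right _ _))]
    exact hx.trans_le ((min_le_left _ _).trans (min_le_right _ _))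

theorem HasBallTopology.isOpen_principalUnits [IsTopologicalRing A] (h : HasBallTopology w) :
    IsOpen (principalUnits w : Set Aˣ) :=
  (h.isOpen_ball one_ne_zero 1).preimage Units.continuous_val

theorem HasBallTopology.isCompact_principalUnits [IsTopologicalRing A] (h : HasBallTopology w)
    (hc : IsCompact {x | w x ≤ 1}) : IsCompact (principalUnits w : Set Aˣ) := by
  have := h.t2Space
  have hball : IsCompact {x | w (x - 1) < 1} :=
    hc.of_isClosed_subset (h.isClosed_ball one_ne_zero 1) fun x hx => by
      have : x = (x - 1) + 1 := by abel
      change w x ≤ 1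
      rw [this]
      exact Valuation.map_add_le w (le_of_lt hx) (by simp)
  have hop : IsCompact (MulOpposite.op '' {x : A | w (x - 1) < 1}) :=
    hball.image MulOpposite.continuous_op
  convert! Units.isClosedEmbedding_embedProduct.isCompact_preimage (hball.prod hop) using 1
  ext x
  simp only [SetLike.mem_coe, mem_principalUnits, Set.mem_preimage, Units.embedProduct_apply,
    Set.mem_prod, Set.mem_ofPred_eq, Set.mem_image, MulOpposite.op_inj, exists_eq_right]
  refine ⟨fun hx => ⟨hx, ?_⟩, fun hx => hx.1⟩
  rw [Units.val_inv_eq_inv_val, valuation_inv_sub_one w hx]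
  exact hx

theorem HasBallTopology.exists_pow_prime_pow_mem [IsTopologicalRing A] [MulArchimedean Γ]
    (h : HasBallTopology w) {p : ℕ} (hp : p.Prime) (hwp : w (p : A) < 1) {H : Subgroup Aˣ}
    (hH : IsOpen (H : Set Aˣ)) {x : Aˣ} (hx : x ∈ principalUnits w) : ∃ n, x ^ p ^ n ∈ H := by
  obtain ⟨γ, hγ, hγH⟩ := h.mem_nhds_one_units (hH.mem_nhds H.one_mem)
  obtain ⟨n, hn⟩ := exists_pow_prime_pow_sub_one_lt hp hwp hx hγ
  exact ⟨n, hγH _ (by simpa using hn)⟩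

end Ball

section PPower

variable {G : Type*} [Group G] [TopologicalSpace G] {k : Type*} [Field k] {p : ℕ}

/-- A character in characteristic `p` kills every element whose `p`-power powers tend to `1`. -/
theorem smoothChar_apply_eq_one [Fact p.Prime] [CharP k p] (χ : SmoothChar G k) {x : G}
    (hx : ∀ H : Subgroup G, IsOpen (H : Set G) → ∃ n, x ^ p ^ n ∈ H) : χ.1 x = 1 := by
  obtain ⟨n, hn⟩ := hx _ χ.2
  rw [MonoidHom.mem_ker, map_pow] at hn
  have h1 : ((χ.1 x : kˣ) : k) ^ p ^ n = 1 := by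
    rw [← Units.val_pow_eq_pow_val, hn, Units.val_one]
  have := ExpChar.prime (R := k) (Fact.out : p.Prime)
  have h2 : (χ.1 x : k) = 1 := by
    apply iterateFrobenius_inj k p n
    rw [iterateFrobenius_def, iterateFrobenius_def, h1, one_pow]
  exact Units.ext h2

/-- A non-zero smooth representation in characteristic `p` of a compact group in which
`p`-power powers tend to `1` has a non-zero fixed vector: the additive group generated by an orbit
is a finite `p`-group acted on through a finite `p`-group. -/
theorem exists_ne_zero_fixed_of_isSmooth [IsTopologicalGroup G] [Fact p.Prime] [CharP k p]
    {V : Type*} [AddCommGroup V] [Module k V] [Nontrivial V] (ρ : Representation k G V)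
    (hρ : IsSmooth ρ) (U : Subgroup G) (hU : IsCompact (U : Set G))
    (hpow : ∀ x ∈ U, ∀ H : Subgroup G, IsOpen (H : Set G) → ∃ n, x ^ p ^ n ∈ H) :
    ∃ v : V, v ≠ 0 ∧ ∀ x ∈ U, ρ x v = v := by
  obtain ⟨v, hv⟩ := exists_ne (0 : V)
  -- the orbit of `v` under `U` is finite
  let O : Set V := (fun x => ρ x v) '' (U : Set G)
  have hO : O.Finite := by
    have hcont : ∀ x : G, IsOpen {y : G | ρ y v = ρ x v} := by
      intro x
      have : {y : G | ρ y v = ρ x v} = (fun y => x⁻¹ * y) ⁻¹' (vecStab ρ v : Set G) := by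
        ext y
        change ρ y v = ρ x v ↔ ρ (x⁻¹ * y) v = v
        rw [map_mul, Module.End.mul_apply]
        constructor
        · intro h; rw [h]; simp
        · intro h
          have := congrArg (ρ x) h
          simpa using this
      rw [this]
      exact (hρ v).preimage (by fun_prop)
    obtain ⟨t, ht⟩ := hU.elim_finite_subcover (fun x : G => {y : G | ρ y v = ρ x v}) hcont
      (fun x _ => Set.mem_iUnion.2 ⟨x, rfl⟩)
    refine (t.finite_toSet.image (fun x => ρ x v)).subset ?_
    rintro _ ⟨x, hx, rfl⟩
    obtain ⟨y, hy, hxy⟩ := Set.mem_iUnion₂.1 (ht hx)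
    exact ⟨y, hy, hxy.symm⟩
  let W : AddSubgroup V := AddSubgroup.closure O
  have hpV : ∀ y : V, p • y = 0 := fun y => by
    rw [← Nat.cast_smul_eq_nsmul k, CharP.cast_eq_zero, zero_smul]
  have : Finite W := by
    have : AddGroup.FG W := (AddGroup.fg_iff_addSubgroup_fg W).2
      ((AddSubgroup.fg_iff W).2 ⟨O, rfl, hO⟩)
    have : Module.Finite ℤ W := Module.Finite.iff_addGroup_fg.2 this
    refine Module.finite_of_fg_torsion W fun y => ⟨⟨(p : ℤ), ?_⟩, ?_⟩
    · simpa [mem_nonZeroDivisors_iff_ne_zero] using (Fact.out : p.Prime).ne_zero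
    · ext
      simpa using hpV y
  have hstab : ∀ x ∈ U, ∀ y ∈ W, ρ x y ∈ W := by
    intro x hx y hy
    induction hy using AddSubgroup.closure_induction with
    | mem y hy =>
      obtain ⟨z, hz, rfl⟩ := hy
      refine AddSubgroup.subset_closure ⟨x * z, U.mul_mem hx hz, ?_⟩
      simp
    | zero => simp
    | add y z _ _ hy hz => rw [map_add]; exact W.add_mem hy hz
    | neg y _ hy => rw [map_neg]; exact W.neg_mem hy
  let _ : MulAction U W :=
    { smul := fun x y => ⟨ρ x y, hstab x x.2 y y.2⟩
      one_smul := fun y => Subtype.ext (by change ρ ((1 : U) : G) y = y; simp)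
      mul_smul := fun x x' y => Subtype.ext (by
        change ρ ((x * x' : U) : G) y = ρ x (ρ x' y); simp) }
  have hsmul : ∀ (x : U) (y : W), ((x • y : W) : V) = ρ x y := fun _ _ => rfl
  let P : Subgroup (Equiv.Perm W) := (MulAction.toPermHom U W).range
  have hP : IsPGroup p P := by
    rintro ⟨_, x, rfl⟩
    let H : Subgroup G := ⨅ y : W, vecStab ρ (y : V)
    have hH : IsOpen (H : Set G) := by
      rw [Subgroup.coe_iInf]
      exact isOpen_iInter_of_finite fun y => hρ y
    obtain ⟨n, hn⟩ := hpow x x.2 H hH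
    refine ⟨n, Subtype.ext (Equiv.ext fun y => Subtype.ext ?_)⟩
    have hy : (x : G) ^ p ^ n ∈ vecStab ρ (y : V) := (Subgroup.mem_iInf.1 hn) y
    have : (((⟨MulAction.toPermHom U W x, ⟨x, rfl⟩⟩ : P) ^ p ^ n : P) : Equiv.Perm W)
        = MulAction.toPermHom U W (x ^ p ^ n) := by
      rw [map_pow]; rfl
    rw [this]
    exact hy
  have hv' : v ∈ W := AddSubgroup.subset_closure ⟨1, U.one_mem, by simp⟩
  have hcard : p ∣ Nat.card W := by
    have h1 : addOrderOf (⟨v, hv'⟩ : W) = p :=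
      addOrderOf_eq_prime (Subtype.ext (hpV v)) (fun h => hv (congrArg Subtype.val h))
    rw [← h1]
    exact addOrderOf_dvd_natCard _
  obtain ⟨b, hb, hb0⟩ := hP.exists_fixed_point_of_prime_dvd_card_of_fixed_point (α := W) hcard
    (a := 0) (by
      rintro ⟨_, x, rfl⟩
      exact Subtype.ext (by change ρ x ((0 : W) : V) = _; simp))
  refine ⟨b, fun h => hb0 (Subtype.ext h.symm), fun x hx => ?_⟩
  exact congrArg Subtype.val (hb ⟨_, ⟨x, hx⟩, rfl⟩)

end PPower

/-! ### The topology of a quadratic division algebra over a local field -/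

section LocalFieldTopology

variable (F : Type*) [Field F] [ValuativeRel F] [TopologicalSpace F] [IsNonarchimedeanLocalField F]

theorem hasBallTopology_valuation : HasBallTopology (valuation F) :=
  IsValuativeTopology.hasBasis_nhds_zero' F

theorem t2Space_localField : T2Space F := (hasBallTopology_valuation F).t2Space

theorem isClosed_valuation_le (γ : ValueGroupWithZero F) : IsClosed {x : F | valuation F x ≤ γ} :=
  have := t2Space_localField F
  (IsNonarchimedeanLocalField.isCompact_closedBall F γ).isClosed

variable {F}

theorem exists_ne_zero_valuation_lt {γ : ValueGroupWithZero F} (hγ : γ ≠ 0) :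
    ∃ c : F, c ≠ 0 ∧ valuation F c < γ := by
  obtain ⟨r, hr0, hr1⟩ := Valuation.IsNontrivial.exists_lt_one (v := valuation F)
  obtain ⟨n, hn⟩ := exists_pow_lt₀ hr1 (Units.mk0 γ hγ)
  exact ⟨r ^ n, pow_ne_zero n hr0, by simpa using hn⟩

theorem exists_ne_zero_valuation_le_of_isCompact {ι : Type*} [TopologicalSpace ι] {K : Set ι}
    (hK : IsCompact K) {f : ι → F} (hf : Continuous f) (h0 : ∀ x ∈ K, f x ≠ 0) :
    ∃ γ : ValueGroupWithZero F, γ ≠ 0 ∧ ∀ x ∈ K, γ ≤ valuation F (f x) := by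
  have := t2Space_localField F
  have hc : IsClosed (f '' K) := (hK.image hf).isClosed
  have hn : (f '' K)ᶜ ∈ 𝓝 (0 : F) := hc.isOpen_compl.mem_nhds (by
    rintro ⟨x, hx, hx0⟩
    exact h0 x hx hx0)
  obtain ⟨γ, hγ, h⟩ := (hasBallTopology_valuation F).mem_iff.1 hn
  exact ⟨γ, hγ, fun x hx => not_lt.1 fun hlt => h hlt ⟨x, hx, rfl⟩⟩

end LocalFieldTopology

section NormTopology

variable {F : Type*} [Field F] [ValuativeRel F] [TopologicalSpace F]
  [IsNonarchimedeanLocalField F] {A : Type*} [DivisionRing A] [Algebra F A]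
  [TopologicalSpace A] [IsModuleTopology F A]

variable (F A) in
theorem continuous_algebraNorm [FiniteDimensional F A] :
    Continuous (Algebra.norm F : A → F) := by
  let b := Module.finBasis F A
  have h : (Algebra.norm F : A → F) = fun x => (Algebra.leftMulMatrix b x).det := by
    ext x
    exact Algebra.norm_eq_matrix_det b x
  rw [h]
  exact (IsModuleTopology.continuous_of_linearMap (R := F)
    (Algebra.leftMulMatrix b).toLinearMap).matrix_det

variable [IsTopologicalRing A]

/-- The norm is bounded below by the coordinates: it does not vanish on the compact unit sphere. -/
theorem exists_valuation_coord_pow_mul_le [FiniteDimensional F A] {ι : Type*} [Fintype ι]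
    (b : Module.Basis ι F A) : ∃ γ : ValueGroupWithZero F, γ ≠ 0 ∧ ∀ (x : A) (i : ι),
      valuation F (b.equivFun x i) ^ Module.finrank F A * γ ≤ valuation F (Algebra.norm F x) := by
  have hsymm : Continuous b.equivFun.symm :=
    IsModuleTopology.continuous_of_linearMap b.equivFun.symm.toLinearMap
  have key : ∀ j : ι, ∃ γ : ValueGroupWithZero F, γ ≠ 0 ∧ ∀ y : ι → F,
      (∀ i, valuation F (y i) ≤ 1) → y j = 1 →
        γ ≤ valuation F (Algebra.norm F (b.equivFun.symm y)) := by
    intro j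
    have := t2Space_localField F
    have hK : IsCompact ((Set.univ.pi fun _ : ι => {a : F | valuation F a ≤ 1})
        ∩ {y : ι → F | y j = 1}) :=
      (isCompact_univ_pi fun _ => IsNonarchimedeanLocalField.isCompact_closedBall F 1).inter_right
        (isClosed_eq (continuous_apply j) continuous_const)
    obtain ⟨γ, hγ, h⟩ := exists_ne_zero_valuation_le_of_isCompact hK
      ((continuous_algebraNorm F A).comp hsymm) (by
        rintro y ⟨-, hy⟩ h0
        rw [Function.comp_apply, Algebra.norm_eq_zero_iff, LinearEquiv.map_eq_zero_iff] at h0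
        rw [h0] at hy
        simp at hy)
    exact ⟨γ, hγ, fun y hy hj => h y ⟨fun i _ => hy i, hj⟩⟩
  choose γ hγ hle using key
  obtain ⟨j₀⟩ : Nonempty ι := b.index_nonempty
  obtain ⟨m, -, hm⟩ := Finset.exists_min_image Finset.univ γ ⟨j₀, Finset.mem_univ _⟩
  refine ⟨γ m, hγ m, fun x i => ?_⟩
  obtain ⟨j, -, hj⟩ := Finset.exists_max_image Finset.univ
    (fun i => valuation F (b.equivFun x i)) ⟨j₀, Finset.mem_univ _⟩
  rcases eq_or_ne (b.equivFun x j) 0 with h0 | h0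
  · have hi : valuation F (b.equivFun x i) = 0 := by
      have := hj i (Finset.mem_univ i)
      simpa [h0] using this
    rw [hi, zero_pow Module.finrank_pos.ne', zero_mul]
    exact zero_le
  · set a := b.equivFun x j with ha
    have hav : valuation F a ≠ 0 := (Valuation.ne_zero_iff _).2 h0
    have hx : x = a • b.equivFun.symm (a⁻¹ • b.equivFun x) := by
      rw [map_smul, LinearEquiv.symm_apply_apply, smul_inv_smul₀ h0]
    have hnorm : valuation F (Algebra.norm F x) = valuation F a ^ Module.finrank F A *
        valuation F (Algebra.norm F (b.equivFun.symm (a⁻¹ • b.equivFun x))) := by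
      conv_lhs => rw [hx, Algebra.smul_def, map_mul, Algebra.norm_algebraMap, map_mul, map_pow]
    rw [hnorm]
    refine mul_le_mul' (pow_le_pow_left₀ zero_le (hj i (Finset.mem_univ i)) _)
      ((hm j (Finset.mem_univ j)).trans (hle j _ (fun l => ?_) ?_))
    · rw [Pi.smul_apply, smul_eq_mul, map_mul, map_inv₀, ← div_eq_inv_mul,
        div_le_one₀ (zero_lt_iff.2 hav)]
      exact hj l (Finset.mem_univ l)
    · rw [Pi.smul_apply, smul_eq_mul, ← ha, inv_mul_cancel₀ h0]

variable [IsQuadraticDivisionAlgebra F A]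

variable (F A)

/-- The ring of integers of a quadratic division algebra over a local field is compact. -/
theorem isCompact_nrdVal_le_one : IsCompact {x : A | nrdVal F A x ≤ 1} := by
  let b := Module.finBasis F A
  obtain ⟨γ, hγ, h⟩ := exists_valuation_coord_pow_mul_le b
  have hsymm : Continuous b.equivFun.symm :=
    IsModuleTopology.continuous_of_linearMap b.equivFun.symm.toLinearMap
  have hK : IsCompact (b.equivFun.symm '' Set.univ.pi
      fun _ : Fin (Module.finrank F A) => {a : F | valuation F a ≤ max 1 γ⁻¹}) :=
    (isCompact_univ_pi fun _ => IsNonarchimedeanLocalField.isCompact_closedBall F _).image hsymm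
  refine hK.of_isClosed_subset ?_ fun x hx => ?_
  · simp_rw [nrdVal_le_one_iff]
    exact (isClosed_valuation_le F 1).preimage (continuous_algebraNorm F A)
  · refine ⟨b.equivFun x, fun i _ => ?_, b.equivFun.symm_apply_apply x⟩
    rw [Set.mem_ofPred_eq, nrdVal_le_one_iff] at hx
    have h1 : valuation F (b.equivFun x i) ^ Module.finrank F A ≤ γ⁻¹ := by
      rw [← one_div, le_div_iff₀ (zero_lt_iff.2 hγ)]
      exact (h x i).trans hx
    rw [Set.mem_ofPred_eq, le_max_iff]
    by_contra! hcon
    refine (hcon.2.trans_le ?_).not_ge h1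
    exact le_self_pow₀ hcon.1.le Module.finrank_pos.ne'

/-- The topology of a quadratic division algebra is that of the valuation `v ∘ Nrd`. -/
theorem hasBallTopology_nrdVal : HasBallTopology (nrdVal F A) := by
  refine ⟨fun t => ⟨fun ht => ?_, ?_⟩⟩
  · obtain ⟨s, hst, hs, h0s⟩ := mem_nhds_iff.1 ht
    have hcont : Continuous fun q : F × A => q.1 • q.2 := by fun_prop
    -- the compact unit ball is scaled into `s` by all small enough elements of `F`
    obtain ⟨U, V, hU, -, h0U, hKV, hUV⟩ := generalized_tube_lemma (isCompact_singleton (x := (0 : F)))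
      (isCompact_nrdVal_le_one F A) (hs.preimage hcont) (by
        rintro ⟨c, x⟩ ⟨hc, -⟩
        obtain rfl : c = 0 := hc
        simpa using h0s)
    obtain ⟨γ, hγ, hγU⟩ := (hasBallTopology_valuation F).mem_iff.1 (hU.mem_nhds (h0U rfl))
    obtain ⟨c, hc0, hc⟩ := exists_ne_zero_valuation_lt hγ
    have hvc : valuation F c ^ 2 ≠ 0 := pow_ne_zero 2 ((Valuation.ne_zero_iff _).2 hc0)
    refine ⟨valuation F c ^ 2, hvc, fun x hx => hst ?_⟩
    have hx' : c⁻¹ • x ∈ V := hKV (by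
      rw [Set.mem_ofPred_eq, Algebra.smul_def, map_mul, nrdVal_algebraMap, map_inv₀, inv_pow,
        ← div_eq_inv_mul, div_le_one₀ (zero_lt_iff.2 hvc)]
      exact le_of_lt hx)
    have := hUV (Set.mk_mem_prod (hγU hc) hx')
    simpa [smul_inv_smul₀ hc0] using this
  · rintro ⟨γ, hγ, hγt⟩
    refine Filter.mem_of_superset ?_ hγt
    have h1 : min 1 (γ ^ Module.finrank F A) ≠ 0 := by
      rcases min_choice 1 (γ ^ Module.finrank F A) with h | h <;> rw [h]
      · exact one_ne_zero
      · exact pow_ne_zero _ hγ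
    have h2 : {z : F | valuation F z < min 1 (γ ^ Module.finrank F A)}
        ∈ 𝓝 (Algebra.norm F (0 : A)) := by
      rw [Algebra.norm_zero]
      exact (hasBallTopology_valuation F).mem_of_mem h1
    filter_upwards [(continuous_algebraNorm F A).continuousAt h2] with x hx
    have hx1 : valuation F (Algebra.norm F x) < 1 := lt_of_lt_of_le hx (min_le_left _ _)
    have hx2 : valuation F (Algebra.norm F x) < γ ^ Module.finrank F A :=
      lt_of_lt_of_le hx (min_le_right _ _)
    change nrdVal F A x < γ
    rw [← pow_lt_pow_iff_left₀ zero_le zero_le (Module.finrank_pos (R := F) (M := A)).ne',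
      nrdVal_pow_finrank]
    exact (pow_le_of_le_one zero_le hx1.le two_ne_zero).trans_lt hx2

end NormTopology

/-! ### Quadratic extensions of fields -/

section QuadraticExtension

variable {F E : Type*} [Field F] [Field E] [Algebra F E] [Algebra.IsQuadraticExtension F E]

theorem exists_eq_algebraMap_add_smul {b : E} (hb : b ∉ Set.range (algebraMap F E)) (e : E) :
    ∃ r s : F, e = algebraMap F E r + s • b := by
  have hli : LinearIndependent F ![(1 : E), b] := by
    rw [LinearIndependent.pair_iff' one_ne_zero]
    intro a ha
    exact hb ⟨a, by rw [← ha, Algebra.smul_def, mul_one]⟩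
  have hspan := hli.span_eq_top_of_card_eq_finrank
    (by simp [Algebra.IsQuadraticExtension.finrank_eq_two F E])
  have he : e ∈ Submodule.span F (Set.range ![(1 : E), b]) := hspan ▸ Submodule.mem_top
  rw [Matrix.range_cons, Matrix.range_cons, Matrix.range_empty, Set.union_empty,
    Set.singleton_union, Submodule.mem_span_pair] at he
  obtain ⟨r, s, h⟩ := he
  exact ⟨r, s, by rw [← h, Algebra.algebraMap_eq_smul_one]⟩

theorem algHom_apply_eq_of_apply_eq {A : Type*} [Ring A] [Algebra F A] {b : E}
    (hb : b ∉ Set.range (algebraMap F E)) {φ ψ : E →ₐ[F] A} (h : φ b = ψ b) : φ = ψ := by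
  ext e
  obtain ⟨r, s, rfl⟩ := exists_eq_algebraMap_add_smul hb e
  simp [h]

/-- A quadratic extension `E = F(b)` maps to any algebra containing a root of the minimal
polynomial of `b`. -/
theorem exists_algHom_apply_eq {A : Type*} [Ring A] [Algebra F A] {b : E}
    (hb : b ∉ Set.range (algebraMap F E)) {t c : F} (hbb : b * b = t • b - algebraMap F E c)
    {x : A} (hx : x * x = t • x - algebraMap F A c) : ∃ φ : E →ₐ[F] A, φ b = x := by
  set f : Polynomial F :=
    Polynomial.X ^ 2 - Polynomial.C t * Polynomial.X + Polynomial.C c with hf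
  have hroot : ∀ {B : Type _} [Ring B] [Algebra F B] {y : B}, y * y = t • y - algebraMap F B c →
      Polynomial.aeval y f = 0 := by
    intro B _ _ y hy
    simp only [hf, map_add, map_sub, map_mul, map_pow, Polynomial.aeval_X, Polynomial.aeval_C]
    rw [pow_two, hy, Algebra.smul_def]
    abel
  have hroot' : Polynomial.aeval x f = 0 := by
    simp only [hf, map_add, map_sub, map_mul, map_pow, Polynomial.aeval_X, Polynomial.aeval_C]
    rw [pow_two, hx, Algebra.smul_def]
    abel
  have hmin : minpoly F b = f := minpoly_eq_of_mul_self_eq hb hbb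
  have hirr : Irreducible f := hmin ▸ minpoly.irreducible (Algebra.IsIntegral.isIntegral b)
  have : Fact (Irreducible f) := ⟨hirr⟩
  obtain ⟨ψ, hψ⟩ := exists_algHom_adjoinRoot (hroot hbb)
  obtain ⟨χ, hχ⟩ := exists_algHom_adjoinRoot hroot'
  let pb := AdjoinRoot.powerBasis hirr.ne_zero
  have : FiniteDimensional F (AdjoinRoot f) := pb.finite
  have hdeg : f.natDegree = 2 := by rw [hf]; compute_degree!
  have hbij : Function.Bijective ψ := by
    refine ⟨ψ.toRingHom.injective,
      (LinearMap.injective_iff_surjective_of_finrank_eq_finrank (f := ψ.toLinearMap) ?_).1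
        ψ.toRingHom.injective⟩
    rw [pb.finrank, AdjoinRoot.powerBasis_dim, hdeg,
      Algebra.IsQuadraticExtension.finrank_eq_two F E]
  let e := AlgEquiv.ofBijective ψ hbij
  refine ⟨χ.comp e.symm.toAlgHom, ?_⟩
  have : e.symm b = AdjoinRoot.root f := by
    rw [AlgEquiv.symm_apply_eq]
    exact hψ.symm
  change χ (e.symm b) = x
  rw [this, hχ]

theorem algHom_bijective {E' : Type*} [Field E'] [Algebra F E']
    [Algebra.IsQuadraticExtension F E'] (φ : E →ₐ[F] E') : Function.Bijective φ :=
  ⟨φ.toRingHom.injective,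
    (LinearMap.injective_iff_surjective_of_finrank_eq_finrank (f := φ.toLinearMap) (by
      rw [Algebra.IsQuadraticExtension.finrank_eq_two F E,
        Algebra.IsQuadraticExtension.finrank_eq_two F E'])).1 φ.toRingHom.injective⟩

theorem norm_eq_redNorm (e : E) : Algebra.norm F e = redNorm F e := by
  by_cases h : e ∈ Set.range (algebraMap F E)
  · obtain ⟨a, rfl⟩ := h
    rw [Algebra.norm_algebraMap, redNorm_algebraMap,
      Algebra.IsQuadraticExtension.finrank_eq_two F E]
  · obtain ⟨m, hm, hn⟩ := exists_natDegree_mul_eq_and_norm_eq (F := F) e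
    have hdeg := natDegree_minpoly_eq_two (F := F) h
    rw [hdeg, Algebra.IsQuadraticExtension.finrank_eq_two F E] at hm
    have hm1 : m = 1 := by omega
    rw [hn, hm1, hdeg, redNorm, hdeg]
    simp

theorem apply_eq_self_iff {θ : E ≃ₐ[F] E} (hθ : θ ≠ AlgEquiv.refl) {e : E} :
    θ e = e ↔ e ∈ Set.range (algebraMap F E) := by
  refine ⟨fun h => ?_, ?_⟩
  · by_contra he
    apply hθ
    have : θ.toAlgHom = AlgHom.id F E := algHom_apply_eq_of_apply_eq he h
    ext y
    exact DFunLike.congr_fun this y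
  · rintro ⟨a, rfl⟩
    exact θ.commutes a

theorem mul_apply_eq_algebraMap_norm {θ : E ≃ₐ[F] E} (hθ : θ ≠ AlgEquiv.refl) (e : E) :
    e * θ e = algebraMap F E (Algebra.norm F e) := by
  rw [norm_eq_redNorm]
  by_cases h : e ∈ Set.range (algebraMap F E)
  · obtain ⟨a, rfl⟩ := h
    rw [redNorm_algebraMap, θ.commutes, map_pow, pow_two]
  · obtain ⟨t, ht, -⟩ := exists_minpoly_eq (F := F) h
    have ht' : θ e * θ e = t • θ e - algebraMap F E (redNorm F e) := by
      rw [← map_mul, ht, map_sub, map_smul, θ.commutes]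
    rw [Algebra.smul_def] at ht ht'
    have hne : θ e - e ≠ 0 := fun h0 => h ((apply_eq_self_iff hθ).1 (sub_eq_zero.1 h0))
    have h2 : θ e + e = algebraMap F E t := by
      apply mul_left_cancel₀ hne
      linear_combination ht' - ht
    rw [← eq_sub_iff_add_eq] at h2
    rw [h2]
    linear_combination -ht

end QuadraticExtension

/-! ### Quadratic extensions of local fields -/

section LocalExtension

variable {F : Type*} [Field F] [ValuativeRel F]
  {E : Type*} [Field E] [ValuativeRel E] [Algebra F E] [ValuativeExtension F E]

instance : (valuation F).HasExtension (valuation E) where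
  val_isEquiv_comap := by
    intro a b
    rw [Valuation.comap_apply, Valuation.comap_apply,
      ← ValuativeExtension.mapValueGroupWithZero_valuation,
      ← ValuativeExtension.mapValueGroupWithZero_valuation]
    exact ValuativeExtension.mapValueGroupWithZero_strictMono.le_iff_le.symm

theorem exists_valuation_eq_algebraMap (hE : IsUnramifiedExt F E) {e : E} (he : e ≠ 0) :
    ∃ a : F, a ≠ 0 ∧ valuation E e = valuation E (algebraMap F E a) := by
  have htop := Subgroup.index_eq_one.1 hE
  have he' : valuation E e ≠ 0 := (Valuation.ne_zero_iff _).2 he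
  obtain ⟨γ, hγ⟩ : Units.mk0 _ he' ∈ (Units.map (ValuativeExtension.mapValueGroupWithZero F E :
    ValueGroupWithZero F →* ValueGroupWithZero E)).range := htop ▸ Subgroup.mem_top _
  obtain ⟨a, ha⟩ := ValuativeRel.valuation_surjective (γ : ValueGroupWithZero F)
  refine ⟨a, ?_, ?_⟩
  · rintro rfl
    rw [map_zero] at ha
    exact γ.ne_zero ha.symm
  · have := congrArg Units.val hγ
    rw [← ValuativeExtension.mapValueGroupWithZero_valuation, ha]
    exact this.symm

variable [TopologicalSpace F] [IsNonarchimedeanLocalField F] [Algebra.IsQuadraticExtension F E]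

theorem valuation_le_one_of_nrdVal_le_one {e : E} (he : nrdVal F E e ≤ 1) : valuation E e ≤ 1 := by
  obtain ⟨t, ht, h⟩ := exists_nrdVal_integral_equation he
  by_contra! hlt
  have h0 : 0 < valuation E e := zero_lt_one.trans hlt
  have ht' : valuation E (algebraMap F E t) ≤ 1 :=
    (Valuation.HasExtension.val_map_le_one_iff (valuation F) (valuation E) t).2 ht
  have hc' : valuation E (algebraMap F E (redNorm F e)) ≤ 1 :=
    (Valuation.HasExtension.val_map_le_one_iff (valuation F) (valuation E) _).2 he
  have h1 : valuation E (e * e) ≤ valuation E e := by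
    rw [h, Algebra.smul_def]
    refine Valuation.map_sub_le _ ?_ (hc'.trans hlt.le)
    rw [map_mul]
    exact mul_le_of_le_one_left' ht'
  rw [map_mul] at h1
  exact h1.not_gt (lt_mul_of_one_lt_left h0 hlt)

/-- The valuation of `E` is determined by that of `F`, through the norm. -/
theorem valuation_sq_eq (e : E) :
    valuation E e ^ 2 = valuation E (algebraMap F E (redNorm F e)) := by
  have key : ∀ e : E, nrdVal F E e = 1 → valuation E e = 1 := by
    intro e he
    refine le_antisymm (valuation_le_one_of_nrdVal_le_one he.le) ?_
    have := valuation_le_one_of_nrdVal_le_one (F := F) (e := e⁻¹) (by rw [map_inv₀, he, inv_one])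
    rw [map_inv₀] at this
    by_contra! hlt
    have he0 : e ≠ 0 := by rintro rfl; simp at he
    exact this.not_gt ((one_lt_inv₀ (zero_lt_iff.2 ((Valuation.ne_zero_iff _).2 he0))).2 hlt)
  rcases eq_or_ne e 0 with rfl | he
  · simp [redNorm_zero]
  have hc : redNorm F e ≠ 0 := fun h => he (redNorm_eq_zero_iff.1 h)
  have h1 := key (e ^ 2 / algebraMap F E (redNorm F e)) (by
    rw [map_div₀, map_pow, nrdVal_algebraMap, nrdVal_apply, div_self]
    exact pow_ne_zero 2 ((Valuation.ne_zero_iff _).2 hc))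
  rw [map_div₀, map_pow, div_eq_one_iff_eq] at h1
  · exact h1
  · exact (Valuation.ne_zero_iff _).2 (by simpa using hc)

theorem nrdVal_lt_one_iff_valuation {e : E} : nrdVal F E e < 1 ↔ valuation E e < 1 := by
  rw [← pow_lt_one_iff (M := ValueGroupWithZero E) two_ne_zero, valuation_sq_eq (F := F),
    Valuation.HasExtension.val_map_lt_one_iff (valuation F), nrdVal_apply]

theorem nrdVal_le_one_iff_valuation {e : E} : nrdVal F E e ≤ 1 ↔ valuation E e ≤ 1 := by
  rw [← pow_le_one_iff (M := ValueGroupWithZero E) two_ne_zero, valuation_sq_eq (F := F),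
    Valuation.HasExtension.val_map_le_one_iff (valuation F), nrdVal_apply]

theorem nrdVal_eq_one_iff_valuation {e : E} : nrdVal F E e = 1 ↔ valuation E e = 1 := by
  rw [le_antisymm_iff, le_antisymm_iff, nrdVal_le_one_iff_valuation,
    ← not_lt (a := nrdVal F E e), ← not_lt (a := valuation E e), nrdVal_lt_one_iff_valuation]

theorem exists_nrdVal_eq_valuation_sq (hE : IsUnramifiedExt F E) {e : E} (he : e ≠ 0) :
    ∃ a : F, a ≠ 0 ∧ nrdVal F E e = valuation F a ^ 2 := by
  obtain ⟨a, ha, h⟩ := exists_valuation_eq_algebraMap hE he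
  refine ⟨a, ha, ?_⟩
  have ha' : valuation F a ^ 2 ≠ 0 := pow_ne_zero 2 ((Valuation.ne_zero_iff _).2 ha)
  have h1 : nrdVal F E (e / algebraMap F E a) = 1 := by
    rw [nrdVal_eq_one_iff_valuation, map_div₀, h, div_self]
    exact (Valuation.ne_zero_iff _).2 (by simpa using ha)
  rwa [map_div₀, nrdVal_algebraMap, div_eq_one_iff_eq ha'] at h1

theorem valuation_algEquiv (θ : E ≃ₐ[F] E) (e : E) : valuation E (θ e) = valuation E e := by
  apply (pow_left_inj₀ zero_le zero_le two_ne_zero).1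
  have h : redNorm F (θ e) = redNorm F e := redNorm_algHom (A := E) θ.toAlgHom e
  rw [valuation_sq_eq (F := F), valuation_sq_eq (F := F), h]

end LocalExtension

/-! ### Residual quadratic polynomials -/

theorem exists_simple_root_of_finrank_eq_two {k l : Type*} [Field k] [Field l] [Algebra k l]
    [Finite l] [Algebra.IsQuadraticExtension k l] {f : Polynomial k} (hirr : Irreducible f)
    (hdeg : f.natDegree = 2) :
    ∃ r : l, Polynomial.aeval r f = 0 ∧ Polynomial.aeval r (Polynomial.derivative f) ≠ 0 := by
  have : Finite k := Finite.of_injective _ (algebraMap k l).injective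
  have : Fact (Irreducible f) := ⟨hirr⟩
  let pb := AdjoinRoot.powerBasis hirr.ne_zero
  have : FiniteDimensional k (AdjoinRoot f) := pb.finite
  have : Finite (AdjoinRoot f) := Module.finite_of_finite k
  obtain ⟨φ⟩ := FiniteField.nonempty_algHom_of_finrank_dvd (F := k) (K := AdjoinRoot f)
    (L := l) (by rw [pb.finrank, AdjoinRoot.powerBasis_dim, hdeg,
      Algebra.IsQuadraticExtension.finrank_eq_two])
  have hroot : Polynomial.aeval (φ (AdjoinRoot.root f)) f = 0 := by
    rw [Polynomial.aeval_algHom_apply, AdjoinRoot.aeval_eq, AdjoinRoot.mk_self, map_zero]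
  refine ⟨_, hroot, fun h0 => ?_⟩
  obtain ⟨a, b, hab⟩ := PerfectField.separable_of_irreducible hirr
  have h := congrArg (Polynomial.aeval (φ (AdjoinRoot.root f))) hab
  rw [map_add, map_mul, map_mul, hroot, h0, mul_zero, mul_zero, map_one, add_zero] at h
  exact zero_ne_one h

section Residue

variable {F : Type*} [Field F] [ValuativeRel F] [TopologicalSpace F] [IsNonarchimedeanLocalField F]

variable (F) in
theorem exists_uniformizer : ∃ ϖ : F, ϖ ≠ 0 ∧ valuation F ϖ < 1 ∧
    ∀ a : F, valuation F a < 1 → valuation F a ≤ valuation F ϖ := by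
  obtain ⟨ϖ, hϖ⟩ := ValuativeRel.valuation_surjective (uniformizer F)
  refine ⟨ϖ, ?_, hϖ ▸ uniformizer_lt_one, fun a ha => ?_⟩
  · rw [← Valuation.ne_zero_iff (valuation F), hϖ]
    exact uniformizer_ne_zero
  · rw [hϖ]
    exact le_uniformizer_iff.2 ha

theorem residue_eq_zero_iff {x : 𝒪[F]} :
    IsLocalRing.residue 𝒪[F] x = 0 ↔ valuation F (x : F) < 1 := by
  rw [IsLocalRing.residue_eq_zero_iff, mem_maximalIdeal_integer_iff]

/-- An integral element of a quadratic division algebra that is not congruent to an element of `F`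
satisfies an integral quadratic equation with irreducible reduction. -/
theorem exists_irreducible_reduction {A : Type*} [DivisionRing A] [Algebra F A]
    [IsQuadraticDivisionAlgebra F A] {x : A} (hx : nrdVal F A x ≤ 1)
    (hx' : ∀ a : F, 1 ≤ nrdVal F A (x - algebraMap F A a)) :
    ∃ t c : 𝒪[F], x * x = (t : F) • x - algebraMap F A c ∧
      Irreducible (Polynomial.X ^ 2 - Polynomial.C (IsLocalRing.residue 𝒪[F] t) * Polynomial.X
        + Polynomial.C (IsLocalRing.residue 𝒪[F] c)) := by
  obtain ⟨t, ht, h⟩ := exists_nrdVal_integral_equation hx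
  have hxF : ∀ a : F, x - algebraMap F A a ∉ Set.range (algebraMap F A) := by
    rintro a ⟨b, hb⟩
    have := hx' (b + a)
    rw [map_add, hb, sub_add_cancel, sub_self, map_zero] at this
    exact this.not_gt zero_lt_one
  refine ⟨⟨t, ht⟩, ⟨redNorm F x, hx⟩, h, ?_⟩
  set f : Polynomial 𝓀[F] :=
    Polynomial.X ^ 2 - Polynomial.C (IsLocalRing.residue 𝒪[F] ⟨t, ht⟩) * Polynomial.X
      + Polynomial.C (IsLocalRing.residue 𝒪[F] ⟨redNorm F x, hx⟩) with hf
  have hdeg : f.natDegree = 2 := by rw [hf]; compute_degree!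
  have hmon : f.Monic := by rw [hf]; monicity!
  rw [Polynomial.irreducible_iff_roots_eq_zero_of_degree_le_three hdeg.ge (by omega)]
  rw [Multiset.eq_zero_iff_forall_notMem]
  intro r hr
  rw [Polynomial.mem_roots hmon.ne_zero] at hr
  obtain ⟨a, rfl⟩ := IsLocalRing.residue_surjective r
  have h1 : valuation F ((a : F) ^ 2 - t * a + redNorm F x) < 1 := by
    have h2 : IsLocalRing.residue 𝒪[F] (a ^ 2 - ⟨t, ht⟩ * a + ⟨redNorm F x, hx⟩) = 0 := by
      simpa [hf] using hr
    rw [residue_eq_zero_iff] at h2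
    simpa using h2
  have h3 : redNorm F (x - algebraMap F A a) = (a : F) ^ 2 - t * a + redNorm F x := by
    refine redNorm_eq_of_mul_self_eq (hxF a) (t := t - 2 * a) ?_
    rw [mul_sub, sub_mul, sub_mul, h]
    simp only [map_add, map_sub, map_mul, Algebra.smul_def, two_mul, pow_two, mul_sub, sub_mul, add_mul]
    rw [← Algebra.commutes (a : F) x]
    abel
  have h4 := hx' a
  rw [nrdVal_apply, h3] at h4
  exact h4.not_gt h1

variable {E : Type*} [Field E] [ValuativeRel E] [Algebra F E] [ValuativeExtension F E]
  [TopologicalSpace E] [IsNonarchimedeanLocalField E]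

theorem algebraMap_residue (t : 𝒪[F]) : algebraMap 𝓀[F] 𝓀[E] (IsLocalRing.residue 𝒪[F] t)
    = IsLocalRing.residue 𝒪[E] (algebraMap 𝒪[F] 𝒪[E] t) := rfl

/-- A root of an integral quadratic polynomial with irreducible reduction is not congruent to its
conjugate, the residue field being perfect. -/
theorem valuation_two_mul_sub_eq_one {t c : 𝒪[F]}
    (hirr : Irreducible (Polynomial.X ^ 2 - Polynomial.C (IsLocalRing.residue 𝒪[F] t) *
      Polynomial.X + Polynomial.C (IsLocalRing.residue 𝒪[F] c)))
    {e : E} (he : valuation E e ≤ 1) (hee : e * e = (t : F) • e - algebraMap F E c) :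
    valuation E (2 * e - algebraMap F E t) = 1 := by
  let e' : 𝒪[E] := ⟨e, he⟩
  have hee' : e' * e' = algebraMap 𝒪[F] 𝒪[E] t * e' - algebraMap 𝒪[F] 𝒪[E] c := by
    ext
    change e * e = algebraMap F E t * e - algebraMap F E c
    rw [hee, Algebra.smul_def]
  obtain ⟨a, b, hab⟩ := PerfectField.separable_of_irreducible hirr
  have h := congrArg (Polynomial.aeval (IsLocalRing.residue 𝒪[E] e')) hab
  have hroot := congrArg (IsLocalRing.residue 𝒪[E]) hee'
  simp only [map_mul, map_sub] at hroot
  simp only [map_add, map_mul, map_sub, map_pow, Polynomial.aeval_X, Polynomial.aeval_C,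
    Polynomial.derivative_C_mul, Polynomial.derivative_X_pow, Polynomial.derivative_X, Polynomial.derivative_C, map_one,
    algebraMap_residue, map_natCast, mul_one, add_zero] at h
  rw [pow_two, hroot, sub_sub_cancel_left, neg_add_cancel, mul_zero, zero_add] at h
  have hne : IsLocalRing.residue 𝒪[E] (2 * e' - algebraMap 𝒪[F] 𝒪[E] t) ≠ 0 := by
    intro h0
    rw [map_sub, map_mul, map_ofNat] at h0
    simp only [Nat.cast_ofNat, Nat.reduceSub, pow_one] at h
    rw [h0, mul_zero] at h
    exact zero_ne_one h
  rw [Ne, residue_eq_zero_iff, not_lt] at hne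
  exact le_antisymm (2 * e' - algebraMap 𝒪[F] 𝒪[E] t).2 hne

end Residue

section UnramifiedQuadratic

variable {F : Type*} [Field F] [ValuativeRel F] [TopologicalSpace F] [IsNonarchimedeanLocalField F]
  {E : Type*} [Field E] [ValuativeRel E]
  [Algebra F E] [ValuativeExtension F E] [Algebra.IsQuadraticExtension F E]

/-- An unramified quadratic extension has a non-trivial residue extension: otherwise an element
generating it would be a limit of elements `a` of `F`, at which its minimal polynomial takes
arbitrarily small values; but it has no root in the compact ring of integers of `F`. -/
theorem exists_residue_generator (hE : IsUnramifiedExt F E) :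
    ∃ b : E, nrdVal F E b ≤ 1 ∧ ∀ a : F, 1 ≤ nrdVal F E (b - algebraMap F E a) := by
  by_contra! hcon
  obtain ⟨x, hx⟩ : ∃ x : E, x ∉ Set.range (algebraMap F E) := by
    by_contra! hall
    have := LinearMap.finrank_le_finrank_of_surjective (f := Algebra.linearMap F E) hall
    rw [Module.finrank_self, Algebra.IsQuadraticExtension.finrank_eq_two F E] at this
    omega
  -- an integral multiple of `x`
  obtain ⟨b, hb, hb1⟩ : ∃ b : E, b ∉ Set.range (algebraMap F E) ∧ nrdVal F E b ≤ 1 := by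
    have hx0 : x ≠ 0 := by rintro rfl; exact hx ⟨0, map_zero _⟩
    obtain ⟨a, ha, h⟩ := exists_nrdVal_eq_valuation_sq hE hx0
    refine ⟨x / algebraMap F E a, ?_, ?_⟩
    · rintro ⟨s, hs⟩
      refine hx ⟨s * a, ?_⟩
      rw [map_mul, hs, div_mul_cancel₀]
      simpa using ha
    · rw [map_div₀, nrdVal_algebraMap, h, div_self]
      exact pow_ne_zero 2 ((Valuation.ne_zero_iff _).2 ha)
  obtain ⟨t, ht, hbb⟩ := exists_nrdVal_integral_equation hb1
  have hbv : valuation E b ≤ 1 := nrdVal_le_one_iff_valuation.1 hb1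
  obtain ⟨ϖ, hϖ0, hϖ1, hϖ⟩ := exists_uniformizer F
  have := hasBallTopology_valuation F
  have hF := IsNonarchimedeanLocalField.isCompact_closedBall F 1
  obtain ⟨γ, hγ, hle⟩ := exists_ne_zero_valuation_le_of_isCompact hF
    (f := fun s : F => s ^ 2 - t * s + redNorm F b) (by fun_prop)
    (fun s _ => no_root_of_minpoly_eq hb hbb s)
  have hϖE0 : valuation E (algebraMap F E ϖ) ≠ 0 :=
    (Valuation.ne_zero_iff _).2 (by simpa using hϖ0)
  -- approximations of `b` by elements of `F`, improved one digit at a time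
  have happrox : ∀ n : ℕ, ∃ a : F,
      valuation E (b - algebraMap F E a) ≤ valuation E (algebraMap F E ϖ) ^ n := by
    intro n
    induction n with
    | zero => exact ⟨0, by simpa using hbv⟩
    | succ n ih =>
      obtain ⟨a, ha⟩ := ih
      have hpow : algebraMap F E ϖ ^ n ≠ 0 := pow_ne_zero n (by simpa using hϖ0)
      obtain ⟨d, hd⟩ := hcon ((b - algebraMap F E a) / algebraMap F E ϖ ^ n) (by
        rw [nrdVal_le_one_iff_valuation, map_div₀, map_pow]
        exact (div_le_one₀ (zero_lt_iff.2 (pow_ne_zero n hϖE0))).2 ha)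
      rw [nrdVal_lt_one_iff_valuation] at hd
      refine ⟨a + ϖ ^ n * d, ?_⟩
      have h1 : b - algebraMap F E (a + ϖ ^ n * d) = algebraMap F E ϖ ^ n *
          ((b - algebraMap F E a) / algebraMap F E ϖ ^ n - algebraMap F E d) := by
        rw [mul_sub, mul_div_cancel₀ _ hpow, map_add, map_mul, map_pow]
        ring
      rw [h1, map_mul, map_pow, pow_succ]
      refine mul_le_mul_right ?_ _
      set y := (b - algebraMap F E a) / algebraMap F E ϖ ^ n - algebraMap F E d
      rcases eq_or_ne y 0 with hy | hy
      · rw [hy, map_zero]; exact zero_le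
      · obtain ⟨s, -, hs⟩ := exists_valuation_eq_algebraMap hE hy
        rw [hs] at hd ⊢
        rw [Valuation.HasExtension.val_map_le_iff (valuation F)]
        exact hϖ s ((Valuation.HasExtension.val_map_lt_one_iff (valuation F) _ s).1 hd)
  -- at a close approximation the polynomial takes a value below its lower bound `γ`
  obtain ⟨n, hn⟩ := exists_pow_lt₀ hϖ1 (Units.mk0 γ hγ)
  obtain ⟨a, ha⟩ := happrox n
  have hϖE1 : valuation E (algebraMap F E ϖ) ≤ 1 :=
    (Valuation.HasExtension.val_map_le_one_iff (valuation F) _ ϖ).2 hϖ1.le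
  have hba : valuation E (b - algebraMap F E a) ≤ 1 := ha.trans (pow_le_one₀ zero_le hϖE1)
  have haE : valuation E (algebraMap F E a) ≤ 1 := by
    have : algebraMap F E a = b - (b - algebraMap F E a) := by ring
    rw [this]
    exact Valuation.map_sub_le _ hbv hba
  have htE : valuation E (algebraMap F E t) ≤ 1 :=
    (Valuation.HasExtension.val_map_le_one_iff (valuation F) _ t).2 ht
  refine (hle a ((Valuation.HasExtension.val_map_le_one_iff (valuation F) _ a).1 haE)).not_gt ?_
  refine lt_of_le_of_lt ?_ hn
  rw [← map_pow, ← Valuation.HasExtension.val_map_le_iff (valuation F) (valuation E)]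
  have h2 : algebraMap F E (a ^ 2 - t * a + redNorm F b)
      = (b - algebraMap F E a) * (algebraMap F E t - b - algebraMap F E a) := by
    rw [Algebra.smul_def] at hbb
    simp only [map_add, map_sub, map_mul, map_pow]
    linear_combination hbb
  rw [h2, map_mul, map_pow (algebraMap F E), map_pow]
  refine (mul_le_of_le_one_right' ?_).trans ha
  exact Valuation.map_sub_le _ (Valuation.map_sub_le _ htE hbv) haE

variable [TopologicalSpace E] [IsNonarchimedeanLocalField E]

/-- The residue extension of an unramified quadratic extension is quadratic. -/
theorem isQuadraticExtension_residueField (hE : IsUnramifiedExt F E) :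
    Algebra.IsQuadraticExtension 𝓀[F] 𝓀[E] := by
  have hfin : FiniteDimensional 𝓀[F] 𝓀[E] := Module.Finite.of_finite
  have h1 : Module.finrank 𝓀[F] 𝓀[E] ≤ 2 := by
    obtain ⟨ζ, hζ⟩ := Field.exists_primitive_element_of_finite_top 𝓀[F] 𝓀[E]
    obtain ⟨x, rfl⟩ := IsLocalRing.residue_surjective ζ
    obtain ⟨t, ht, h⟩ := exists_nrdVal_integral_equation (F := F) (x := (x : E))
      (nrdVal_le_one_iff_valuation.2 x.2)
    have hc : valuation F (redNorm F (x : E)) ≤ 1 := nrdVal_le_one_iff_valuation.2 x.2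
    have h' : x * x = algebraMap 𝒪[F] 𝒪[E] ⟨t, ht⟩ * x - algebraMap 𝒪[F] 𝒪[E] ⟨_, hc⟩ := by
      ext
      change (x : E) * x = algebraMap F E t * x - algebraMap F E (redNorm F (x : E))
      rw [h, Algebra.smul_def]
    have h2 := congrArg (IsLocalRing.residue 𝒪[E]) h'
    simp only [map_mul, map_sub, ← algebraMap_residue] at h2
    rw [← (Field.primitive_element_iff_minpoly_natDegree_eq 𝓀[F] _).1 hζ]
    have hmon : (Polynomial.X ^ 2 - Polynomial.C (IsLocalRing.residue 𝒪[F] ⟨t, ht⟩) * Polynomial.X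
      + Polynomial.C (IsLocalRing.residue 𝒪[F] ⟨redNorm F (x : E), hc⟩)).Monic := by monicity!
    have hle := Polynomial.natDegree_le_of_dvd
      (minpoly.dvd 𝓀[F] (IsLocalRing.residue 𝒪[E] x) (p := Polynomial.X ^ 2 -
        Polynomial.C (IsLocalRing.residue 𝒪[F] ⟨t, ht⟩) * Polynomial.X
        + Polynomial.C (IsLocalRing.residue 𝒪[F] ⟨redNorm F (x : E), hc⟩)) (by
          simp only [map_add, map_mul, map_sub, map_pow, Polynomial.aeval_X, Polynomial.aeval_C]
          rw [pow_two, h2]; ring)) hmon.ne_zero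
    refine hle.trans (le_of_eq ?_)
    compute_degree!
  have h2 : Module.finrank 𝓀[F] 𝓀[E] ≠ 1 := by
    intro h
    obtain ⟨b, hb, hb'⟩ := exists_residue_generator hE
    rw [nrdVal_le_one_iff_valuation] at hb
    obtain ⟨r, hr⟩ := (Subalgebra.bot_eq_top_iff_finrank_eq_one.2 h ▸ Algebra.mem_top :
      IsLocalRing.residue 𝒪[E] ⟨b, hb⟩ ∈ (⊥ : Subalgebra 𝓀[F] 𝓀[E]))
    obtain ⟨a, rfl⟩ := IsLocalRing.residue_surjective r
    have h3 : IsLocalRing.residue 𝒪[E] (⟨b, hb⟩ - algebraMap 𝒪[F] 𝒪[E] a) = 0 := by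
      rw [map_sub, ← algebraMap_residue, sub_eq_zero]
      exact hr.symm
    rw [residue_eq_zero_iff] at h3
    exact (hb' a).not_gt (nrdVal_lt_one_iff_valuation.2 h3)
  have h3 : 0 < Module.finrank 𝓀[F] 𝓀[E] := Module.finrank_pos
  exact { finrank_eq_two' := by omega }

/-- Every integral quadratic polynomial with irreducible reduction has a root in an unramified
quadratic extension: its reduction has a simple root in the residue field, which lifts. -/
theorem exists_root_of_irreducible_reduction (hE : IsUnramifiedExt F E) {t c : 𝒪[F]}
    (hirr : Irreducible (Polynomial.X ^ 2 - Polynomial.C (IsLocalRing.residue 𝒪[F] t) *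
      Polynomial.X + Polynomial.C (IsLocalRing.residue 𝒪[F] c))) :
    ∃ e : E, e * e = (t : F) • e - algebraMap F E c := by
  have := isQuadraticExtension_residueField hE
  set f : Polynomial 𝓀[F] := Polynomial.X ^ 2 - Polynomial.C (IsLocalRing.residue 𝒪[F] t) *
      Polynomial.X + Polynomial.C (IsLocalRing.residue 𝒪[F] c) with hf
  obtain ⟨z, hroot, hder⟩ := exists_simple_root_of_finrank_eq_two (l := 𝓀[E]) hirr
    (by rw [hf]; compute_degree!)
  obtain ⟨r, rfl⟩ := IsLocalRing.residue_surjective z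
  have := henselianLocalRing_integer E
  obtain ⟨e, he, -⟩ := HenselianLocalRing.is_henselian (R := 𝒪[E])
    (Polynomial.X ^ 2 - Polynomial.C (algebraMap 𝒪[F] 𝒪[E] t) * Polynomial.X
      + Polynomial.C (algebraMap 𝒪[F] 𝒪[E] c)) (by monicity!) r (by
      rw [← IsLocalRing.residue_eq_zero_iff, ← hroot]
      simp [hf]) (by
      rw [← IsLocalRing.residue_ne_zero_iff_isUnit]
      convert! hder using 1
      simp [hf])
  refine ⟨e, ?_⟩
  have h1 := congrArg Subtype.val he
  simp only [Polynomial.eval_add, Polynomial.eval_sub, Polynomial.eval_mul, Polynomial.eval_pow,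
    Polynomial.eval_X, Polynomial.eval_C] at h1
  have h2 : (e : E) ^ 2 - algebraMap F E t * e + algebraMap F E c = 0 := h1
  rw [Algebra.smul_def]
  linear_combination h2

/-- An unramified quadratic extension embeds into every quadratic division algebra with an
integral element not congruent to an element of `F`. -/
theorem nonempty_algHom_of_residue_generator (hE : IsUnramifiedExt F E) {A : Type*}
    [DivisionRing A] [Algebra F A] [IsQuadraticDivisionAlgebra F A] {x : A}
    (hx : nrdVal F A x ≤ 1) (hx' : ∀ a : F, 1 ≤ nrdVal F A (x - algebraMap F A a)) :
    Nonempty (E →ₐ[F] A) := by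
  obtain ⟨t, c, h, hirr⟩ := exists_irreducible_reduction hx hx'
  obtain ⟨e, he⟩ := exists_root_of_irreducible_reduction hE hirr
  have hxF : x ∉ Set.range (algebraMap F A) := by
    rintro ⟨a, rfl⟩
    have := hx' a
    rw [sub_self, map_zero] at this
    exact this.not_gt zero_lt_one
  have heF : e ∉ Set.range (algebraMap F E) := by
    rintro ⟨s, rfl⟩
    refine no_root_of_minpoly_eq hxF h s ?_
    rw [Algebra.smul_def] at he
    apply (algebraMap F E).injective
    simp only [map_add, map_sub, map_mul, map_pow, map_zero]
    linear_combination he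
  obtain ⟨φ, -⟩ := exists_algHom_apply_eq heF he h
  exact ⟨φ⟩

theorem nonempty_algEquiv_of_isUnramifiedExt (hE : IsUnramifiedExt F E)
    {E' : Type*} [Field E'] [ValuativeRel E'] [TopologicalSpace E'] [IsNonarchimedeanLocalField E']
    [Algebra F E'] [ValuativeExtension F E'] [Algebra.IsQuadraticExtension F E']
    (hE' : IsUnramifiedExt F E') : Nonempty (E ≃ₐ[F] E') := by
  obtain ⟨b, hb, hb'⟩ := exists_residue_generator hE'
  obtain ⟨φ⟩ := nonempty_algHom_of_residue_generator hE hb hb'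
  exact ⟨AlgEquiv.ofBijective φ (algHom_bijective φ)⟩

/-- The non-trivial automorphism of an unramified quadratic extension acts non-trivially on the
residue field. -/
theorem exists_algEquiv_valuation_sub_eq_one (hE : IsUnramifiedExt F E) :
    ∃ (θ : E ≃ₐ[F] E) (b : E), valuation E b ≤ 1 ∧ valuation E (b - θ b) = 1 := by
  obtain ⟨b, hb, hb'⟩ := exists_residue_generator hE
  obtain ⟨t, c, h, hirr⟩ := exists_irreducible_reduction hb hb'
  have hbF : b ∉ Set.range (algebraMap F E) := by
    rintro ⟨a, rfl⟩
    have := hb' a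
    rw [sub_self, map_zero] at this
    exact this.not_gt zero_lt_one
  have hbv := nrdVal_le_one_iff_valuation.1 hb
  obtain ⟨φ, hφ⟩ := exists_algHom_apply_eq hbF h (x := algebraMap F E t - b) (by
    rw [Algebra.smul_def] at h ⊢
    linear_combination h)
  refine ⟨AlgEquiv.ofBijective φ (algHom_bijective φ), b, hbv, ?_⟩
  rw [AlgEquiv.coe_ofBijective, hφ, ← valuation_two_mul_sub_eq_one hirr hbv h]
  congr 1
  ring

/-- The norm of an unramified quadratic extension is surjective on residual units. -/
theorem exists_valuation_norm_sub_lt_one (hE : IsUnramifiedExt F E) {u : F}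
    (hu : valuation F u ≤ 1) :
    ∃ e : E, valuation E e ≤ 1 ∧ valuation F (Algebra.norm F e - u) < 1 := by
  have := isQuadraticExtension_residueField hE
  obtain ⟨z, hz⟩ := FiniteField.norm_surjective 𝓀[F] 𝓀[E] (IsLocalRing.residue 𝒪[F] ⟨u, hu⟩)
  by_cases h : z ∈ Set.range (algebraMap 𝓀[F] 𝓀[E])
  · obtain ⟨r, rfl⟩ := h
    obtain ⟨a, rfl⟩ := IsLocalRing.residue_surjective r
    refine ⟨algebraMap F E a,
      (Valuation.HasExtension.val_map_le_one_iff (valuation F) _ _).2 a.2, ?_⟩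
    rw [Algebra.norm_algebraMap, Algebra.IsQuadraticExtension.finrank_eq_two] at hz ⊢
    have h1 : IsLocalRing.residue 𝒪[F] (a ^ 2 - ⟨u, hu⟩) = 0 := by
      rw [map_sub, map_pow, hz, sub_self]
    rw [residue_eq_zero_iff] at h1
    exact h1
  · obtain ⟨x, rfl⟩ := IsLocalRing.residue_surjective z
    obtain ⟨t, ht, hxx⟩ := exists_nrdVal_integral_equation (F := F) (x := (x : E))
      (nrdVal_le_one_iff_valuation.2 x.2)
    have hc : valuation F (redNorm F (x : E)) ≤ 1 := nrdVal_le_one_iff_valuation.2 x.2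
    have h' : x * x = algebraMap 𝒪[F] 𝒪[E] ⟨t, ht⟩ * x - algebraMap 𝒪[F] 𝒪[E] ⟨_, hc⟩ := by
      ext
      change (x : E) * x = algebraMap F E t * x - algebraMap F E (redNorm F (x : E))
      rw [hxx, Algebra.smul_def]
    have h2 := congrArg (IsLocalRing.residue 𝒪[E]) h'
    simp only [map_mul, map_sub, ← algebraMap_residue] at h2
    rw [norm_eq_redNorm, redNorm_eq_of_mul_self_eq h (t := IsLocalRing.residue 𝒪[F] ⟨t, ht⟩)
      (by rw [h2, Algebra.smul_def])] at hz
    refine ⟨x, x.2, ?_⟩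
    have h1 : IsLocalRing.residue 𝒪[F] (⟨redNorm F (x : E), hc⟩ - ⟨u, hu⟩) = 0 := by
      rw [map_sub, hz, sub_self]
    rw [residue_eq_zero_iff] at h1
    rw [norm_eq_redNorm]
    exact h1

end UnramifiedQuadratic

/-! ### Residues in a quaternion division algebra -/

section QuaternionResidue

variable {F : Type*} [Field F] [ValuativeRel F] [TopologicalSpace F] [IsNonarchimedeanLocalField F]
  {D : Type*} [DivisionRing D] [Algebra F D] [IsQuadraticDivisionAlgebra F D]

variable (F D) in
theorem exists_nrdVal_uniformizer : ∃ ϖ : D, ϖ ≠ 0 ∧ nrdVal F D ϖ < 1 ∧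
    ∀ y : D, nrdVal F D y < 1 → nrdVal F D y ≤ nrdVal F D ϖ := by
  obtain ⟨π, hπ0, hπ1, hπ⟩ := exists_uniformizer F
  by_cases h : ∃ y : D, nrdVal F D y = valuation F π
  · obtain ⟨y, hy⟩ := h
    refine ⟨y, ?_, hy ▸ hπ1, fun z hz => hy ▸ hπ _ hz⟩
    rintro rfl
    rw [map_zero] at hy
    exact hπ0 ((Valuation.zero_iff _).1 hy.symm)
  · push Not at h
    have hπ0' : valuation F π ≠ 0 := (Valuation.ne_zero_iff _).2 hπ0
    refine ⟨algebraMap F D π, by simpa using hπ0, ?_, fun z hz => ?_⟩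
    · rw [nrdVal_algebraMap]
      exact pow_lt_one₀ zero_le hπ1 two_ne_zero
    · have h1 : nrdVal F D z < valuation F π := lt_of_le_of_ne (hπ _ hz) (h z)
      have h2 := hπ (redNorm F z / π) (by
        rw [map_div₀]
        exact (div_lt_one₀ (zero_lt_iff.2 hπ0')).2 h1)
      rw [map_div₀, div_le_iff₀ (zero_lt_iff.2 hπ0')] at h2
      rw [nrdVal_algebraMap, pow_two]
      exact h2

theorem exists_mem_adjoin_nrdVal_sub_le {ϖ : D} (hϖ0 : ϖ ≠ 0)
    (hϖ : ∀ y : D, nrdVal F D y < 1 → nrdVal F D y ≤ nrdVal F D ϖ)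
    (hres : ∀ x : D, nrdVal F D x ≤ 1 → ∃ a : F, nrdVal F D (x - algebraMap F D a) < 1)
    (n : ℕ) : ∀ x : D, nrdVal F D x ≤ 1 →
      ∃ z ∈ Algebra.adjoin F {ϖ}, nrdVal F D (x - z) ≤ nrdVal F D ϖ ^ n := by
  have hw : nrdVal F D ϖ ≠ 0 := (Valuation.ne_zero_iff _).2 hϖ0
  induction n with
  | zero => exact fun x hx => ⟨0, zero_mem _, by simpa using hx⟩
  | succ n ih =>
    intro x hx
    obtain ⟨a, ha⟩ := hres x hx
    obtain ⟨z, hz, hxz⟩ := ih ((x - algebraMap F D a) * ϖ⁻¹) (by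
      rw [map_mul, map_inv₀]
      exact mul_inv_le_one_of_le₀ (hϖ _ ha) zero_le)
    refine ⟨algebraMap F D a + z * ϖ, add_mem (Subalgebra.algebraMap_mem _ a)
      (mul_mem hz (Algebra.self_mem_adjoin_singleton F ϖ)), ?_⟩
    have : x - (algebraMap F D a + z * ϖ) = ((x - algebraMap F D a) * ϖ⁻¹ - z) * ϖ := by
      rw [sub_mul, inv_mul_cancel_right₀ hϖ0, sub_sub]
    rw [this, map_mul, pow_succ]
    exact mul_le_mul_left hxz _

variable [TopologicalSpace D] [IsTopologicalRing D] [IsModuleTopology F D]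

/-- Some integral element of a quaternion division algebra is not congruent to an element of `F`:
otherwise every element would be a power series over `F` in a uniformizer, and the algebra would be
commutative. -/
theorem exists_nrdVal_residue_generator (hcomm : ¬ ∀ y z : D, y * z = z * y) :
    ∃ x : D, nrdVal F D x ≤ 1 ∧ ∀ a : F, 1 ≤ nrdVal F D (x - algebraMap F D a) := by
  by_contra! hres
  obtain ⟨ϖ, hϖ0, hϖ1, hϖ⟩ := exists_nrdVal_uniformizer F D
  have hint : ∀ x : D, nrdVal F D x ≤ 1 → x ∈ Algebra.adjoin F {ϖ} := by
    intro x hx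
    by_contra hmem
    obtain ⟨f, hfx, hf⟩ := Submodule.exists_le_ker_of_notMem
      (p := Subalgebra.toSubmodule (Algebra.adjoin F {ϖ})) hmem
    have hfc : Continuous f := IsModuleTopology.continuous_of_linearMap f
    have hnhds : {y : F | valuation F y < valuation F (f x)} ∈ 𝓝 (f 0) := by
      rw [map_zero]
      exact (hasBallTopology_valuation F).mem_of_mem ((Valuation.ne_zero_iff _).2 hfx)
    obtain ⟨γ, hγ, hsub⟩ := (hasBallTopology_nrdVal F D).mem_iff.1 (hfc.continuousAt hnhds)
    obtain ⟨n, hn⟩ := exists_pow_lt₀ hϖ1 (Units.mk0 γ hγ)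
    obtain ⟨z, hz, hxz⟩ := exists_mem_adjoin_nrdVal_sub_le hϖ0 hϖ hres n x hx
    have h := hsub (show x - z ∈ {y | nrdVal F D y < γ} from hxz.trans_lt hn)
    have hz0 : f z = 0 := hf hz
    simp only [Set.mem_preimage, Set.mem_ofPred_eq, map_sub, hz0, sub_zero, lt_self_iff_false] at h
  have hall : ∀ x : D, x ∈ Algebra.adjoin F {ϖ} := by
    intro x
    obtain hx | hx := le_or_gt (nrdVal F D x) 1
    · exact hint x hx
    have hx0 : 0 < nrdVal F D x := zero_lt_one.trans hx
    obtain ⟨c, hc0, hc⟩ := exists_ne_zero_valuation_lt (F := F) (inv_ne_zero hx0.ne')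
    have hc1 : valuation F c ≤ 1 := (hc.trans (inv_lt_one_of_one_lt₀ hx)).le
    have h := hint (algebraMap F D c * x) (by
      rw [map_mul, nrdVal_algebraMap, ← le_mul_inv_iff₀ hx0, one_mul]
      exact (pow_le_of_le_one zero_le hc1 two_ne_zero).trans hc.le)
    have := mul_mem (Subalgebra.algebraMap_mem (Algebra.adjoin F {ϖ}) c⁻¹) h
    rwa [← mul_assoc, ← map_mul, inv_mul_cancel₀ hc0, map_one, one_mul] at this
  refine hcomm fun y z => ?_
  have hy := hall y
  have hz := hall z
  rw [Algebra.adjoin_singleton_eq_range_aeval] at hy hz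
  obtain ⟨q, rfl⟩ := hy
  obtain ⟨r, rfl⟩ := hz
  exact (Commute.all q r).map (Polynomial.aeval ϖ)

variable {E : Type*} [Field E] [ValuativeRel E] [Algebra F E] [ValuativeExtension F E]
  [TopologicalSpace E] [IsNonarchimedeanLocalField E] [Algebra.IsQuadraticExtension F E]

theorem nonempty_algHom_quaternion (hE : IsUnramifiedExt F E) (hD : Module.finrank F D = 4)
    [Algebra.IsCentral F D] : Nonempty (E →ₐ[F] D) := by
  obtain ⟨x, hx, hx'⟩ := exists_nrdVal_residue_generator (F := F)
    (not_forall_commute_of_finrank_eq_four (F := F) (D := D) hD)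
  exact nonempty_algHom_of_residue_generator hE hx hx'

end QuaternionResidue

/-! ### Conjugacy of embeddings of quadratic extensions -/

section SkolemNoether

variable {F E D : Type*} [Field F] [Field E] [Algebra F E] [Algebra.IsQuadraticExtension F E]
  [DivisionRing D] [Algebra F D]

variable (F E) in
theorem exists_notMem_range_algebraMap : ∃ b : E, b ∉ Set.range (algebraMap F E) := by
  by_contra! hall
  have := LinearMap.finrank_le_finrank_of_surjective (f := Algebra.linearMap F E) hall
  rw [Module.finrank_self, Algebra.IsQuadraticExtension.finrank_eq_two F E] at this
  omega

/-- The case of the Skolem–Noether theorem of two embeddings of a quadratic extension in a central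
division algebra. If `b` generates `E`, with trace `t`, then `ι' b * y + y * ι b - t * y`
intertwines `ι b` and `ι' b` for every `y`. -/
theorem exists_mul_eq_mul_of_algHom [Algebra.IsCentral F D] (ι ι' : E →ₐ[F] D) :
    ∃ g : Dˣ, ∀ e : E, (g : D) * ι e = ι' e * g := by
  obtain ⟨b, hb⟩ := exists_notMem_range_algebraMap F E
  obtain ⟨t, ht, -⟩ := exists_minpoly_eq hb
  set c := redNorm F b
  have h1 : ι b * ι b = algebraMap F D t * ι b - algebraMap F D c := by
    rw [← map_mul, ht, map_sub, AlgHom.commutes, map_smul, Algebra.smul_def]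
  have h2 : ι' b * ι' b = algebraMap F D t * ι' b - algebraMap F D c := by
    rw [← map_mul, ht, map_sub, AlgHom.commutes, map_smul, Algebra.smul_def]
  have key : ∀ y : D, (ι' b * y + y * ι b - algebraMap F D t * y) * ι b =
      ι' b * (ι' b * y + y * ι b - algebraMap F D t * y) := by
    intro y
    have e1 : y * ι b * ι b = algebraMap F D t * y * ι b - algebraMap F D c * y := by
      rw [mul_assoc, h1, mul_sub, ← mul_assoc, Algebra.commutes t y, Algebra.commutes c y]
    have e2 : ι' b * (ι' b * y) = ι' b * (algebraMap F D t * y) - algebraMap F D c * y := by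
      rw [← mul_assoc, h2, sub_mul, Algebra.commutes t (ι' b), mul_assoc]
    rw [sub_mul, add_mul, e1, mul_sub, mul_add, e2, ← mul_assoc (ι' b) y]
    abel
  obtain ⟨y, hy⟩ : ∃ y : D, ι' b * y + y * ι b - algebraMap F D t * y ≠ 0 := by
    by_contra! hall
    have h3 : ι' b = algebraMap F D t - ι b := by
      have := hall 1
      rw [mul_one, one_mul, mul_one, sub_eq_zero] at this
      exact eq_sub_of_add_eq this
    have hc : ι b ∈ Subalgebra.center F D := by
      rw [Subalgebra.mem_center_iff]
      intro y
      have := hall y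
      rw [h3, sub_mul] at this
      have h4 : algebraMap F D t * y - ι b * y + y * ι b - algebraMap F D t * y
        = y * ι b - ι b * y := by abel
      rw [h4] at this
      exact sub_eq_zero.1 this
    obtain ⟨a, ha⟩ := Algebra.mem_bot.1 (Algebra.IsCentral.out hc)
    exact hb ⟨a, ι.toRingHom.injective ((ι.commutes a).trans ha)⟩
  have hk := key y
  generalize ι' b * y + y * ι b - algebraMap F D t * y = g at hy hk
  refine ⟨Units.mk0 g hy, fun e => ?_⟩
  obtain ⟨r, s, rfl⟩ := exists_eq_algebraMap_add_smul hb e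
  simp only [map_add, AlgHom.commutes, map_smul, Units.val_mk0, mul_add, add_mul, mul_smul_comm,
    smul_mul_assoc, hk, Algebra.commutes r]

end SkolemNoether

/-! ### The twisted decomposition of a quaternion division algebra -/

section Twist

theorem ne_refl_of_valuation_sub_eq_one {F E : Type*} [Field F] [Field E] [Algebra F E]
    [ValuativeRel E] {θ : E ≃ₐ[F] E} {b : E}
    (hbθ : valuation E (b - θ b) = 1) : θ ≠ AlgEquiv.refl := by
  rintro rfl
  rw [AlgEquiv.coe_refl, id, sub_self, map_zero] at hbθ
  exact zero_ne_one hbθ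

variable {F E D : Type*} [Field F] [Field E] [Algebra F E] [Algebra.IsQuadraticExtension F E]
  [DivisionRing D] [Algebra F D] {ι : E →ₐ[F] D} {θ : E ≃ₐ[F] E} {g : D}

theorem algEquiv_algEquiv_apply (θ : E ≃ₐ[F] E) (e : E) : θ (θ e) = e := by
  by_cases hθ : θ = AlgEquiv.refl
  · rw [hθ]; rfl
  by_cases he : e = 0
  · rw [he, map_zero, map_zero]
  have h := mul_apply_eq_algebraMap_norm hθ e
  have h' := congrArg θ h
  rw [AlgEquiv.commutes, map_mul, ← h, mul_comm e] at h'
  exact mul_left_cancel₀ ((map_ne_zero θ).2 he) h'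

/-- `D = E + E g` if `g ≠ 0` induces the non-trivial automorphism of `E`. -/
theorem exists_eq_add_mul (hD : Module.finrank F D = 4) (hθ : θ ≠ AlgEquiv.refl) 
    (hg : ∀ e, g * ι e = ι (θ e) * g) (hg0 : g ≠ 0) (x : D) : ∃ a d : E, x = ι a + ι d * g := by
  have : FiniteDimensional F D := Module.finite_of_finrank_pos (by omega)
  have : FiniteDimensional F E := Module.finite_of_finrank_pos (by
    rw [Algebra.IsQuadraticExtension.finrank_eq_two F E]; omega)
  let T : E × E →ₗ[F] D := LinearMap.coprod ι.toLinearMap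
    ((LinearMap.mulRight F g).comp ι.toLinearMap)
  have hT : ∀ z, T z = ι z.1 + ι z.2 * g := fun z => by
    rw [LinearMap.coprod_apply]
    rfl
  have hinj : Function.Injective T := by
    rw [← LinearMap.ker_eq_bot, LinearMap.ker_eq_bot']
    rintro ⟨a, d⟩ h
    rw [hT] at h
    have hd : d = 0 := by
      by_contra hd
      have hιd : ι d ≠ 0 := (map_ne_zero ι).2 hd
      have hgE : g = ι (-(d⁻¹ * a)) := by
        rw [map_neg, map_mul, map_inv₀, eq_neg_of_add_eq_zero_left h, mul_neg, neg_neg,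
          inv_mul_cancel_left₀ hιd]
      refine hθ (AlgEquiv.ext fun e => ι.toRingHom.injective ?_)
      have := hg e
      rw [hgE, ← map_mul, mul_comm, map_mul, ← hgE] at this
      exact (mul_right_cancel₀ hg0 this).symm
    subst hd
    simp only [map_zero, zero_mul, add_zero, map_eq_zero] at h
    rw [h]
    rfl
  have hsurj := (LinearMap.injective_iff_surjective_of_finrank_eq_finrank (by
    rw [Module.finrank_prod, Algebra.IsQuadraticExtension.finrank_eq_two F E, hD])).1 hinj
  obtain ⟨z, hz⟩ := hsurj x
  exact ⟨z.1, z.2, by rw [← hz, hT]⟩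

end Twist

section TwistValuation

variable {F : Type*} [Field F] [ValuativeRel F] [TopologicalSpace F] [IsNonarchimedeanLocalField F]
  {D : Type*} [DivisionRing D] [Algebra F D] [IsQuadraticDivisionAlgebra F D]
  {E : Type*} [Field E] [ValuativeRel E] [Algebra F E] [ValuativeExtension F E]
  [TopologicalSpace E] [IsNonarchimedeanLocalField E] [Algebra.IsQuadraticExtension F E]
  {ι : E →ₐ[F] D} {θ : E ≃ₐ[F] E} {g : D}

/-- An element inducing the Galois automorphism of an unramified quadratic subfield has odd
valuation. If not, one may assume that it has valuation `0`; its square `u` lies in `F`, and is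
congruent to the norm of some `e ∈ E`. Then `h = e⁻¹ g` satisfies `h² ≡ 1`, so that `h ≡ ±1`,
and `h` cannot act on `E` as a non-trivial automorphism of the residue field. -/
theorem nrdVal_ne_sq_of_twist (hE : IsUnramifiedExt F E) {b : E} (hb : valuation E b ≤ 1)
    (hbθ : valuation E (b - θ b) = 1) (hg : ∀ e, g * ι e = ι (θ e) * g) (hg0 : g ≠ 0) (a : F) :
    nrdVal F D g ≠ valuation F a ^ 2 := by
  intro hga
  have hθb : θ b ≠ b := by
    intro h
    rw [h, sub_self, map_zero] at hbθ
    exact zero_ne_one hbθ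
  have hθ : θ ≠ AlgEquiv.refl := by
    rintro rfl
    exact hθb rfl
  have ha0 : valuation F a ≠ 0 := by
    intro h
    rw [h, zero_pow two_ne_zero, Valuation.zero_iff] at hga
    exact hg0 hga
  have ha : a ≠ 0 := (Valuation.ne_zero_iff _).1 ha0
  obtain ⟨y, hy, hyw⟩ : ∃ y : D, (∀ e, y * ι e = ι (θ e) * y) ∧ nrdVal F D y = 1 := by
    refine ⟨algebraMap F D a⁻¹ * g, fun e => ?_, ?_⟩
    · rw [mul_assoc, hg, ← mul_assoc, Algebra.commutes, mul_assoc]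
    · rw [map_mul, nrdVal_algebraMap, hga, ← mul_pow, ← map_mul, inv_mul_cancel₀ ha, map_one,
        one_pow]
  have hy0 : y ≠ 0 := by
    rintro rfl
    rw [map_zero] at hyw
    exact zero_ne_one hyw
  have hcomm : y * ι b ≠ ι b * y := by
    rw [hy]
    intro h
    exact hθb (ι.toRingHom.injective (mul_right_cancel₀ hy0 h))
  have hyF : y ∉ Set.range (algebraMap F D) := by
    rintro ⟨r, rfl⟩
    exact hcomm (Algebra.commutes r _)
  obtain ⟨t, ht, -⟩ := exists_minpoly_eq hyF
  -- `y²` commutes with `ι b` but `y` does not, so `y` has trace `0`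
  have hyy : y * y * ι b = ι b * (y * y) := by
    rw [mul_assoc, hy, ← mul_assoc, hy, algEquiv_algEquiv_apply, mul_assoc]
  have ht0 : t = 0 := by
    by_contra ht0
    refine hcomm (smul_right_injective D ht0 ?_)
    have h : t • y = y * y + algebraMap F D (redNorm F y) := by rw [ht, sub_add_cancel]
    change t • (y * ι b) = t • (ι b * y)
    rw [← smul_mul_assoc, ← mul_smul_comm, h, add_mul, mul_add, hyy, Algebra.commutes]
  set u : F := -redNorm F y with hu
  have hyu : y * y = algebraMap F D u := by rw [ht, ht0, zero_smul, zero_sub, hu, map_neg]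
  have hvu : valuation F u = 1 := by rw [hu, Valuation.map_neg]; exact hyw
  obtain ⟨e, he1, heu⟩ := exists_valuation_norm_sub_lt_one hE hvu.le
  have hve : valuation F (Algebra.norm F e) = 1 := by
    have h := Valuation.map_add_eq_of_lt_right (v := valuation F) (heu.trans_eq hvu.symm)
    rwa [sub_add_cancel, hvu] at h
  have hwe : nrdVal F D (ι e) = 1 := by
    rw [nrdVal_algHom, nrdVal_apply, ← norm_eq_redNorm, hve]
  have he0 : e ≠ 0 := by
    rintro rfl
    rw [map_zero, map_zero] at hwe
    exact zero_ne_one hwe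
  set h : D := ι e⁻¹ * y with hh
  have hwh : nrdVal F D h = 1 := by
    rw [hh, map_mul, hyw, map_inv₀, map_inv₀, hwe, inv_one, mul_one]
  have hne : Algebra.norm F e⁻¹ * Algebra.norm F e = 1 := by
    rw [← map_mul, inv_mul_cancel₀ he0, map_one]
  have hve' : valuation F (Algebra.norm F e⁻¹) = 1 := by
    have := congrArg (valuation F) hne
    rwa [map_mul, hve, mul_one, map_one] at this
  have hhh : h * h = algebraMap F D (Algebra.norm F e⁻¹ * u) := by
    rw [hh, mul_assoc, ← mul_assoc y, hy, mul_assoc, hyu, ← mul_assoc, ← map_mul,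
      mul_apply_eq_algebraMap_norm hθ, AlgHom.commutes, ← map_mul]
  have hprod : nrdVal F D (h - 1) * nrdVal F D (h + 1) < 1 := by
    have h1 : (h - 1) * (h + 1)
        = algebraMap F D (Algebra.norm F e⁻¹ * (u - Algebra.norm F e)) := by
      have h2 : (h - 1) * (h + 1) = h * h - 1 := by
        rw [sub_mul, mul_add, mul_one, one_mul, add_sub_assoc, sub_add_cancel_left, sub_eq_add_neg]
      rw [h2, hhh, mul_sub, hne, map_sub, map_one]
    rw [← map_mul, h1, nrdVal_algebraMap, map_mul, hve', one_mul]
    rw [Valuation.map_sub_swap]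
    exact pow_lt_one₀ zero_le heu two_ne_zero
  -- `s` is one of `1` and `-1`
  obtain ⟨s, hs, hs'⟩ : ∃ s : D, nrdVal F D (h - s) < 1 ∧ ι b * s = s * ι b := by
    obtain h1 | h1 := lt_or_ge (nrdVal F D (h - 1)) 1
    · exact ⟨1, h1, by rw [one_mul, mul_one]⟩
    · refine ⟨-1, ?_, by rw [mul_neg, neg_mul, one_mul, mul_one]⟩
      rw [sub_neg_eq_add]
      exact (le_mul_of_one_le_left zero_le h1).trans_lt hprod
  have hwb : nrdVal F D (ι b) ≤ 1 := by
    rw [nrdVal_algHom]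
    exact nrdVal_le_one_iff_valuation.2 hb
  have hlt : nrdVal F D (ι b * h - h * ι b) < 1 := by
    have h1 : ι b * h - h * ι b = ι b * (h - s) - (h - s) * ι b := by
      rw [mul_sub, sub_mul, hs']
      abel
    rw [h1]
    refine (Valuation.map_sub _ _ _).trans_lt (max_lt ?_ ?_)
    · rw [map_mul]
      exact (mul_le_of_le_one_left zero_le hwb).trans_lt hs
    · rw [map_mul]
      exact (mul_le_of_le_one_right zero_le hwb).trans_lt hs
  have heq : ι b * h - h * ι b = ι (b - θ b) * h := by
    rw [hh, mul_assoc (ι e⁻¹) y, hy, ← mul_assoc, ← mul_assoc, ← map_mul, ← map_mul,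
      mul_comm e⁻¹ (θ b), map_mul, map_mul, map_sub, sub_mul, mul_assoc, mul_assoc]
  rw [heq, map_mul, hwh, mul_one, nrdVal_algHom,
    nrdVal_eq_one_iff_valuation.2 hbθ] at hlt
  exact lt_irrefl _ hlt

end TwistValuation

/-! ### The elements of even valuation -/

section EvenUnits

variable (F : Type*) [Field F] [ValuativeRel F] [TopologicalSpace F] [IsNonarchimedeanLocalField F]
  (D : Type*) [DivisionRing D] [Algebra F D] [IsQuadraticDivisionAlgebra F D]

/-- The subgroup of `Dˣ` of the elements whose reduced norm has the valuation of a square. -/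
def evenUnits : Subgroup Dˣ where
  carrier := {x | ∃ a : F, nrdVal F D x = valuation F a ^ 2}
  one_mem' := ⟨1, by simp⟩
  mul_mem' := by
    rintro x y ⟨a, ha⟩ ⟨b, hb⟩
    exact ⟨a * b, by rw [Units.val_mul, map_mul, ha, hb, map_mul, mul_pow]⟩
  inv_mem' := by
    rintro x ⟨a, ha⟩
    exact ⟨a⁻¹, by rw [Units.val_inv_eq_inv_val, map_inv₀, ha, map_inv₀, inv_pow]⟩

variable {F D}

theorem mem_evenUnits_of_nrdVal_eq_one {x : Dˣ} (hx : nrdVal F D x = 1) : x ∈ evenUnits F D :=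
  ⟨1, by rw [hx, map_one, one_pow]⟩

theorem principalUnits_le_evenUnits : principalUnits (nrdVal F D) ≤ evenUnits F D := fun _ hx =>
  mem_evenUnits_of_nrdVal_eq_one (valuation_eq_one_of_mem_principalUnits hx)

variable {E : Type*} [Field E] [ValuativeRel E] [Algebra F E] [ValuativeExtension F E]
  [Algebra.IsQuadraticExtension F E]

theorem embUnits_mem_evenUnits (hE : IsUnramifiedExt F E) (ι : E →ₐ[F] D) (e : Eˣ) :
    embUnits ι e ∈ evenUnits F D := by
  obtain ⟨a, -, ha⟩ := exists_nrdVal_eq_valuation_sq hE e.ne_zero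
  exact ⟨a, (nrdVal_algHom ι e).trans ha⟩

variable [TopologicalSpace E] [IsNonarchimedeanLocalField E]

/-- The non-trivial automorphism of an unramified quadratic subfield is induced by an element of
odd valuation. -/
theorem exists_twist [Algebra.IsCentral F D] (hE : IsUnramifiedExt F E) (ι : E →ₐ[F] D) :
    ∃ (θ : E ≃ₐ[F] E) (b : E) (g : Dˣ), valuation E b ≤ 1 ∧ valuation E (b - θ b) = 1 ∧
      (∀ e, (g : D) * ι e = ι (θ e) * g) ∧ g ∉ evenUnits F D := by
  obtain ⟨θ, b, hb, hbθ⟩ := exists_algEquiv_valuation_sub_eq_one hE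
  obtain ⟨g, hg⟩ := exists_mul_eq_mul_of_algHom ι (ι.comp θ.toAlgHom)
  refine ⟨θ, b, g, hb, hbθ, hg, ?_⟩
  rintro ⟨a, ha⟩
  exact nrdVal_ne_sq_of_twist hE hb hbθ hg g.ne_zero a ha

variable [Algebra.IsCentral F D]

/-- According to the parity of its valuation, the first or the second term dominates in the
decomposition of an element of `Dˣ` along `D = E + E g`. -/
theorem exists_dominant_term (hD : Module.finrank F D = 4) (hE : IsUnramifiedExt F E)
    (ι : E →ₐ[F] D) : ∃ g : Dˣ, ∀ x : Dˣ,
      (x ∈ evenUnits F D → ∃ e : Eˣ, ∃ u ∈ principalUnits (nrdVal F D), x = embUnits ι e * u) ∧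
      (x ∉ evenUnits F D → ∃ e : Eˣ, nrdVal F D x = nrdVal F D (ι e) * nrdVal F D g) := by
  obtain ⟨θ, b, g, -, hbθ, hg, hodd⟩ := exists_twist hE ι
  refine ⟨g, fun x => ?_⟩
  obtain ⟨a, d, hx⟩ := exists_eq_add_mul hD (ne_refl_of_valuation_sub_eq_one hbθ) hg g.ne_zero (x : D)
  have hmul : ∀ d : Eˣ, embUnits ι d * g ∉ evenUnits F D := fun d h =>
    hodd ((Subgroup.mul_mem_cancel_left _ (embUnits_mem_evenUnits hE ι d)).1 h)
  obtain rfl | ha := eq_or_ne a 0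
  · have hd : d ≠ 0 := by
      rintro rfl
      simp at hx
    have hxd : x = embUnits ι (Units.mk0 d hd) * g := Units.ext (by
      rw [hx, map_zero, zero_add]
      rfl)
    refine ⟨fun h => absurd (hxd ▸ h) (hmul _), fun _ => ⟨Units.mk0 d hd, ?_⟩⟩
    rw [hxd, Units.val_mul, map_mul]
    rfl
  have hιa : nrdVal F D (ι a) ≠ 0 := (Valuation.ne_zero_iff _).2 ((map_ne_zero ι).2 ha)
  have hlt : nrdVal F D (ι d * g) < nrdVal F D (ι a) → x ∈ evenUnits F D ∧
      ∃ e : Eˣ, ∃ u ∈ principalUnits (nrdVal F D), x = embUnits ι e * u := by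
    intro h
    have hu : (embUnits ι (Units.mk0 a ha))⁻¹ * x ∈ principalUnits (nrdVal F D) := by
      have h1 : (((embUnits ι (Units.mk0 a ha))⁻¹ * x : Dˣ) : D) - 1 = (ι a)⁻¹ * (ι d * g) := by
        rw [Units.val_mul, Units.val_inv_eq_inv_val, hx]
        change (ι a)⁻¹ * (ι a + ι d * g) - 1 = _
        rw [mul_add, inv_mul_cancel₀ ((map_ne_zero ι).2 ha), add_sub_cancel_left]
      rw [mem_principalUnits, h1, map_mul, map_inv₀]
      rw [inv_mul_lt_iff₀ (zero_lt_iff.2 hιa), mul_one]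
      exact h
    have hxu := (mul_inv_cancel_left (embUnits ι (Units.mk0 a ha)) x).symm
    refine ⟨?_, _, _, hu, hxu⟩
    rw [hxu]
    exact mul_mem (embUnits_mem_evenUnits hE ι _) (principalUnits_le_evenUnits hu)
  obtain rfl | hd := eq_or_ne d 0
  · have := hlt (by simpa using zero_lt_iff.2 hιa)
    exact ⟨fun _ => this.2, fun h => absurd this.1 h⟩
  obtain h | h | h := lt_trichotomy (nrdVal F D (ι d * g)) (nrdVal F D (ι a))
  · exact ⟨fun _ => (hlt h).2, fun h' => absurd (hlt h).1 h'⟩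
  -- the two terms have valuations of different parity, so they cannot be equal
  · obtain ⟨a', ha'⟩ := embUnits_mem_evenUnits hE ι (Units.mk0 a ha)
    exact absurd ⟨a', h.trans ha'⟩ (hmul (Units.mk0 d hd))
  · have hxw : nrdVal F D x = nrdVal F D (ι d * g) := by
      rw [hx, add_comm]
      exact Valuation.map_add_eq_of_lt_left _ h
    refine ⟨?_, fun _ => ⟨Units.mk0 d hd, by rw [hxw, map_mul]; rfl⟩⟩
    rintro ⟨c, hc⟩
    exact absurd ⟨c, hxw.symm.trans hc⟩ (hmul (Units.mk0 d hd))

variable (hD : Module.finrank F D = 4) (hE : IsUnramifiedExt F E)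
include hD hE

theorem exists_eq_mul_of_mem_evenUnits (ι : E →ₐ[F] D) {x : Dˣ} (hx : x ∈ evenUnits F D) :
    ∃ e : Eˣ, ∃ u ∈ principalUnits (nrdVal F D), x = embUnits ι e * u := by
  obtain ⟨g, h⟩ := exists_dominant_term hD hE ι
  exact (h x).1 hx

theorem mul_inv_mem_evenUnits {x y : Dˣ} (hx : x ∉ evenUnits F D)
    (hy : y ∉ evenUnits F D) (ι : E →ₐ[F] D) : x * y⁻¹ ∈ evenUnits F D := by
  obtain ⟨g, h⟩ := exists_dominant_term hD hE ι
  obtain ⟨e, he⟩ := (h x).2 hx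
  obtain ⟨e', he'⟩ := (h y).2 hy
  obtain ⟨a, ha⟩ := embUnits_mem_evenUnits hE ι (e * e'⁻¹)
  refine ⟨a, ?_⟩
  have hg : nrdVal F D g ≠ 0 := (Valuation.ne_zero_iff _).2 g.ne_zero
  have h' : nrdVal F D (embUnits ι (e * e'⁻¹)) = nrdVal F D (ι e) * (nrdVal F D (ι e'))⁻¹ := by
    rw [map_mul, map_inv, Units.val_mul, Units.val_inv_eq_inv_val, map_mul, map_inv₀]
    rfl
  rw [← ha, h', Units.val_mul, Units.val_inv_eq_inv_val, map_mul, map_inv₀, he, he',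
    ← div_eq_mul_inv, mul_div_mul_right _ _ hg, div_eq_mul_inv]

/-- The group `Eˣ U_D¹` does not depend on the embedding of `E`. -/
theorem groupJ_eq_evenUnits (ι : E →ₐ[F] D) : groupJ ι = evenUnits F D := by
  refine le_antisymm (sup_le ?_ ?_) fun x hx => ?_
  · rintro _ ⟨e, rfl⟩
    exact embUnits_mem_evenUnits hE ι e
  · exact (Subgroup.closure_le _).2 fun x hx => principalUnits_le_evenUnits hx
  · obtain ⟨e, u, hu, rfl⟩ := exists_eq_mul_of_mem_evenUnits hD hE ι hx
    exact mul_mem (Subgroup.mem_sup_left ⟨e, rfl⟩)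
      (Subgroup.mem_sup_right (Subgroup.subset_closure hu))

theorem coe_groupJ_eq_range_embUnits_mul (ι : E →ₐ[F] D) :
    (groupJ ι : Set Dˣ) = Set.range (embUnits ι) * unitsD1 F D := by
  ext x
  constructor
  · intro hx
    rw [groupJ_eq_evenUnits hD hE] at hx
    obtain ⟨e, u, hu, rfl⟩ := exists_eq_mul_of_mem_evenUnits hD hE ι hx
    exact Set.mul_mem_mul ⟨e, rfl⟩ hu
  · rintro ⟨_, ⟨e, rfl⟩, u, hu, rfl⟩
    exact mul_mem (Subgroup.mem_sup_left ⟨e, rfl⟩)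
      (Subgroup.mem_sup_right (Subgroup.subset_closure hu))

theorem coe_groupJ_eq_range_algebraMap_mul (ι : E →ₐ[F] D) : (groupJ ι : Set Dˣ) =
    Set.range (Units.map (algebraMap F D : F →* D)) * unitsD F D := by
  rw [groupJ_eq_evenUnits hD hE]
  ext x
  constructor
  · rintro ⟨a, ha⟩
    have hx0 : nrdVal F D x ≠ 0 := (Valuation.ne_zero_iff _).2 x.ne_zero
    have ha0 : a ≠ 0 := by
      rintro rfl
      rw [map_zero, zero_pow two_ne_zero] at ha
      exact hx0 ha
    refine ⟨_, ⟨Units.mk0 a ha0, rfl⟩, _, ?_, mul_inv_cancel_left _ x⟩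
    change nrdVal F D _ = 1
    rw [Units.val_mul, map_mul, Units.val_inv_eq_inv_val, map_inv₀]
    change (nrdVal F D (algebraMap F D a))⁻¹ * _ = 1
    rw [nrdVal_algebraMap, ← ha, inv_mul_cancel₀ hx0]
  · rintro ⟨_, ⟨a, rfl⟩, u, hu, rfl⟩
    exact mul_mem ⟨a, nrdVal_algebraMap (a : F)⟩ (mem_evenUnits_of_nrdVal_eq_one hu)

end EvenUnits

/-! ### Smooth induction of characters -/

section SmoothInduction

variable {G : Type*} [Group G] [TopologicalSpace G] [IsTopologicalGroup G] {k : Type*} [Field k]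

/-- The space of the representation smoothly induced from a character. -/
abbrev IndSpace {H : Subgroup G} (χ : SmoothChar H k) :=
  (smoothVectors (Representation.coind H.subtype (charRep χ))).toSubmodule

theorem charRep_apply {H : Type*} [Group H] [TopologicalSpace H] (χ : SmoothChar H k) (x : H)
    (a : k) : charRep χ x a = χ.1 x * a := rfl

theorem isSmooth_charRep (χ : SmoothChar G k) : IsSmooth (charRep χ) := by
  refine fun v => Subgroup.isOpen_mono (H₁ := χ.1.ker) (fun x hx => ?_) χ.2
  change charRep χ x v = v
  rw [charRep_apply, MonoidHom.mem_ker.1 hx, Units.val_one, one_mul]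

theorem isSmooth_prod {V W : Type*} [AddCommGroup V] [Module k V] [AddCommGroup W] [Module k W]
    {ρ : Representation k G V} {σ : Representation k G W} (hρ : IsSmooth ρ) (hσ : IsSmooth σ) :
    IsSmooth (ρ.prod σ) := by
  refine fun v => Subgroup.isOpen_mono (H₁ := vecStab ρ v.1 ⊓ vecStab σ v.2) ?_
    ((hρ v.1).inter (hσ v.2))
  rintro x ⟨h1, h2⟩
  exact Prod.ext h1 h2

variable {H H' : Subgroup G} {χ : SmoothChar H k} {χ' : SmoothChar H' k}

theorem smoothInd_apply (x : G) (f : IndSpace χ) (y : G) :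
    (smoothInd H (charRep χ) x f).1.1 y = f.1.1 (y * x) := rfl

theorem indSpace_apply_mul (f : IndSpace χ) (h : H) (y : G) :
    f.1.1 (h * y) = χ.1 h * f.1.1 y := f.1.2 h y

theorem indSpace_ext {f f' : IndSpace χ} (h : ∀ y, f.1.1 y = f'.1.1 y) : f = f' :=
  Subtype.ext (Subtype.ext (funext h))

theorem isSmooth_smoothInd : IsSmooth (V := IndSpace χ) (smoothInd H (charRep χ)) := by
  refine fun f => Subgroup.isOpen_mono (fun x hx => ?_) f.2
  exact Subtype.ext hx

/-- Frobenius reciprocity: an `H`-equivariant functional on a smooth representation `ρ` of `G`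
induces a map from `ρ` to the induced representation. -/
def indLift {V : Type*} [AddCommGroup V] [Module k V] {ρ : Representation k G V} (hρ : IsSmooth ρ)
    (ℓ : V →ₗ[k] k) (hℓ : ∀ (h : H) v, ℓ (ρ h v) = χ.1 h * ℓ v) :
    ρ.IntertwiningMap (smoothInd H (charRep χ)) where
  toFun v := ⟨⟨fun x => ℓ (ρ x v), fun h x => by
      change ℓ (ρ (h * x) v) = χ.1 h * ℓ (ρ x v)
      rw [map_mul, Module.End.mul_apply, hℓ]⟩, by
    refine Subgroup.isOpen_mono (H₁ := vecStab ρ v) (fun y hy => ?_) (hρ v)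
    refine Subtype.ext (funext fun x => ?_)
    change ℓ (ρ (x * y) v) = ℓ (ρ x v)
    rw [map_mul, Module.End.mul_apply, show ρ y v = v from hy]⟩
  map_add' v v' := indSpace_ext fun x => by
    change ℓ (ρ x (v + v')) = ℓ (ρ x v) + ℓ (ρ x v')
    rw [map_add, map_add]
  map_smul' c v := indSpace_ext fun x => by
    change ℓ (ρ x (c • v)) = c * ℓ (ρ x v)
    rw [map_smul, map_smul, smul_eq_mul]
  isIntertwining' y := by
    ext v x
    change ℓ (ρ x (ρ y v)) = ℓ (ρ (x * y) v)
    rw [map_mul, Module.End.mul_apply]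

/-- Left translation by `g` as a map between representations induced from conjugate characters. -/
def indTranslate (g : G) (hH : ∀ h : H', g * h * g⁻¹ ∈ H)
    (hχ : ∀ h : H', χ.1 ⟨g * h * g⁻¹, hH h⟩ = χ'.1 h) :
    (smoothInd H (charRep χ)).IntertwiningMap (smoothInd H' (charRep χ')) :=
  indLift isSmooth_smoothInd
    { toFun := fun f => f.1.1 g
      map_add' := fun _ _ => rfl
      map_smul' := fun _ _ => rfl } (fun h f => by
    change f.1.1 (g * h) = χ'.1 h * f.1.1 g
    rw [← hχ h, ← indSpace_apply_mul, inv_mul_cancel_right])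

theorem indTranslate_apply (g : G) (hH : ∀ h : H', g * h * g⁻¹ ∈ H)
    (hχ : ∀ h : H', χ.1 ⟨g * h * g⁻¹, hH h⟩ = χ'.1 h) (f : IndSpace χ) (x : G) :
    (indTranslate g hH hχ f).1.1 x = f.1.1 (g * x) := rfl

/-- Conjugate characters of conjugate subgroups induce isomorphic representations. -/
theorem nonempty_smoothInd_equiv_of_conj (g : G) (hH : ∀ h : H', g * h * g⁻¹ ∈ H)
    (hH' : ∀ h : H, g⁻¹ * h * g ∈ H') (hχ : ∀ h : H', χ.1 ⟨g * h * g⁻¹, hH h⟩ = χ'.1 h) :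
    Nonempty ((smoothInd H (charRep χ)).Equiv (smoothInd H' (charRep χ'))) := by
  have hH'' : ∀ h : H, g⁻¹ * h * g⁻¹⁻¹ ∈ H' := by simpa using hH'
  let S := indTranslate (χ := χ') (χ' := χ) g⁻¹ hH'' (fun h => by
    rw [← hχ]
    congr 1
    ext
    simp [mul_assoc])
  refine ⟨(indTranslate g hH hχ).ofBijective ⟨?_, fun f => ⟨S f, ?_⟩⟩⟩
  · refine Function.LeftInverse.injective (g := S) fun f => indSpace_ext fun x => ?_
    rw [indTranslate_apply, indTranslate_apply, mul_inv_cancel_left]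
  · refine indSpace_ext fun x => ?_
    rw [indTranslate_apply, indTranslate_apply, inv_mul_cancel_left]

end SmoothInduction

/-! ### Induction from an open subgroup of index two -/

section IndexTwo

theorem mul_inv_mem_of_index_two {G : Type*} [Group G] {J : Subgroup G} {g : G}
    (hJ2 : J.index = 2) (hg : g ∉ J) {x : G} (hx : x ∉ J) : x * g⁻¹ ∈ J := by
  rw [Subgroup.mul_mem_iff_of_index_two hJ2, inv_mem_iff]
  exact iff_of_false hx hg

/-- The conjugate `j ↦ χ (g j g⁻¹)` of a character of a normal subgroup. -/
def conjHom {G : Type*} [Group G] [TopologicalSpace G] {k : Type*} [Field k] {J : Subgroup G}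
    [J.Normal] (χ : SmoothChar J k) (g : G) : J →* kˣ :=
  χ.1.comp (MulAut.conjNormal g).toMonoidHom

theorem conjHom_apply {G : Type*} [Group G] [TopologicalSpace G] {k : Type*} [Field k]
    {J : Subgroup G} [J.Normal] (χ : SmoothChar J k) (g : G) (j : J) :
    conjHom χ g j = χ.1 (MulAut.conjNormal g j) := rfl

variable {G : Type*} [Group G] [TopologicalSpace G] [IsTopologicalGroup G] {k : Type*} [Field k]
  {J : Subgroup G}

variable {g : G}

theorem isOpen_map_ker_inf_comap (hJ : IsOpen (J : Set G)) (χ : SmoothChar J k) (g : G) :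
    IsOpen ((χ.1.ker.map J.subtype ⊓ (χ.1.ker.map J.subtype).comap (MulAut.conj g).toMonoidHom :
      Subgroup G) : Set G) := by
  have h1 : IsOpen ((χ.1.ker.map J.subtype : Subgroup G) : Set G) := by
    rw [Subgroup.coe_map]
    exact hJ.isOpenMap_subtype_val _ χ.2
  refine h1.inter (h1.preimage ?_)
  change Continuous fun x => g * x * g⁻¹
  fun_prop

variable {χ χ' : SmoothChar J k}

/-- An equivariant function is determined by its values at `1` and `g`. -/
theorem indSpace_ext_of_index_two (hJ2 : J.index = 2) (hg : g ∉ J) {f f' : IndSpace χ}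
    (h1 : f.1.1 1 = f'.1.1 1) (h2 : f.1.1 g = f'.1.1 g) : f = f' := by
  refine indSpace_ext fun x => ?_
  by_cases hx : x ∈ J
  · have h := fun f : IndSpace χ => indSpace_apply_mul f ⟨x, hx⟩ 1
    simp only [mul_one] at h
    rw [h, h, h1]
  · have h := fun f : IndSpace χ =>
      indSpace_apply_mul f ⟨_, mul_inv_mem_of_index_two hJ2 hg hx⟩ g
    simp only [inv_mul_cancel_right] at h
    rw [h, h, h2]

open Classical in
theorem exists_indSpace_apply_eq (hJ : IsOpen (J : Set G)) (hJ2 : J.index = 2) (hg : g ∉ J)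
    (χ : SmoothChar J k) (a b : k) : ∃ f : IndSpace χ, f.1.1 1 = a ∧ f.1.1 g = b := by
  let F : G → k := fun x => if hx : x ∈ J then χ.1 ⟨x, hx⟩ * a else
    χ.1 ⟨x * g⁻¹, mul_inv_mem_of_index_two hJ2 hg hx⟩ * b
  have hF1 : ∀ j : J, F j = χ.1 j * a := fun j => dif_pos j.2
  have hF2 : ∀ j : J, F (j * g) = χ.1 j * b := fun j => by
    have h : ((j : G) * g) ∉ J := fun h => hg ((Subgroup.mul_mem_cancel_left _ j.2).1 h)
    simp only [F, dif_neg h, mul_inv_cancel_right]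
  have hcov : ∀ x : G, (∃ j : J, x = j) ∨ ∃ j : J, x = j * g := fun x => by
    by_cases hx : x ∈ J
    · exact Or.inl ⟨⟨x, hx⟩, rfl⟩
    · exact Or.inr ⟨⟨_, mul_inv_mem_of_index_two hJ2 hg hx⟩, by simp⟩
  have hF : F ∈ Representation.coindV J.subtype (charRep χ) := by
    intro j x
    rw [charRep_apply, Subgroup.subtype_apply]
    obtain ⟨i, rfl⟩ | ⟨i, rfl⟩ := hcov x
    · rw [← Subgroup.coe_mul, hF1, hF1, map_mul, Units.val_mul, mul_assoc]
    · rw [← mul_assoc, ← Subgroup.coe_mul, hF2, hF2, map_mul, Units.val_mul, mul_assoc]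
  refine ⟨⟨⟨F, hF⟩, ?_⟩, ?_, ?_⟩
  · refine Subgroup.isOpen_mono ?_ (isOpen_map_ker_inf_comap hJ χ g)
    rintro x ⟨⟨i, hi, rfl⟩, ⟨i', hi', hii'⟩⟩
    have hgi : g * i * g⁻¹ = i' := hii'.symm
    refine Subtype.ext (funext fun y => ?_)
    change F (y * i) = F y
    obtain ⟨j, rfl⟩ | ⟨j, rfl⟩ := hcov y
    · rw [← Subgroup.coe_mul, hF1, hF1, map_mul, show χ.1 i = 1 from hi, mul_one]
    · have : (j : G) * g * i = (j * i' : J) * g := by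
        rw [Subgroup.coe_mul, ← hgi]
        group
      rw [this, hF2, hF2, map_mul, show χ.1 i' = 1 from hi', mul_one]
  · simpa using hF1 1
  · simpa using hF2 1

theorem finrank_indSpace (hJ : IsOpen (J : Set G)) (hJ2 : J.index = 2) (χ : SmoothChar J k) :
    Module.finrank k (IndSpace χ) = 2 := by
  obtain ⟨g, hg, -⟩ := Subgroup.index_eq_two_iff_exists_notMem_and.1 hJ2
  let ev : IndSpace χ →ₗ[k] k × k :=
    { toFun := fun f => (f.1.1 1, f.1.1 g)
      map_add' := fun _ _ => rfl
      map_smul' := fun _ _ => rfl }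
  have hev : Function.Bijective ev := by
    refine ⟨fun f f' h => indSpace_ext_of_index_two hJ2 hg (congrArg Prod.fst h)
      (congrArg Prod.snd h), fun z => ?_⟩
    obtain ⟨f, h1, h2⟩ := exists_indSpace_apply_eq hJ hJ2 hg χ z.1 z.2
    exact ⟨f, Prod.ext h1 h2⟩
  rw [(LinearEquiv.ofBijective ev hev).finrank_eq, Module.finrank_prod, Module.finrank_self]

variable [J.Normal]

theorem indSpace_apply_mul_right (f : IndSpace χ) (j : J) :
    f.1.1 (g * j) = conjHom χ g j * f.1.1 g := by
  rw [conjHom_apply, ← indSpace_apply_mul, MulAut.conjNormal_apply, inv_mul_cancel_right]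

theorem smoothInd_eq_smul_of_apply_eq_zero (hJ2 : J.index = 2) (hg : g ∉ J) {f : IndSpace χ}
    (hf : f.1.1 g = 0) (j : J) : smoothInd J (charRep χ) j f = (χ.1 j : k) • f := by
  refine indSpace_ext_of_index_two hJ2 hg ?_ ?_
  · rw [smoothInd_apply]
    change _ = χ.1 j * f.1.1 1
    rw [← indSpace_apply_mul, one_mul, mul_one]
  · rw [smoothInd_apply]
    change _ = χ.1 j * f.1.1 g
    rw [indSpace_apply_mul_right, hf, mul_zero, mul_zero]

theorem smoothInd_eq_conjHom_smul_of_apply_eq_zero (hJ2 : J.index = 2) (hg : g ∉ J)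
    {f : IndSpace χ} (hf : f.1.1 1 = 0) (j : J) :
    smoothInd J (charRep χ) j f = (conjHom χ g j : k) • f := by
  refine indSpace_ext_of_index_two hJ2 hg ?_ ?_
  · rw [smoothInd_apply]
    change _ = conjHom χ g j * f.1.1 1
    rw [one_mul, ← mul_one (j : G), indSpace_apply_mul, hf, mul_zero, mul_zero]
  · rw [smoothInd_apply]
    exact indSpace_apply_mul_right f j

/-- If two induced representations are isomorphic, the characters are equal or conjugate: the
restriction to `J` of the representation induced from `χ` is the sum of `χ` and its conjugate. -/
theorem eq_or_eq_conjHom_of_equiv (hJ : IsOpen (J : Set G)) (hJ2 : J.index = 2) (hg : g ∉ J)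
    (φ : (smoothInd J (charRep χ)).Equiv (smoothInd J (charRep χ'))) :
    χ'.1 = χ.1 ∨ χ'.1 = conjHom χ g := by
  have key : ∀ (f : IndSpace χ) (η : J →* kˣ),
      (∀ j : J, smoothInd J (charRep χ) j f = (η j : k) • f) → (φ f).1.1 1 ≠ 0 → χ'.1 = η := by
    intro f η hf h0
    ext j
    have h1 : smoothInd J (charRep χ') j (φ f) = (η j : k) • φ f := by
      rw [← map_smul φ, ← hf]
      exact (Representation.IntertwiningMap.isIntertwining _ _ φ.toIntertwiningMap _ f).symm
    have h2 := congrArg (fun f => f.1.1 1) h1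
    change (φ f).1.1 (1 * j) = η j * (φ f).1.1 1 at h2
    rw [one_mul, ← mul_one (j : G), indSpace_apply_mul] at h2
    exact mul_right_cancel₀ h0 h2
  obtain ⟨f, hf1, hf2⟩ := exists_indSpace_apply_eq hJ hJ2 hg χ 1 0
  obtain ⟨f', hf1', hf2'⟩ := exists_indSpace_apply_eq hJ hJ2 hg χ 0 1
  by_cases h1 : (φ f).1.1 1 = 0
  · by_cases h2 : (φ f').1.1 1 = 0
    · exfalso
      obtain ⟨e, he, -⟩ := exists_indSpace_apply_eq hJ hJ2 hg χ' 1 0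
      have h3 : φ.symm e = (φ.symm e).1.1 1 • f + (φ.symm e).1.1 g • f' := by
        refine indSpace_ext_of_index_two hJ2 hg ?_ ?_
        · change _ = _ * f.1.1 1 + _ * f'.1.1 1
          rw [hf1, hf1', mul_one, mul_zero, add_zero]
        · change _ = _ * f.1.1 g + _ * f'.1.1 g
          rw [hf2, hf2', mul_one, mul_zero, zero_add]
      have h4 : e = φ (φ.symm e) := (φ.apply_symm_apply e).symm
      rw [h3, map_add, map_smul, map_smul] at h4
      have h5 := congrArg (fun f => f.1.1 1) h4
      change e.1.1 1 = _ * (φ f).1.1 1 + _ * (φ f').1.1 1 at h5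
      rw [he, h1, h2, mul_zero, mul_zero, add_zero] at h5
      exact one_ne_zero h5
    · exact Or.inr (key f' _ (smoothInd_eq_conjHom_smul_of_apply_eq_zero hJ2 hg hf1') h2)
  · exact Or.inl (key f _ (smoothInd_eq_smul_of_apply_eq_zero hJ2 hg hf2) h1)

/-- A character distinct from its conjugate induces an irreducible representation: a non-zero
subrepresentation contains a function `f` with `f 1 ≠ 0`, hence its component in the `χ`-eigenline
of `J`, and `g` carries this eigenline to the other one. -/
theorem isIrreducible_smoothInd (hJ : IsOpen (J : Set G)) (hJ2 : J.index = 2) (hg : g ∉ J)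
    (hχ : conjHom χ g ≠ χ.1) :
    Representation.IsIrreducible (V := IndSpace χ) (smoothInd J (charRep χ)) := by
  obtain ⟨j, hj⟩ := DFunLike.ne_iff.1 hχ
  have hj' : (χ.1 j : k) - conjHom χ g j ≠ 0 := sub_ne_zero.2 fun h => hj (Units.ext h.symm)
  have hgg : ∀ f : IndSpace χ, f.1.1 (g * g) =
      χ.1 ⟨g * g, Subgroup.mul_self_mem_of_index_two hJ2 g⟩ * f.1.1 1 := fun f => by
    rw [← indSpace_apply_mul, mul_one]
  obtain ⟨e₁, h1, h1'⟩ := exists_indSpace_apply_eq hJ hJ2 hg χ 1 0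
  have hne : Nontrivial (Subrepresentation (smoothInd J (charRep χ))) := by
    refine ⟨⊥, ⊤, fun h => ?_⟩
    have h2 : e₁ ∈ (⊥ : Subrepresentation (smoothInd J (charRep χ))).toSubmodule := by
      rw [h]
      trivial
    have h3 : e₁ = 0 := h2
    rw [h3] at h1
    exact zero_ne_one h1
  refine { eq_bot_or_eq_top := fun W => or_iff_not_imp_left.2 fun hW => ?_ }
  have hact : ∀ x, ∀ f ∈ W.toSubmodule, smoothInd J (charRep χ) x f ∈ W.toSubmodule := fun x f hf =>
    W.apply_mem_toSubmodule x hf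
  obtain ⟨f, hfW, hf⟩ : ∃ f ∈ W.toSubmodule, f.1.1 1 ≠ 0 := by
    by_contra! hall
    refine hW (Subrepresentation.toSubmodule_injective ((Submodule.eq_bot_iff _).2 fun f hf => ?_))
    refine indSpace_ext_of_index_two hJ2 hg (hall f hf) ?_
    have := hall _ (hact g f hf)
    rwa [smoothInd_apply, one_mul] at this
  -- subtracting the component on which `J` acts by the conjugate character
  have h1W : e₁ ∈ W.toSubmodule := by
    have h2 := W.toSubmodule.smul_mem ((χ.1 j - conjHom χ g j) * f.1.1 1 : k)⁻¹
      (W.toSubmodule.add_mem (hact j f hfW)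
        (W.toSubmodule.smul_mem (-(conjHom χ g j : k)) hfW))
    convert! h2 using 1
    refine indSpace_ext_of_index_two hJ2 hg ?_ ?_
    · change e₁.1.1 1 = _⁻¹ * (f.1.1 (1 * j) + -(conjHom χ g j : k) * f.1.1 1)
      rw [one_mul, ← mul_one (j : G), indSpace_apply_mul, ← add_mul, ← sub_eq_add_neg, h1,
        inv_mul_cancel₀ (mul_ne_zero hj' hf)]
    · change e₁.1.1 g = _⁻¹ * (f.1.1 (g * j) + -(conjHom χ g j : k) * f.1.1 g)
      rw [indSpace_apply_mul_right, ← add_mul, add_neg_cancel, zero_mul, mul_zero, h1']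
  refine Subrepresentation.toSubmodule_injective ((Submodule.eq_top_iff').2 fun f => ?_)
  have h2W := hact g _ h1W
  set e₂ := smoothInd J (charRep χ) g e₁
  have h2 : e₂.1.1 1 = 0 := by rw [smoothInd_apply, one_mul, h1']
  have h2' : e₂.1.1 g ≠ 0 := by
    rw [smoothInd_apply, hgg, h1, mul_one]
    exact Units.ne_zero _
  convert! W.toSubmodule.add_mem (W.toSubmodule.smul_mem (f.1.1 1) h1W)
    (W.toSubmodule.smul_mem (f.1.1 g * (e₂.1.1 g)⁻¹) h2W) using 1
  refine indSpace_ext_of_index_two hJ2 hg ?_ ?_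
  · change _ = _ * e₁.1.1 1 + _ * e₂.1.1 1
    rw [h1, h2, mul_one, mul_zero, add_zero]
  · change _ = _ * e₁.1.1 g + _ * e₂.1.1 g
    rw [h1', mul_zero, zero_add, inv_mul_cancel_right₀ h2']

end IndexTwo

/-! ### Extension of invariant characters from a subgroup of index two -/

section Extension

variable {G : Type*} [Group G] [TopologicalSpace G] [IsTopologicalGroup G] {k : Type*} [Field k]
  {J : Subgroup G} {χ : SmoothChar J k} {g : G}

theorem smoothChar_ext_of_index_two {G : Type*} [Group G] [TopologicalSpace G] {k : Type*}
    [Field k] {J : Subgroup G} {g : G} {ψ ψ' : SmoothChar G k} (hJ2 : J.index = 2) (hg : g ∉ J)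
    (hJ : ∀ j : J, ψ.1 j = ψ'.1 j) (h : ψ.1 g = ψ'.1 g) : ψ = ψ' := by
  refine Subtype.ext (MonoidHom.ext fun x => ?_)
  by_cases hx : x ∈ J
  · exact hJ ⟨x, hx⟩
  · have h1 := hJ ⟨_, mul_inv_mem_of_index_two hJ2 hg hx⟩
    rw [← inv_mul_cancel_right x g, map_mul ψ.1 (x * g⁻¹), map_mul ψ'.1 (x * g⁻¹), h, h1]

open Classical in
/-- An invariant character `χ` of a subgroup of index two extends, the value of the extension at
`g` being any square root of `χ (g²)`. -/
theorem exists_smoothChar_extension [J.Normal] (hJ : IsOpen (J : Set G)) (hJ2 : J.index = 2)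
    (hg : g ∉ J) (hχ : conjHom χ g = χ.1) {c : kˣ}
    (hc : c * c = χ.1 ⟨g * g, Subgroup.mul_self_mem_of_index_two hJ2 g⟩) :
    ∃ ψ : SmoothChar G k, (∀ j : J, ψ.1 j = χ.1 j) ∧ ψ.1 g = c := by
  let F : G → kˣ := fun x => if hx : x ∈ J then χ.1 ⟨x, hx⟩ else
    χ.1 ⟨x * g⁻¹, mul_inv_mem_of_index_two hJ2 hg hx⟩ * c
  have hF1 : ∀ j : J, F j = χ.1 j := fun j => dif_pos j.2
  have hF2 : ∀ j : J, F (j * g) = χ.1 j * c := fun j => by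
    have h : ((j : G) * g) ∉ J := fun h => hg ((Subgroup.mul_mem_cancel_left _ j.2).1 h)
    simp only [F, dif_neg h, mul_inv_cancel_right]
  have hcov : ∀ x : G, (∃ j : J, x = j) ∨ ∃ j : J, x = j * g := fun x => by
    by_cases hx : x ∈ J
    · exact Or.inl ⟨⟨x, hx⟩, rfl⟩
    · exact Or.inr ⟨⟨_, mul_inv_mem_of_index_two hJ2 hg hx⟩, by simp⟩
  have hconj : ∀ j : J, χ.1 (MulAut.conjNormal g j) = χ.1 j := fun j => by
    rw [← conjHom_apply, hχ]
  have hgj : ∀ j : J, g * j = (MulAut.conjNormal g j : J) * g := fun j => by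
    rw [MulAut.conjNormal_apply, inv_mul_cancel_right]
  have hmul : ∀ x y, F (x * y) = F x * F y := by
    intro x y
    obtain ⟨i, rfl⟩ | ⟨i, rfl⟩ := hcov x <;> obtain ⟨j, rfl⟩ | ⟨j, rfl⟩ := hcov y
    · rw [← Subgroup.coe_mul, hF1, hF1, hF1, map_mul]
    · rw [← mul_assoc, ← Subgroup.coe_mul, hF1, hF2, hF2, map_mul, mul_assoc]
    · rw [mul_assoc, hgj, ← mul_assoc, ← Subgroup.coe_mul, hF2, hF2, hF1, map_mul, hconj,
        mul_right_comm]
    · have : (i : G) * g * (j * g) = (i * MulAut.conjNormal g j *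
          ⟨g * g, Subgroup.mul_self_mem_of_index_two hJ2 g⟩ : J) := by
        rw [Subgroup.coe_mul, Subgroup.coe_mul, MulAut.conjNormal_apply]
        group
      rw [this, hF1, hF2, hF2, map_mul, map_mul, hconj, ← hc]
      exact mul_mul_mul_comm _ _ _ _
  let ψ : G →* kˣ :=
    { toFun := F
      map_one' := (hF1 1).trans (map_one _)
      map_mul' := hmul }
  refine ⟨⟨ψ, ?_⟩, hF1, ?_⟩
  · refine Subgroup.isOpen_mono (H₁ := χ.1.ker.map J.subtype) ?_ ?_
    · rintro _ ⟨j, hj, rfl⟩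
      exact (hF1 j).trans hj
    · rw [Subgroup.coe_map]
      exact hJ.isOpenMap_subtype_val _ χ.2
  · have := hF2 1
    rwa [Subgroup.coe_one, one_mul, map_one, one_mul] at this

theorem exists_smoothChar_extension_of_isAlgClosed [IsAlgClosed k] [J.Normal]
    (hJ : IsOpen (J : Set G)) (hJ2 : J.index = 2) (hg : g ∉ J) (hχ : conjHom χ g = χ.1) :
    ∃ ψ : SmoothChar G k, ∀ j : J, ψ.1 j = χ.1 j := by
  obtain ⟨c, hc⟩ := IsAlgClosed.exists_eq_mul_self
    ((χ.1 ⟨g * g, Subgroup.mul_self_mem_of_index_two hJ2 g⟩ : kˣ) : k)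
  have hc0 : c ≠ 0 := by
    rintro rfl
    exact Units.ne_zero _ (hc.trans (mul_zero 0))
  obtain ⟨ψ, hψ, -⟩ := exists_smoothChar_extension hJ hJ2 hg hχ (c := Units.mk0 c hc0)
    (Units.ext hc.symm)
  exact ⟨ψ, hψ⟩

variable {ψ : SmoothChar G k} (hψ : ∀ j : J, ψ.1 j = χ.1 j)
include hψ

/-- The embedding in the induced representation of an extension of the character. -/
def extensionToInd : (charRep ψ).IntertwiningMap (smoothInd J (charRep χ)) :=
  indLift (isSmooth_charRep ψ) LinearMap.id fun j a => by
    rw [charRep_apply, hψ]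
    rfl

theorem extensionToInd_apply (a : k) (x : G) :
    (extensionToInd hψ a).1.1 x = ψ.1 x * a := rfl

/-- The representation induced from an invariant character is reducible. -/
theorem not_isIrreducible_of_extension (hJ : IsOpen (J : Set G)) (hJ2 : J.index = 2) :
    ¬ Representation.IsIrreducible (V := IndSpace χ) (smoothInd J (charRep χ)) := by
  intro hirr
  obtain ⟨g, hg, -⟩ := Subgroup.index_eq_two_iff_exists_notMem_and.1 hJ2
  let W := (extensionToInd hψ).range
  have hW : ∀ f : IndSpace χ, f ∈ W.toSubmodule ↔ ∃ a, extensionToInd hψ a = f := fun f => Iff.rfl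
  obtain h | h := hirr.eq_bot_or_eq_top W
  · have h1 : extensionToInd hψ 1 ∈ W.toSubmodule := ⟨1, rfl⟩
    rw [h] at h1
    have h2 : extensionToInd hψ 1 = 0 := h1
    have h3 := congrArg (fun f : IndSpace χ => f.1.1 1) h2
    change (ψ.1 1 : k) * 1 = 0 at h3
    simp at h3
  · obtain ⟨f, h1, h2⟩ := exists_indSpace_apply_eq hJ hJ2 hg χ 0 1
    have h3 : f ∈ W.toSubmodule := by
      rw [h]
      trivial
    obtain ⟨a, rfl⟩ := (hW f).1 h3
    rw [extensionToInd_apply, map_one, Units.val_one, one_mul] at h1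
    rw [extensionToInd_apply, h1, mul_zero] at h2
    exact zero_ne_one h2

/-- The induced representation is the sum of two distinct extensions of the character: these
agree on `J` and so differ at `g`, which makes `(a, b) ↦ ψ a + ψ' b` bijective. -/
theorem nonempty_equiv_prod (hJ2 : J.index = 2) (hg : g ∉ J)
    {ψ' : SmoothChar G k} (hψ' : ∀ j : J, ψ'.1 j = χ.1 j) (hne : ψ ≠ ψ') :
    Nonempty (Representation.Equiv (V := IndSpace χ) (smoothInd J (charRep χ))
      ((charRep ψ).prod (charRep ψ'))) := by
  let T : ((charRep ψ).prod (charRep ψ')).IntertwiningMap (smoothInd J (charRep χ)) :=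
    indLift (isSmooth_prod (isSmooth_charRep ψ) (isSmooth_charRep ψ'))
      (LinearMap.fst k k k + LinearMap.snd k k k) fun j a => by
        change ψ.1 j * a.1 + ψ'.1 j * a.2 = χ.1 j * (a.1 + a.2)
        rw [hψ, hψ', mul_add]
  have hT : ∀ (a : k × k) (x : G), (T a).1.1 x = ψ.1 x * a.1 + ψ'.1 x * a.2 := fun _ _ => rfl
  have hdet : (ψ.1 g : k) - ψ'.1 g ≠ 0 := fun h =>
    hne (smoothChar_ext_of_index_two hJ2 hg (fun j => (hψ j).trans (hψ' j).symm)
      (Units.ext (sub_eq_zero.1 h)))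
  refine ⟨(T.ofBijective ⟨?_, ?_⟩).symm⟩
  · intro a b hab
    have h1 : (ψ.1 1 : k) * a.1 + ψ'.1 1 * a.2 = ψ.1 1 * b.1 + ψ'.1 1 * b.2 :=
      congrArg (fun f : IndSpace χ => f.1.1 1) hab
    have h2 : (ψ.1 g : k) * a.1 + ψ'.1 g * a.2 = ψ.1 g * b.1 + ψ'.1 g * b.2 :=
      congrArg (fun f : IndSpace χ => f.1.1 g) hab
    simp only [map_one, Units.val_one, one_mul] at h1
    have h3 : a.1 = b.1 := mul_left_cancel₀ hdet (by linear_combination h2 - (ψ'.1 g : k) * h1)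
    exact Prod.ext h3 (by linear_combination h1 - h3)
  · intro f
    refine ⟨((f.1.1 g - ψ'.1 g * f.1.1 1) / (ψ.1 g - ψ'.1 g),
      (ψ.1 g * f.1.1 1 - f.1.1 g) / (ψ.1 g - ψ'.1 g)),
      indSpace_ext_of_index_two hJ2 hg ?_ ?_⟩
    · rw [hT, map_one, map_one, Units.val_one]
      field_simp
      ring
    · rw [hT]
      field_simp
      ring

theorem extension_mul_apply_of_mem (f : IndSpace χ) {x : G} (hx : x ∈ J) :
    f.1.1 x = ψ.1 x * f.1.1 1 := by
  have h := indSpace_apply_mul f ⟨x, hx⟩ 1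
  rw [mul_one] at h
  rw [h, ← hψ]

theorem extension_mul_apply_of_notMem (hJ2 : J.index = 2) (hg : g ∉ J) (f : IndSpace χ) {x : G}
    (hx : x ∉ J) : f.1.1 x = ψ.1 x * ((ψ.1 g)⁻¹ : kˣ) * f.1.1 g := by
  have h := indSpace_apply_mul f ⟨x * g⁻¹, mul_inv_mem_of_index_two hJ2 hg hx⟩ g
  rw [inv_mul_cancel_right] at h
  rw [h, ← hψ, map_mul, map_inv, Units.val_mul]

/-- In characteristic two the representation induced from a character with an extension `ψ` is a
non-split extension of `ψ` by itself. The quotient map sends `f` to `h g - h 1` for `h = ψ⁻¹ f`: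
right translation by an element outside `J` exchanges the two values of `h`. -/
theorem isNonsplitSelfExtension_of_charP_two [CharP k 2] (hJ : IsOpen (J : Set G))
    (hJ2 : J.index = 2) (hg : g ∉ J) :
    IsNonsplitSelfExtension (V := IndSpace χ) ψ (smoothInd J (charRep χ)) := by
  let Q : IndSpace χ →ₗ[k] k :=
    { toFun := fun f => ((ψ.1 g)⁻¹ : kˣ) * f.1.1 g - f.1.1 1
      map_add' := fun f f' => by
        change _ * (f.1.1 g + f'.1.1 g) - (f.1.1 1 + f'.1.1 1) = _
        ring
      map_smul' := fun c f => by
        change _ * (c * f.1.1 g) - c * f.1.1 1 = c * _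
        ring }
  have hQ : ∀ f : IndSpace χ, Q f = ((ψ.1 g)⁻¹ : kˣ) * f.1.1 g - f.1.1 1 := fun _ => rfl
  have hgu : ((ψ.1 g)⁻¹ : kˣ) * (ψ.1 g : k) = 1 := Units.inv_mul _
  have hQρ : ∀ x f, Q (smoothInd J (charRep χ) x f) = ψ.1 x * Q f := by
    intro x f
    rw [hQ, hQ, smoothInd_apply, smoothInd_apply, one_mul]
    by_cases hx : x ∈ J
    · have hgx : g * x ∉ J := fun h => hg ((Subgroup.mul_mem_cancel_right _ hx).1 h)
      rw [extension_mul_apply_of_mem hψ f hx, extension_mul_apply_of_notMem hψ hJ2 hg f hgx,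
        map_mul, Units.val_mul]
      linear_combination (ψ.1 x * ((ψ.1 g)⁻¹ : kˣ) * f.1.1 g : k) * hgu
    · have hgx : g * x ∈ J := by
        rw [Subgroup.mul_mem_iff_of_index_two hJ2]
        exact iff_of_false hg hx
      rw [extension_mul_apply_of_notMem hψ hJ2 hg f hx, extension_mul_apply_of_mem hψ f hgx,
        map_mul, Units.val_mul]
      have h2 : (2 : k) = 0 := CharP.cast_eq_zero k 2
      linear_combination (ψ.1 x * f.1.1 1 : k) * hgu +
        (ψ.1 x * (f.1.1 1 - ((ψ.1 g)⁻¹ : kˣ) * f.1.1 g) : k) * h2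
  let q : (smoothInd J (charRep χ)).IntertwiningMap (charRep ψ) :=
    { toLinearMap := Q
      isIntertwining' := fun x => LinearMap.ext fun f => hQρ x f }
  have hq : ∀ f : IndSpace χ, q f = ((ψ.1 g)⁻¹ : kˣ) * f.1.1 g - f.1.1 1 := fun _ => rfl
  refine ⟨extensionToInd hψ, q, fun a b hab => ?_, fun f => ⟨fun h => ?_, ?_⟩, fun a => ?_, ?_⟩
  · have h := congrArg (fun f : IndSpace χ => f.1.1 1) hab
    change (ψ.1 1 : k) * a = ψ.1 1 * b at h
    simpa using h
  · rw [hq] at h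
    refine ⟨f.1.1 1, indSpace_ext_of_index_two hJ2 hg ?_ ?_⟩
    · rw [extensionToInd_apply, map_one, Units.val_one, one_mul]
    · rw [extensionToInd_apply]
      linear_combination (-(ψ.1 g : k)) * h + f.1.1 g * hgu
  · rintro ⟨a, rfl⟩
    rw [hq, extensionToInd_apply, extensionToInd_apply, map_one, Units.val_one]
    linear_combination a * hgu
  · obtain ⟨f, h1, h2⟩ := exists_indSpace_apply_eq hJ hJ2 hg χ 0 (ψ.1 g * a)
    refine ⟨f, ?_⟩
    rw [hq, h1, h2]
    linear_combination a * hgu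
  · rintro ⟨s, hs⟩
    have h1 : smoothInd J (charRep χ) g (s 1) = s (charRep ψ g 1) :=
      (Representation.IntertwiningMap.isIntertwining _ _ s g 1).symm
    have h2 : charRep ψ g (1 : k) = (ψ.1 g : k) • (1 : k) := rfl
    rw [h2, map_smul] at h1
    have h3 := congrArg (fun f : IndSpace χ => f.1.1 1) h1
    change (s 1).1.1 (1 * g) = ψ.1 g * (s 1).1.1 1 at h3
    rw [one_mul] at h3
    have h4 := hs 1
    rw [hq, h3] at h4
    refine one_ne_zero (α := k) ?_
    rw [← h4]
    linear_combination ((s 1).1.1 1) * hgu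

end Extension

/-! ### Irreducible representations with a large abelian quotient -/

section Classification

/-- Commuting operators on a finite-dimensional space have a common eigenvector. -/
theorem exists_common_eigenvector {k W : Type*} [Field k] [IsAlgClosed k] [AddCommGroup W]
    [Module k W] [FiniteDimensional k W] [Nontrivial W] {S : Type*} (T : S → Module.End k W)
    (hT : ∀ i j, Commute (T i) (T j)) : ∃ v : W, v ≠ 0 ∧ ∀ i, ∃ c : k, T i v = c • v := by
  obtain ⟨P, ⟨hP0, hP⟩, hmin⟩ := WellFounded.has_min
    (measure fun P : Submodule k W => Module.finrank k P).wf
    {P | P ≠ ⊥ ∧ ∀ i, ∀ v ∈ P, T i v ∈ P} ⟨⊤, top_ne_bot, fun _ _ _ => trivial⟩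
  obtain ⟨v, hv, hv0⟩ := P.exists_mem_ne_zero_of_ne_bot hP0
  refine ⟨v, hv0, fun i => ?_⟩
  have : Nontrivial P := Submodule.nontrivial_iff_ne_bot.2 hP0
  obtain ⟨c, hc⟩ := Module.End.exists_eigenvalue ((T i).restrict (hP i))
  obtain ⟨x, hx⟩ := hc.exists_hasEigenvector
  let P' : Submodule k W := P ⊓ LinearMap.ker (T i - algebraMap k _ c)
  have hmem : ∀ y, y ∈ P' ↔ y ∈ P ∧ T i y = c • y := fun y => by
    rw [Submodule.mem_inf, LinearMap.mem_ker, LinearMap.sub_apply, sub_eq_zero,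
      Module.algebraMap_end_apply]
  have hP' : P' = P := by
    refine Submodule.eq_of_le_of_finrank_le inf_le_left (not_lt.1 (hmin P' ⟨?_, ?_⟩))
    · refine Submodule.ne_bot_iff _ |>.2 ⟨x, (hmem _).2 ⟨x.2, ?_⟩, ?_⟩
      · exact congrArg Subtype.val hx.apply_eq_smul
      · exact fun h => hx.2 (Subtype.ext h)
    · intro j y hy
      obtain ⟨h1, h2⟩ := (hmem y).1 hy
      refine (hmem _).2 ⟨hP j y h1, ?_⟩
      rw [← Module.End.mul_apply, (hT i j).eq, Module.End.mul_apply, h2, map_smul]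
  exact ⟨c, ((hmem v).1 (hP'.symm ▸ hv)).2⟩

variable {G : Type*} [Group G] {k : Type*} [Field k]
  {V : Type*} [AddCommGroup V] [Module k V] {ρ : Representation k G V} {U : Subgroup G}

/-- A normal subgroup with a non-zero fixed vector acts trivially on an irreducible
representation. -/
theorem apply_eq_self_of_isIrreducible [U.Normal] (hirr : ρ.IsIrreducible)
    (hfix : ∃ v : V, v ≠ 0 ∧ ∀ x ∈ U, ρ x v = v) (x : G) (hx : x ∈ U) (v : V) : ρ x v = v := by
  let W : Subrepresentation ρ :=
    { toSubmodule :=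
        { carrier := {v | ∀ x ∈ U, ρ x v = v}
          zero_mem' := fun x _ => map_zero _
          add_mem' := fun ha hb x hx => by rw [map_add, ha x hx, hb x hx]
          smul_mem' := fun c v hv x hx => by rw [map_smul, hv x hx] }
      apply_mem_toSubmodule := fun g v hv x hx => by
        have h := hv _ (Subgroup.Normal.conj_mem' ‹U.Normal› x hx g)
        rw [map_mul, map_mul, Module.End.mul_apply, Module.End.mul_apply] at h
        have h' := congrArg (ρ g) h
        rwa [ρ.self_inv_apply] at h' }
  obtain ⟨v₀, hv₀, hfix⟩ := hfix
  obtain h | h := hirr.eq_bot_or_eq_top W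
  · have h1 : v₀ ∈ W.toSubmodule := hfix
    rw [h] at h1
    exact absurd h1 hv₀
  · have h1 : v ∈ W.toSubmodule := by
      rw [h]
      trivial
    exact h1 x hx

theorem nonempty_equiv_of_finrank_eq_two {W : Type*} [AddCommGroup W] [Module k W]
    {σ : Representation k G W} (hW : Module.finrank k W = 2) (hirr : ρ.IsIrreducible)
    (T : ρ.IntertwiningMap σ) (hT0 : T ≠ 0) :
    Module.finrank k V = 1 ∨ Module.finrank k V = 2 ∧ Nonempty (ρ.Equiv σ) := by
  have : FiniteDimensional k W := Module.finite_of_finrank_pos (by omega)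
  have hT : Function.Injective T.toLinearMap :=
    (Representation.IsIrreducible.injective_or_eq_zero T).resolve_right hT0
  have hle : Module.finrank k V ≤ 2 := hW ▸ LinearMap.finrank_le_finrank_of_injective hT
  have hfd : FiniteDimensional k V := FiniteDimensional.of_injective T.toLinearMap hT
  obtain ⟨v, hv⟩ : ∃ v, T v ≠ 0 := by
    by_contra! h
    exact hT0 (Representation.IntertwiningMap.ext (LinearMap.ext h))
  have hpos : 0 < Module.finrank k V := Module.finrank_pos_iff_exists_ne_zero.2 ⟨v, by
    rintro rfl
    exact hv (map_zero T)⟩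
  obtain h | h : Module.finrank k V = 1 ∨ Module.finrank k V = 2 := by omega
  · exact Or.inl h
  · exact Or.inr ⟨h, ⟨T.ofBijective ⟨hT,
      (LinearMap.injective_iff_surjective_of_finrank_eq_finrank (h.trans hW.symm)).1 hT⟩⟩⟩

variable [TopologicalSpace G]

theorem finiteDimensional_of_isAdmissible (hadm : IsAdmissible ρ)
    (hU : IsOpen (U : Set G)) (hUc : IsCompact (U : Set G))
    (htriv : ∀ x ∈ U, ∀ v, ρ x v = v) : FiniteDimensional k V := by
  have h := hadm.2 U hU hUc
  have htop : Representation.invariants (ρ.comp U.subtype) = ⊤ := by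
    rw [Submodule.eq_top_iff']
    exact fun v x => htriv x x.2 v
  rw [htop] at h
  exact Module.Finite.equiv (Submodule.topEquiv (R := k) (M := V))

/-- A finite-dimensional smooth representation on which the elements of `J` commute has a
`J`-eigenfunctional. -/
theorem exists_smoothChar_functional [IsAlgClosed k] [IsTopologicalGroup G] {J : Subgroup G}
    [FiniteDimensional k V] [Nontrivial V] (hρ : IsSmooth ρ)
    (hcomm : ∀ x ∈ J, ∀ y ∈ J, ∀ v, ρ x (ρ y v) = ρ y (ρ x v)) :
    ∃ (χ : SmoothChar J k) (ℓ : V →ₗ[k] k), ℓ ≠ 0 ∧ ∀ (j : J) v, ℓ (ρ j v) = χ.1 j * ℓ v := by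
  obtain ⟨ℓ, hℓ, h⟩ := exists_common_eigenvector (W := Module.Dual k V)
    (fun j : J => Module.Dual.transpose (R := k) (ρ j)) fun i j => by
      ext ℓ v
      change ℓ (ρ j (ρ i v)) = ℓ (ρ i (ρ j v))
      rw [hcomm j j.2 i i.2]
  choose c hc using h
  have hc : ∀ (j : J) (v : V), ℓ (ρ j v) = c j * ℓ v := fun j v => LinearMap.congr_fun (hc j) v
  obtain ⟨v, hv⟩ : ∃ v, ℓ v ≠ 0 := by
    by_contra! h
    exact hℓ (LinearMap.ext h)
  let η : J →* k :=
    { toFun := c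
      map_one' := mul_right_cancel₀ hv (by rw [← hc, one_mul]; simp)
      map_mul' := fun i j => mul_right_cancel₀ hv (by
        rw [← hc, mul_assoc, ← hc, ← hc, Subgroup.coe_mul, map_mul, Module.End.mul_apply]) }
  refine ⟨⟨η.toHomUnits, ?_⟩, ℓ, hℓ, hc⟩
  refine Subgroup.isOpen_mono (H₁ := (vecStab ρ v).subgroupOf J) ?_
    ((hρ v).preimage continuous_subtype_val)
  intro j hj
  have hj' : ρ j v = v := hj
  refine Units.ext (mul_right_cancel₀ hv ?_)
  change c j * ℓ v = 1 * ℓ v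
  rw [← hc, hj', one_mul]

/-- An irreducible representation of dimension greater than one with a `J`-eigenfunctional is
isomorphic to an induced representation. -/
theorem nonempty_equiv_smoothInd [IsTopologicalGroup G] {J : Subgroup G} (hJ : IsOpen (J : Set G))
    (hJ2 : J.index = 2) (hirr : ρ.IsIrreducible) (hρ : IsSmooth ρ) {χ : SmoothChar J k}
    {ℓ : V →ₗ[k] k} (hℓ0 : ℓ ≠ 0) (hℓ : ∀ (j : J) v, ℓ (ρ j v) = χ.1 j * ℓ v) :
    Module.finrank k V = 1 ∨ Module.finrank k V = 2 ∧
      Nonempty (Representation.Equiv (W := IndSpace χ) ρ (smoothInd J (charRep χ))) := by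
  refine nonempty_equiv_of_finrank_eq_two (W := IndSpace χ) (finrank_indSpace hJ hJ2 χ) hirr (indLift hρ ℓ hℓ)
    fun h => hℓ0 (LinearMap.ext fun v => ?_)
  have h1 : indLift hρ ℓ hℓ v = 0 := by rw [h]; rfl
  have h2 := congrArg (fun f : IndSpace χ => f.1.1 1) h1
  change ℓ (ρ 1 v) = 0 at h2
  simpa using h2

end Classification

/-! ### Characters in residue characteristic -/

section LocalCharacters

theorem valuation_natCast_lt_one (F : Type*) [Field F] [ValuativeRel F] [TopologicalSpace F]
    [IsNonarchimedeanLocalField F] {p : ℕ} [CharP 𝓀[F] p] :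
    valuation F (p : F) < 1 := by
  have h : IsLocalRing.residue 𝒪[F] (p : 𝒪[F]) = 0 := by
    rw [map_natCast, CharP.cast_eq_zero]
  have h1 := mem_maximalIdeal_integer_iff.1 ((IsLocalRing.residue_eq_zero_iff _).1 h)
  simpa using h1

theorem valuation_natCast_lt_one_of_extension {F E : Type*} [Field F] [ValuativeRel F] [Field E]
    [ValuativeRel E] [Algebra F E] [ValuativeExtension F E] {p : ℕ}
    (hp : valuation F (p : F) < 1) : valuation E (p : E) < 1 := by
  rw [← map_natCast (algebraMap F E)]
  exact (Valuation.HasExtension.val_map_lt_one_iff (valuation F) (valuation E) _).2 hp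

variable {k : Type*} [Field k] {p : ℕ} [Fact p.Prime] [CharP k p]

/-- Characters of characteristic `p` are trivial on the principal units of a local field of residue
characteristic `p`. -/
theorem smoothChar_apply_eq_one_of_mem_principalUnits {L : Type*} [Field L] [ValuativeRel L]
    [TopologicalSpace L] [IsNonarchimedeanLocalField L] (hp : valuation L (p : L) < 1)
    (ξ : SmoothChar Lˣ k) {e : Lˣ} (he : e ∈ principalUnits (valuation L)) : ξ.1 e = 1 :=
  smoothChar_apply_eq_one (p := p) ξ fun _ hH =>
    (hasBallTopology_valuation L).exists_pow_prime_pow_mem Fact.out hp hH he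

theorem isOpen_ker_of_principalUnits_le {L : Type*} [Field L] [ValuativeRel L]
    [TopologicalSpace L] [IsNonarchimedeanLocalField L] (η : Lˣ →* kˣ)
    (hη : ∀ e ∈ principalUnits (valuation L), η e = 1) : IsOpen (η.ker : Set Lˣ) :=
  Subgroup.isOpen_mono (H₁ := principalUnits (valuation L)) hη
    (hasBallTopology_valuation L).isOpen_principalUnits

theorem exists_pow_prime_pow_mem_of_mem_principalUnits {F : Type*} [Field F]
    [ValuativeRel F] [TopologicalSpace F] [IsNonarchimedeanLocalField F]
    {D : Type*} [DivisionRing D] [Algebra F D] [IsQuadraticDivisionAlgebra F D]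
    [TopologicalSpace D] [IsTopologicalRing D] [IsModuleTopology F D] {p : ℕ} [Fact p.Prime]
    (hp : valuation F (p : F) < 1)
    {x : Dˣ} (hx : x ∈ principalUnits (nrdVal F D)) {H : Subgroup Dˣ} (hH : IsOpen (H : Set Dˣ)) :
    ∃ n, x ^ p ^ n ∈ H := by
  refine (hasBallTopology_nrdVal F D).exists_pow_prime_pow_mem Fact.out ?_ hH hx
  rw [← map_natCast (algebraMap F D), nrdVal_algebraMap]
  exact pow_lt_one₀ zero_le hp two_ne_zero

theorem smoothChar_subgroup_apply_eq_one_of_mem_principalUnits {F : Type*} [Field F]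
    [ValuativeRel F] [TopologicalSpace F] [IsNonarchimedeanLocalField F]
    {D : Type*} [DivisionRing D] [Algebra F D] [IsQuadraticDivisionAlgebra F D]
    [TopologicalSpace D] [IsTopologicalRing D] [IsModuleTopology F D] {J : Subgroup Dˣ}
    (hJ : IsOpen (J : Set Dˣ)) (hp : valuation F (p : F) < 1)
    (χ : SmoothChar J k) {x : J} (hx : (x : Dˣ) ∈ principalUnits (nrdVal F D)) : χ.1 x = 1 := by
  refine smoothChar_apply_eq_one (p := p) χ fun H hH => ?_
  have hH' : IsOpen ((H.map J.subtype : Subgroup Dˣ) : Set Dˣ) := by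
    rw [Subgroup.coe_map]
    exact hJ.isOpenMap_subtype_val _ hH
  obtain ⟨n, y, hy, hyx⟩ := exists_pow_prime_pow_mem_of_mem_principalUnits hp hx hH'
  refine ⟨n, ?_⟩
  rwa [show x ^ p ^ n = y from Subtype.ext hyx.symm]

end LocalCharacters

/-! ### Regular characters -/

section Regular

/-- A character factors through a homomorphism if it is trivial on its kernel, the target of the
character being divisible. -/
theorem exists_eq_comp_of_ker_le {A Q k : Type*} [CommGroup A] [CommGroup Q] [Field k]
    [IsAlgClosed k] (f : A →* Q) (ξ : A →* kˣ) (h : f.ker ≤ ξ.ker) :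
    ∃ φ : Q →* kˣ, ∀ a, ξ a = φ (f a) := by
  have hdiv : ∀ {n : ℕ}, n ≠ 0 → Function.Surjective fun x : kˣ => x ^ n := by
    intro n hn x
    obtain ⟨y, hy⟩ := IsAlgClosed.exists_pow_nat_eq (x : k) (Nat.pos_of_ne_zero hn)
    have hy0 : y ≠ 0 := by
      rintro rfl
      rw [zero_pow hn] at hy
      exact x.ne_zero hy.symm
    exact ⟨Units.mk0 y hy0, Units.ext hy⟩
  let _ : DivisibleBy (Additive kˣ) ℕ := divisibleByOfSMulRightSurj _ _ hdiv
  let _ : DivisibleBy (Additive kˣ) ℤ := AddGroup.divisibleByIntOfDivisibleByNat _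
  obtain ⟨φ, hφ⟩ := (Module.Baer.of_divisible (Additive kˣ)).extension_property_addMonoidHom
    (MonoidHom.toAdditive (QuotientGroup.kerLift f)) (QuotientGroup.kerLift_injective f)
    (MonoidHom.toAdditive (QuotientGroup.lift f.ker ξ h))
  exact ⟨MonoidHom.toAdditive.symm φ, fun a =>
    (DFunLike.congr_fun hφ (Additive.ofMul (QuotientGroup.mk a))).symm⟩

variable {F : Type*} [Field F] [ValuativeRel F] [TopologicalSpace F] [IsNonarchimedeanLocalField F]
  {E : Type*} [Field E] [ValuativeRel E] [TopologicalSpace E] [IsNonarchimedeanLocalField E]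
  [Algebra F E] [ValuativeExtension F E] [Algebra.IsQuadraticExtension F E]
  {k : Type*} [Field k] {p : ℕ} [Fact p.Prime] [CharP k p]

/-- An invariant character of `Eˣ` is trivial on `x` if the norm of `x` is a principal unit:
multiplicatively up to principal units, `x` is of the form `y / θ y`, with `y = c + x θ c` for
`c = 1` or a generator of the residue extension, as in Hilbert's theorem 90. -/
theorem apply_eq_one_of_norm_mem_principalUnits (hp : valuation F (p : F) < 1) {θ : E ≃ₐ[F] E}
    {b : E} (hb : valuation E b ≤ 1) (hbθ : valuation E (b - θ b) = 1) {ξ : SmoothChar Eˣ k}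
    (hξ : galConj θ ξ = ξ.1) {x : Eˣ} (hx : valuation F (Algebra.norm F (x : E) - 1) < 1) :
    ξ.1 x = 1 := by
  have hθ := ne_refl_of_valuation_sub_eq_one hbθ
  have hN : valuation F (Algebra.norm F (x : E)) = 1 := by
    have := Valuation.map_one_add_of_lt _ hx
    rwa [add_sub_cancel] at this
  have hvx : valuation E (x : E) = 1 :=
    nrdVal_eq_one_iff_valuation (F := F).1 (by rw [nrdVal_apply, ← norm_eq_redNorm, hN])
  have hNE : valuation E (algebraMap F E (Algebra.norm F (x : E)) - 1) < 1 := by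
    rw [← map_one (algebraMap F E), ← map_sub]
    exact (Valuation.HasExtension.val_map_lt_one_iff (valuation F) (valuation E) _).2 hx
  obtain ⟨c, hc, hy⟩ : ∃ c : E, valuation E c ≤ 1 ∧ valuation E (c + x * θ c) = 1 := by
    obtain h | h := lt_or_ge (valuation E (1 + x : E)) 1
    · refine ⟨b, hb, ?_⟩
      have h1 : b + x * θ b = (1 + x) * θ b + (b - θ b) := by ring
      rw [h1, ← hbθ]
      refine Valuation.map_add_eq_of_lt_right (valuation E) ?_
      rw [hbθ, map_mul, valuation_algEquiv]
      exact (mul_le_of_le_one_right zero_le hb).trans_lt h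
    · refine ⟨1, by rw [map_one], le_antisymm ?_ ?_⟩
      · exact Valuation.map_add_le (valuation E) (by rw [map_one]) (by rw [map_one, mul_one, hvx])
      · rwa [map_one, mul_one]
  have hy0 : c + x * θ c ≠ 0 := by
    intro h
    rw [h, map_zero] at hy
    exact zero_ne_one hy
  set y : Eˣ := Units.mk0 _ hy0 with hydef
  have hθy : (x : E) * θ y = y + (algebraMap F E (Algebra.norm F (x : E)) - 1) * c := by
    rw [hydef, Units.val_mk0, map_add, map_mul, algEquiv_algEquiv_apply,
      ← mul_apply_eq_algebraMap_norm hθ]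
    ring
  have hmem : x * Units.map (θ : E →* E) y * y⁻¹ ∈ principalUnits (valuation E) := by
    have h1 : (((x * Units.map (θ : E →* E) y * y⁻¹ : Eˣ) : E) - 1)
        = (algebraMap F E (Algebra.norm F (x : E)) - 1) * c * (y : E)⁻¹ := by
      have h2 : ((x * Units.map (θ : E →* E) y : Eˣ) : E) = x * θ y := rfl
      rw [Units.val_mul, h2, hθy, Units.val_inv_eq_inv_val, add_mul, mul_inv_cancel₀ y.ne_zero,
        add_sub_cancel_left]
    have hvy : valuation E (y : E) = 1 := hy
    rw [mem_principalUnits, h1, map_mul, map_mul, map_inv₀, hvy, inv_one, mul_one]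
    exact (mul_le_of_le_one_right zero_le hc).trans_lt hNE
  have h1 := smoothChar_apply_eq_one_of_mem_principalUnits (p := p)
    (valuation_natCast_lt_one_of_extension hp) ξ hmem
  have h2 : ξ.1 (Units.map (θ : E →* E) y) = ξ.1 y := DFunLike.congr_fun hξ y
  rwa [map_mul, map_mul, map_inv, h2, mul_inv_cancel_right] at h1

/-- A character of `Eˣ` is irregular if and only if it is invariant under the Galois group. -/
theorem not_isRegularChar_iff [IsAlgClosed k] (hp : valuation F (p : F) < 1) {θ : E ≃ₐ[F] E}
    {b : E} (hb : valuation E b ≤ 1) (hbθ : valuation E (b - θ b) = 1) {ξ : SmoothChar Eˣ k} :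
    ¬ IsRegularChar F ξ ↔ galConj θ ξ = ξ.1 := by
  rw [IsRegularChar, not_not]
  constructor
  · rintro ⟨φ, hφ⟩
    ext e
    change ((ξ.1 (Units.map (θ : E →* E) e) : kˣ) : k) = _
    rw [hφ, hφ]
    congr 2
    exact Units.ext (Algebra.norm_eq_of_algEquiv θ (e : E))
  · intro hξ
    let N : Eˣ →* Fˣ ⧸ principalUnits (valuation F) :=
      (QuotientGroup.mk' (principalUnits (valuation F))).comp (normUnits F E)
    obtain ⟨φ, hφ⟩ := exists_eq_comp_of_ker_le
      (Q := Fˣ ⧸ principalUnits (valuation F)) N ξ.1 fun x hx => by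
        refine apply_eq_one_of_norm_mem_principalUnits hp hb hbθ hξ ?_
        exact (QuotientGroup.eq_one_iff (normUnits F E x)).1 hx
    refine ⟨⟨φ.comp (QuotientGroup.mk' _), isOpen_ker_of_principalUnits_le _ fun e he => ?_⟩, hφ⟩
    change φ (QuotientGroup.mk e) = 1
    rw [(QuotientGroup.eq_one_iff e).2 he, map_one]

end Regular

/-! ### The characters of `Eˣ U_D¹` -/

section Dagger

variable {F : Type*} [Field F] [ValuativeRel F] [TopologicalSpace F] [IsNonarchimedeanLocalField F]
  {D : Type*} [DivisionRing D] [Algebra F D] [IsQuadraticDivisionAlgebra F D]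
  {E : Type*} [Field E] [ValuativeRel E] [Algebra F E] [ValuativeExtension F E]
  [Algebra.IsQuadraticExtension F E]
  {k : Type*} [Field k]

theorem embUnits_mem_principalUnits {ι : E →ₐ[F] D} {e : Eˣ} :
    embUnits ι e ∈ principalUnits (nrdVal F D) ↔ e ∈ principalUnits (valuation E) := by
  rw [mem_principalUnits, mem_principalUnits, ← nrdVal_lt_one_iff_valuation (F := F),
    ← nrdVal_algHom ι, map_sub ι, map_one]
  rfl

theorem embUnits_mem_groupJ {F E D : Type*} [Field F] [ValuativeRel F] [Field E] [DivisionRing D]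
    [Algebra F E] [Algebra F D] (ι : E →ₐ[F] D) (e : Eˣ) : embUnits ι e ∈ groupJ ι :=
  Subgroup.mem_sup_left ⟨e, rfl⟩

theorem principalUnits_le_groupJ {E : Type*} [Field E] [Algebra F E] (ι : E →ₐ[F] D) :
    principalUnits (nrdVal F D) ≤ groupJ ι :=
  fun _ hx => Subgroup.mem_sup_right (Subgroup.subset_closure hx)

theorem exists_embUnits_inv_mul_mem [TopologicalSpace E] [IsNonarchimedeanLocalField E]
    [Algebra.IsCentral F D] (hD : Module.finrank F D = 4) (hE : IsUnramifiedExt F E)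
    (ι : E →ₐ[F] D) (x : groupJ ι) :
    ∃ e : Eˣ, (embUnits ι e)⁻¹ * (x : Dˣ) ∈ principalUnits (nrdVal F D) := by
  have hx : (x : Dˣ) ∈ evenUnits F D := (groupJ_eq_evenUnits hD hE ι).le x.2
  obtain ⟨e, u, hu, h⟩ := exists_eq_mul_of_mem_evenUnits hD hE ι hx
  exact ⟨e, by rwa [h, inv_mul_cancel_left]⟩

variable [TopologicalSpace D]

theorem isOpen_groupJ [IsTopologicalRing D] [IsModuleTopology F D] {E : Type*} [Field E]
    [Algebra F E] (ι : E →ₐ[F] D) : IsOpen (groupJ ι : Set Dˣ) :=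
  Subgroup.isOpen_mono (principalUnits_le_groupJ ι)
    (hasBallTopology_nrdVal F D).isOpen_principalUnits

theorem IsDagger.apply_eq {E : Type*} [Field E] [TopologicalSpace E] [Algebra F E] {ι : E →ₐ[F] D} {ξ : SmoothChar Eˣ k} {χ : SmoothChar (groupJ ι) k}
    (h : IsDagger ι ξ χ) {x : groupJ ι} {e : Eˣ}
    (he : (embUnits ι e)⁻¹ * (x : Dˣ) ∈ principalUnits (nrdVal F D)) : χ.1 x = ξ.1 e := by
  rw [← h.1 ⟨_, embUnits_mem_groupJ ι e⟩ e rfl, ← inv_mul_eq_one, ← map_inv, ← map_mul]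
  refine h.2 (x⁻¹ * ⟨_, embUnits_mem_groupJ ι e⟩) ?_
  have h1 := inv_mem he
  rw [mul_inv_rev, inv_inv] at h1
  exact h1

variable [TopologicalSpace E] [IsNonarchimedeanLocalField E]
  (hD : Module.finrank F D = 4) (hE : IsUnramifiedExt F E) [Algebra.IsCentral F D]
include hD hE

theorem IsDagger.unique {ι : E →ₐ[F] D} {ξ : SmoothChar Eˣ k} {χ χ' : SmoothChar (groupJ ι) k}
    (h : IsDagger ι ξ χ) (h' : IsDagger ι ξ χ') : χ = χ' := by
  refine Subtype.ext (MonoidHom.ext fun x => ?_)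
  obtain ⟨e, he⟩ := exists_embUnits_inv_mul_mem hD hE ι x
  rw [h.apply_eq he, h'.apply_eq he]

variable [IsTopologicalRing D] [IsModuleTopology F D] {p : ℕ} [Fact p.Prime] [CharP k p]

theorem exists_isDagger (hp : valuation F (p : F) < 1) (ι : E →ₐ[F] D) (ξ : SmoothChar Eˣ k) :
    ∃ χ, IsDagger ι ξ χ := by
  choose e he using exists_embUnits_inv_mul_mem hD hE ι
  have key : ∀ (x : groupJ ι) (e' : Eˣ),
      (embUnits ι e')⁻¹ * (x : Dˣ) ∈ principalUnits (nrdVal F D) → ξ.1 (e x) = ξ.1 e' := by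
    intro x e' he'
    have h1 := mul_mem he' (inv_mem (he x))
    rw [mul_inv_rev, inv_inv, mul_assoc, mul_inv_cancel_left, ← map_inv, ← map_mul,
      embUnits_mem_principalUnits] at h1
    have h2 := smoothChar_apply_eq_one_of_mem_principalUnits (p := p)
      (valuation_natCast_lt_one_of_extension hp) ξ h1
    rw [map_mul, map_inv, inv_mul_eq_one] at h2
    exact h2.symm
  let χ : groupJ ι →* kˣ :=
    { toFun := fun x => ξ.1 (e x)
      map_one' := (key 1 1 (by simp)).trans (map_one _)
      map_mul' := fun x y => by
        rw [← map_mul]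
        refine key _ _ ?_
        have h1 := mul_mem (conj_mem_principalUnits (embUnits ι (e y))⁻¹ (he x)) (he y)
        convert! h1 using 1
        rw [map_mul, Subgroup.coe_mul]
        group }
  have hχ : ∀ x : groupJ ι, (x : Dˣ) ∈ principalUnits (nrdVal F D) → χ x = 1 := fun x hx =>
    (key x 1 (by rwa [map_one, inv_one, one_mul])).trans (map_one _)
  refine ⟨⟨χ, ?_⟩, fun x e' hx => key x e' ?_, hχ⟩
  · exact Subgroup.isOpen_mono (H₁ := (principalUnits (nrdVal F D)).subgroupOf (groupJ ι)) hχ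
      ((hasBallTopology_nrdVal F D).isOpen_principalUnits.preimage continuous_subtype_val)
  · rw [hx, inv_mul_cancel]
    exact one_mem _

theorem isDagger_dagger (hp : valuation F (p : F) < 1) (ι : E →ₐ[F] D) (ξ : SmoothChar Eˣ k) :
    IsDagger ι ξ (dagger ι ξ) := by
  have h := exists_isDagger hD hE hp ι ξ
  rw [dagger, dif_pos h]
  exact h.choose_spec

theorem dagger_apply_embUnits (hp : valuation F (p : F) < 1) (ι : E →ₐ[F] D)
    (ξ : SmoothChar Eˣ k) (e : Eˣ) :
    (dagger ι ξ).1 ⟨embUnits ι e, embUnits_mem_groupJ ι e⟩ = ξ.1 e :=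
  (isDagger_dagger hD hE hp ι ξ).1 _ _ rfl

/-- Every character of `Eˣ U_D¹` arises from a character of `Eˣ`. -/
theorem exists_dagger_eq (hp : valuation F (p : F) < 1) (ι : E →ₐ[F] D)
    (χ : SmoothChar (groupJ ι) k) : ∃ ξ : SmoothChar Eˣ k, dagger ι ξ = χ := by
  have hχ : ∀ x : groupJ ι, (x : Dˣ) ∈ principalUnits (nrdVal F D) → χ.1 x = 1 := fun x hx =>
    smoothChar_subgroup_apply_eq_one_of_mem_principalUnits (isOpen_groupJ ι) hp χ hx
  let η : Eˣ →* kˣ := χ.1.comp ((embUnits ι).codRestrict (groupJ ι) (embUnits_mem_groupJ ι))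
  refine ⟨⟨η, isOpen_ker_of_principalUnits_le η fun e he =>
    hχ _ (embUnits_mem_principalUnits.2 he)⟩, ?_⟩
  refine (isDagger_dagger hD hE hp ι _).unique hD hE ⟨fun x e hx => ?_, hχ⟩
  exact congrArg χ.1 (Subtype.ext hx)

/-- Conjugation of `ξ†` by an element inducing `θ` on `E` corresponds to `ξ ↦ ξ ∘ θ`. -/
theorem conjHom_dagger_eq_iff (hp : valuation F (p : F) < 1) {ι : E →ₐ[F] D}
    [(groupJ ι).Normal] {θ : E ≃ₐ[F] E} {g : Dˣ} (hg : ∀ e, (g : D) * ι e = ι (θ e) * g)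
    (ξ ξ' : SmoothChar Eˣ k) :
    conjHom (dagger ι ξ) g = (dagger ι ξ').1 ↔ galConj θ ξ = ξ'.1 := by
  have hgu : ∀ e : Eˣ, g * embUnits ι e * g⁻¹ = embUnits ι (Units.map (θ : E →* E) e) := fun e => by
    rw [mul_inv_eq_iff_eq_mul]
    exact Units.ext (hg e)
  have hgal : ∀ e : Eˣ, galConj θ ξ e = ξ.1 (Units.map (θ : E →* E) e) := fun _ => rfl
  constructor
  · intro h
    refine MonoidHom.ext fun e => ?_
    have h1 := DFunLike.congr_fun h ⟨embUnits ι e, embUnits_mem_groupJ ι e⟩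
    rw [dagger_apply_embUnits hD hE hp, conjHom_apply] at h1
    rw [← h1, hgal, ← dagger_apply_embUnits hD hE hp ι]
    congr 1
    exact Subtype.ext (hgu e).symm
  · intro h
    refine MonoidHom.ext fun x => ?_
    obtain ⟨e, he⟩ := exists_embUnits_inv_mul_mem hD hE ι x
    rw [(isDagger_dagger hD hE hp ι ξ').apply_eq he, ← h, hgal, conjHom_apply]
    refine (isDagger_dagger hD hE hp ι ξ).apply_eq ?_
    have h1 := conj_mem_principalUnits g he
    convert! h1 using 1
    rw [← hgu, MulAut.conjNormal_apply]
    group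

/-- Isomorphic pairs `(E, ξ)` and `(E', ξ')` have isomorphic `π_ξ` and `π_ξ'`, for any embeddings:
these are conjugate by the theorem of Skolem and Noether, and conjugation carries one character of
the group of elements of even valuation to the other. -/
theorem nonempty_piRep_equiv {E' : Type*} [Field E'] [ValuativeRel E'] [Algebra F E']
    [ValuativeExtension F E'] [Algebra.IsQuadraticExtension F E'] [TopologicalSpace E']
    [IsNonarchimedeanLocalField E'] (hE' : IsUnramifiedExt F E') (hp : valuation F (p : F) < 1)
    (ι : E →ₐ[F] D) (ι' : E' →ₐ[F] D) (j : E ≃ₐ[F] E') {ξ : SmoothChar Eˣ k}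
    {ξ' : SmoothChar E'ˣ k} (hξ : ξ.1 = ξ'.1.comp (Units.map (j : E →* E'))) :
    Nonempty ((piRep ι ξ).Equiv (piRep ι' ξ')) := by
  obtain ⟨g, hg⟩ := exists_mul_eq_mul_of_algHom (ι'.comp j.toAlgHom) ι
  have hgu : ∀ e : Eˣ, g * embUnits ι' (Units.map (j : E →* E') e) * g⁻¹ = embUnits ι e :=
    fun e => by
      rw [mul_inv_eq_iff_eq_mul]
      exact Units.ext (hg e)
  have hconj : ∀ x g : Dˣ, x ∈ evenUnits F D → g * x * g⁻¹ ∈ evenUnits F D := by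
    rintro x g ⟨a, ha⟩
    refine ⟨a, ?_⟩
    rw [← ha, Units.val_mul, Units.val_mul, map_mul, map_mul, mul_right_comm, ← map_mul,
      ← Units.val_mul, mul_inv_cancel, Units.val_one, map_one, one_mul]
  have hJ := groupJ_eq_evenUnits hD hE ι
  have hJ' := groupJ_eq_evenUnits hD hE' ι'
  refine nonempty_smoothInd_equiv_of_conj g (fun h => ?_) (fun h => ?_) fun x => ?_
  · rw [hJ]
    exact hconj _ _ (hJ'.le h.2)
  · rw [hJ']
    simpa using hconj _ g⁻¹ (hJ.le h.2)
  · obtain ⟨e', he'⟩ := exists_embUnits_inv_mul_mem hD hE' ι' x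
    obtain ⟨e, rfl⟩ : ∃ e : Eˣ, Units.map (j : E →* E') e = e' :=
      ⟨Units.map (j.symm : E' →* E) e', Units.ext (j.apply_symm_apply _)⟩
    rw [(isDagger_dagger hD hE' hp ι' ξ').apply_eq he',
      ← MonoidHom.comp_apply ξ'.1, ← hξ]
    refine (isDagger_dagger hD hE hp ι ξ).apply_eq ?_
    have h1 := conj_mem_principalUnits g he'
    convert! h1 using 1
    rw [← hgu]
    group

end Dagger

/-! ### The representations `π_ξ` -/

section IrreducibleTransfer

variable {G : Type*} [Group G] {k : Type*} [Field k] {V : Type*} [AddCommGroup V] [Module k V]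
  {ρ : Representation k G V}

theorem nontrivial_of_isIrreducible (hirr : ρ.IsIrreducible) : Nontrivial V := by
  by_contra h
  rw [not_nontrivial_iff_subsingleton] at h
  exact bot_ne_top (α := Subrepresentation ρ)
    (Subrepresentation.toSubmodule_injective (Subsingleton.elim _ _))

theorem isIrreducible_of_equiv {W : Type*} [AddCommGroup W] [Module k W]
    {σ : Representation k G W} (hirr : ρ.IsIrreducible) (φ : ρ.Equiv σ) : σ.IsIrreducible := by
  have := nontrivial_of_isIrreducible hirr
  obtain ⟨v, hv⟩ := exists_ne (0 : V)
  have hφ : ∀ x v, φ (ρ x v) = σ x (φ v) := fun x v =>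
    Representation.IntertwiningMap.isIntertwining _ _ φ.toIntertwiningMap x v
  have hinj : Function.Injective φ := φ.toLinearEquiv.injective
  have hsurj : Function.Surjective φ := φ.toLinearEquiv.surjective
  refine { exists_pair_ne := ⟨⊥, ⊤, fun h => ?_⟩, eq_bot_or_eq_top := fun W => ?_ }
  · have h1 : φ v ∈ (⊥ : Subrepresentation σ).toSubmodule := by
      rw [h]
      trivial
    exact hv (hinj ((show φ v = 0 from h1).trans (map_zero φ).symm))
  · let W' : Subrepresentation ρ :=
      { toSubmodule := W.toSubmodule.comap φ.toLinearEquiv.toLinearMap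
        apply_mem_toSubmodule := fun x v hv => by
          change φ (ρ x v) ∈ W.toSubmodule
          rw [hφ]
          exact W.apply_mem_toSubmodule x hv }
    have hW' : ∀ v, v ∈ W'.toSubmodule ↔ φ v ∈ W.toSubmodule := fun v => Iff.rfl
    refine (hirr.eq_bot_or_eq_top W').imp (fun h => ?_) (fun h => ?_) <;>
      refine Subrepresentation.toSubmodule_injective ?_
    · refine (Submodule.eq_bot_iff _).2 fun w hw => ?_
      obtain ⟨v, rfl⟩ := hsurj w
      rw [← hW', h] at hw
      rw [show v = 0 from hw, map_zero]
    · refine (Submodule.eq_top_iff').2 fun w => ?_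
      obtain ⟨v, rfl⟩ := hsurj w
      rw [← hW', h]
      trivial

theorem isAdmissible_of_finrank_eq_two [TopologicalSpace G] (hρ : IsSmooth ρ)
    (h : Module.finrank k V = 2) : IsAdmissible ρ := by
  have : FiniteDimensional k V := Module.finite_of_finrank_pos (by omega)
  exact ⟨hρ, fun K _ _ => FiniteDimensional.finiteDimensional_submodule _⟩

theorem one_lt_rank_of_finrank_eq_two (h : Module.finrank k V = 2) : 1 < Module.rank k V := by
  have : FiniteDimensional k V := Module.finite_of_finrank_pos (by omega)
  rw [← Module.finrank_eq_rank, h]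
  norm_num

end IrreducibleTransfer

section PiRep

variable {F : Type*} [Field F] [ValuativeRel F] [TopologicalSpace F] [IsNonarchimedeanLocalField F]
  {D : Type*} [DivisionRing D] [Algebra F D] [IsQuadraticDivisionAlgebra F D]
  [Algebra.IsCentral F D]
  {E : Type*} [Field E] [ValuativeRel E] [Algebra F E] [ValuativeExtension F E]
  [Algebra.IsQuadraticExtension F E] [TopologicalSpace E] [IsNonarchimedeanLocalField E]

theorem index_groupJ (hD : Module.finrank F D = 4) (hE : IsUnramifiedExt F E) (ι : E →ₐ[F] D) :
    (groupJ ι).index = 2 := by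
  obtain ⟨-, -, g, -, -, -, hg⟩ := exists_twist hE ι
  rw [groupJ_eq_evenUnits hD hE, Subgroup.index_eq_two_iff_exists_notMem_and]
  refine ⟨g⁻¹, fun h => hg (inv_mem_iff.1 h), fun b => ?_⟩
  by_cases hb : b ∈ evenUnits F D
  · exact Or.inr hb
  · exact Or.inl (mul_inv_mem_evenUnits hD hE hb hg ι)

variable [TopologicalSpace D] [IsTopologicalRing D] [IsModuleTopology F D]
  {k : Type*} [Field k] {p : ℕ} [Fact p.Prime] [CharP k p]

variable (hD : Module.finrank F D = 4) (hE : IsUnramifiedExt F E)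
include hD hE

theorem isAdmissible_piRep (ι : E →ₐ[F] D) (ξ : SmoothChar Eˣ k) :
    IsAdmissible (V := IndSpace (dagger ι ξ)) (piRep ι ξ) :=
  isAdmissible_of_finrank_eq_two (V := IndSpace (dagger ι ξ)) isSmooth_smoothInd
    (finrank_indSpace (isOpen_groupJ ι) (index_groupJ hD hE ι) (dagger ι ξ))

variable (hp : valuation F (p : F) < 1)
include hp

theorem dagger_injective (ι : E →ₐ[F] D) {ξ ξ' : SmoothChar Eˣ k}
    (h : dagger ι ξ = dagger ι ξ') : ξ = ξ' := by
  refine Subtype.ext (MonoidHom.ext fun e => ?_)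
  rw [← dagger_apply_embUnits hD hE hp ι ξ, h, dagger_apply_embUnits hD hE hp ι ξ']

theorem nonempty_piRep_equiv_iff (ι : E →ₐ[F] D) (ξ ξ' : SmoothChar Eˣ k) :
    Nonempty ((piRep ι ξ).Equiv (piRep ι ξ')) ↔ ∃ θ : E ≃ₐ[F] E, galConj θ ξ = ξ'.1 := by
  constructor
  · rintro ⟨φ⟩
    obtain ⟨θ, b, g, hb, hbθ, hg, hodd⟩ := exists_twist hE ι
    have hJ2 := index_groupJ hD hE ι
    have := Subgroup.normal_of_index_eq_two hJ2
    have hgJ : g ∉ groupJ ι := fun h => hodd ((groupJ_eq_evenUnits hD hE ι).le h)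
    obtain h | h := eq_or_eq_conjHom_of_equiv (isOpen_groupJ ι) hJ2 hgJ φ
    · refine ⟨AlgEquiv.refl, ?_⟩
      rw [dagger_injective hD hE hp ι (Subtype.ext h)]
      rfl
    · exact ⟨θ, (conjHom_dagger_eq_iff hD hE hp hg ξ ξ').1 h.symm⟩
  · rintro ⟨θ, hθ⟩
    obtain ⟨φ⟩ := nonempty_piRep_equiv hD hE hE hp ι ι θ (ξ := ξ') (ξ' := ξ) hθ.symm
    exact ⟨φ.symm⟩

/-- If `π_ξ ≅ π_ξ'` for two unramified quadratic extensions `E` and `E'`, then `ξ` and `ξ'`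
correspond under an isomorphism of `E` with `E'`. -/
theorem exists_algEquiv_of_piRep_equiv {E' : Type*} [Field E'] [ValuativeRel E'] [Algebra F E']
    [ValuativeExtension F E'] [Algebra.IsQuadraticExtension F E'] [TopologicalSpace E']
    [IsNonarchimedeanLocalField E'] (hE' : IsUnramifiedExt F E')
    (ι : E →ₐ[F] D) (ι' : E' →ₐ[F] D) {ξ : SmoothChar Eˣ k} {ξ' : SmoothChar E'ˣ k}
    (h : Nonempty ((piRep ι ξ).Equiv (piRep ι' ξ'))) :
    ∃ j : E ≃ₐ[F] E', ξ.1 = ξ'.1.comp (Units.map (j : E →* E')) := by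
  obtain ⟨j⟩ := nonempty_algEquiv_of_isUnramifiedExt hE hE'
  have hker : ∀ e ∈ principalUnits (valuation E), ξ'.1 (Units.map (j : E →* E') e) = 1 := by
    intro e he
    refine smoothChar_apply_eq_one_of_mem_principalUnits (p := p)
      (valuation_natCast_lt_one_of_extension hp) ξ' ?_
    rw [mem_principalUnits] at he ⊢
    rw [← nrdVal_lt_one_iff_valuation (F := F)] at he ⊢
    change nrdVal F E' (j e - 1) < 1
    rw [← map_one j, ← map_sub]
    exact (nrdVal_algHom j.toAlgHom _).trans_lt he
  let ξ'' : SmoothChar Eˣ k := ⟨ξ'.1.comp (Units.map (j : E →* E')),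
    isOpen_ker_of_principalUnits_le _ hker⟩
  obtain ⟨φ⟩ := h
  obtain ⟨φ'⟩ := nonempty_piRep_equiv hD hE hE' hp ι ι' j (ξ := ξ'') (ξ' := ξ') rfl
  obtain ⟨θ, hθ⟩ := (nonempty_piRep_equiv_iff hD hE hp ι ξ ξ'').1 ⟨φ.trans φ'.symm⟩
  refine ⟨θ.symm.trans j, MonoidHom.ext fun e => ?_⟩
  have h1 := DFunLike.congr_fun hθ (Units.map (θ.symm : E →* E) e)
  have h2 : galConj θ ξ (Units.map (θ.symm : E →* E) e) = ξ.1 e :=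
    congrArg ξ.1 (Units.ext (θ.apply_symm_apply e))
  rw [← h2, h1]
  rfl

variable [IsAlgClosed k]

theorem isIrreducible_piRep_iff (ι : E →ₐ[F] D) (ξ : SmoothChar Eˣ k) :
    Representation.IsIrreducible (V := IndSpace (dagger ι ξ)) (piRep ι ξ) ↔
      IsRegularChar F ξ := by
  obtain ⟨θ, b, g, hb, hbθ, hg, hodd⟩ := exists_twist hE ι
  have hJ2 := index_groupJ hD hE ι
  have := Subgroup.normal_of_index_eq_two hJ2
  have hgJ : g ∉ groupJ ι := fun h => hodd ((groupJ_eq_evenUnits hD hE ι).le h)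
  have hiff := (conjHom_dagger_eq_iff hD hE hp hg ξ ξ).trans
    (not_isRegularChar_iff hp hb hbθ (ξ := ξ)).symm
  constructor
  · intro hirr
    by_contra hreg
    obtain ⟨ψ, hψ⟩ := exists_smoothChar_extension_of_isAlgClosed (isOpen_groupJ ι) hJ2 hgJ
      (hiff.2 hreg)
    exact not_isIrreducible_of_extension hψ (isOpen_groupJ ι) hJ2 hirr
  · exact fun hreg => isIrreducible_smoothInd (isOpen_groupJ ι) hJ2 hgJ
      fun h => hiff.1 h hreg

/-- An irreducible admissible representation of `Dˣ` has a non-zero vector fixed by `U_D¹`, hence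
`U_D¹` acts trivially on it and `Eˣ U_D¹` acts through an abelian quotient. -/
theorem finrank_eq_one_or_exists_equiv {V : Type*} [AddCommGroup V] [Module k V]
    {ρ : Representation k Dˣ V} (hirr : ρ.IsIrreducible) (hadm : IsAdmissible ρ)
    (ι : E →ₐ[F] D) : Module.finrank k V = 1 ∨ Module.finrank k V = 2 ∧
      ∃ ξ : SmoothChar Eˣ k, IsRegularChar F ξ ∧ Nonempty (ρ.Equiv (piRep ι ξ)) := by
  have := nontrivial_of_isIrreducible hirr
  have hball := hasBallTopology_nrdVal F D
  have hU := hball.isCompact_principalUnits (isCompact_nrdVal_le_one F D)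
  have htriv := apply_eq_self_of_isIrreducible hirr
    (exists_ne_zero_fixed_of_isSmooth (p := p) ρ hadm.1 (principalUnits (nrdVal F D)) hU
      fun x hx H hH => exists_pow_prime_pow_mem_of_mem_principalUnits hp hx hH)
  have := finiteDimensional_of_isAdmissible hadm hball.isOpen_principalUnits hU htriv
  obtain ⟨χ, ℓ, hℓ0, hℓ⟩ := exists_smoothChar_functional (J := groupJ ι) hadm.1 (by
    intro x hx y hy v
    obtain ⟨e, he⟩ := exists_embUnits_inv_mul_mem hD hE ι ⟨x, hx⟩
    obtain ⟨e', he'⟩ := exists_embUnits_inv_mul_mem hD hE ι ⟨y, hy⟩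
    have h : (y * x)⁻¹ * (x * y) ∈ principalUnits (nrdVal F D) := by
      rw [← QuotientGroup.eq, QuotientGroup.mk_mul, QuotientGroup.mk_mul,
        ← QuotientGroup.eq.2 he, ← QuotientGroup.eq.2 he', ← QuotientGroup.mk_mul,
        ← QuotientGroup.mk_mul, ← map_mul, ← map_mul, mul_comm]
    have h1 : x * y = y * x * ((y * x)⁻¹ * (x * y)) := by group
    rw [← Module.End.mul_apply, ← map_mul, h1, map_mul, Module.End.mul_apply, htriv _ h,
      map_mul, Module.End.mul_apply])
  obtain ⟨ξ, rfl⟩ := exists_dagger_eq hD hE hp ι χ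
  refine (nonempty_equiv_smoothInd (isOpen_groupJ ι) (index_groupJ hD hE ι) hirr hadm.1 hℓ0
    hℓ).imp_right fun h => ⟨h.1, ξ, ?_, h.2⟩
  obtain ⟨φ⟩ := h.2
  exact (isIrreducible_piRep_iff hD hE hp ι ξ).1
    (isIrreducible_of_equiv (W := IndSpace (dagger ι ξ)) hirr φ)

theorem exists_two_extensions (hp2 : p ≠ 2) (ι : E →ₐ[F] D) {ξ : SmoothChar Eˣ k}
    (hξ : ¬ IsRegularChar F ξ) : ∃ χ₁ χ₂ : SmoothChar Dˣ k, χ₁ ≠ χ₂ ∧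
      (∀ χ, ExtendsDagger ι ξ χ ↔ χ = χ₁ ∨ χ = χ₂) ∧
      Nonempty ((piRep ι ξ).Equiv ((charRep χ₁).prod (charRep χ₂))) := by
  obtain ⟨θ, b, g, hb, hbθ, hg, hodd⟩ := exists_twist hE ι
  have hJ2 := index_groupJ hD hE ι
  have := Subgroup.normal_of_index_eq_two hJ2
  have hgJ : g ∉ groupJ ι := fun h => hodd ((groupJ_eq_evenUnits hD hE ι).le h)
  have hinv := (conjHom_dagger_eq_iff hD hE hp hg ξ ξ).2
    ((not_isRegularChar_iff hp hb hbθ).1 hξ)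
  obtain ⟨ψ, hψ⟩ := exists_smoothChar_extension_of_isAlgClosed (isOpen_groupJ ι) hJ2 hgJ hinv
  have hsq : ∀ χ : SmoothChar Dˣ k, ExtendsDagger ι ξ χ → χ.1 g * χ.1 g =
      (dagger ι ξ).1 ⟨g * g, Subgroup.mul_self_mem_of_index_two hJ2 g⟩ := fun χ hχ => by
    rw [← hχ, ← map_mul]
  obtain ⟨ψ', hψ', hψg⟩ := exists_smoothChar_extension (isOpen_groupJ ι) hJ2 hgJ hinv
    (c := -ψ.1 g) (by rw [neg_mul_neg, hsq ψ hψ])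
  have hne : ψ ≠ ψ' := by
    rintro rfl
    have h1 : (2 : k) * ψ.1 g = 0 := by
      have := congrArg Units.val hψg
      rw [Units.val_neg] at this
      linear_combination this
    have h2 : ((2 : ℕ) : k) = 0 := (mul_eq_zero.1 h1).resolve_right (Units.ne_zero _)
    rw [CharP.cast_eq_zero_iff k p, Nat.prime_dvd_prime_iff_eq Fact.out Nat.prime_two] at h2
    exact hp2 h2
  refine ⟨ψ, ψ', hne, fun χ => ⟨fun hχ => ?_, ?_⟩, nonempty_equiv_prod hψ hJ2 hgJ hψ' hne⟩
  · have h1 : χ.1 g = ψ.1 g ∨ χ.1 g = -ψ.1 g := by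
      rw [← Units.val_inj, ← Units.val_inj (b := -ψ.1 g), Units.val_neg,
        ← mul_self_eq_mul_self_iff, ← Units.val_mul, ← Units.val_mul, hsq χ hχ, hsq ψ hψ]
    refine h1.imp (fun h => ?_) (fun h => ?_)
    · exact smoothChar_ext_of_index_two hJ2 hgJ (fun j => (hχ j).trans (hψ j).symm) h
    · exact smoothChar_ext_of_index_two hJ2 hgJ (fun j => (hχ j).trans (hψ' j).symm)
        (h.trans hψg.symm)
  · rintro (rfl | rfl)
    exacts [hψ, hψ']

theorem exists_unique_extension_of_two (hp2 : p = 2) (ι : E →ₐ[F] D) {ξ : SmoothChar Eˣ k}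
    (hξ : ¬ IsRegularChar F ξ) : ∃ χ : SmoothChar Dˣ k, (∀ χ', ExtendsDagger ι ξ χ' ↔ χ' = χ) ∧
      IsNonsplitSelfExtension (V := IndSpace (dagger ι ξ)) χ (piRep ι ξ) := by
  subst hp2
  obtain ⟨θ, b, g, hb, hbθ, hg, hodd⟩ := exists_twist hE ι
  have hJ2 := index_groupJ hD hE ι
  have := Subgroup.normal_of_index_eq_two hJ2
  have hgJ : g ∉ groupJ ι := fun h => hodd ((groupJ_eq_evenUnits hD hE ι).le h)
  have hinv := (conjHom_dagger_eq_iff hD hE hp hg ξ ξ).2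
    ((not_isRegularChar_iff hp hb hbθ).1 hξ)
  obtain ⟨ψ, hψ⟩ := exists_smoothChar_extension_of_isAlgClosed (isOpen_groupJ ι) hJ2 hgJ hinv
  refine ⟨ψ, fun χ => ⟨fun hχ => ?_, ?_⟩,
    isNonsplitSelfExtension_of_charP_two hψ (isOpen_groupJ ι) hJ2 hgJ⟩
  · refine smoothChar_ext_of_index_two hJ2 hgJ (fun j => (hχ j).trans (hψ j).symm) ?_
    have h1 : ((χ.1 g : kˣ) : k) * χ.1 g = ψ.1 g * ψ.1 g := by
      rw [← Units.val_mul, ← Units.val_mul, ← map_mul, ← map_mul,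
        hχ ⟨g * g, Subgroup.mul_self_mem_of_index_two hJ2 g⟩,
        hψ ⟨g * g, Subgroup.mul_self_mem_of_index_two hJ2 g⟩]
    refine Units.ext ?_
    obtain h | h := mul_self_eq_mul_self_iff.1 h1
    · exact h
    · rw [h, CharTwo.neg_eq]
  · rintro rfl
    exact hψ

end PiRep

/-! ### Admissible pairs -/

section Pairs

/-- Characters of characteristic `p` being trivial on principal units, the extension in an
admissible pair is unramified. -/
theorem AdmissiblePair.isUnramifiedExt {F : Type u} [Field F] [ValuativeRel F]
    [TopologicalSpace F] [IsNonarchimedeanLocalField F] {k : Type*} [Field k] {p : ℕ}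
    [Fact p.Prime] [CharP k p] (hp : valuation F (p : F) < 1) (P : AdmissiblePair F k) :
    IsUnramifiedExt F P.E := by
  refine P.unram_of_factor ⟨⟨1, by simp [MonoidHom.ker_one]⟩, fun x hx => ?_⟩
  exact smoothChar_apply_eq_one_of_mem_principalUnits (p := p)
    (valuation_natCast_lt_one_of_extension hp) P.χ hx

variable {F : Type u} [Field F] [ValuativeRel F] [TopologicalSpace F]
  [IsNonarchimedeanLocalField F] {k : Type} [Field k] {p : ℕ} [Fact p.Prime] [CharP k p]

variable {D : Type u} [DivisionRing D] [Algebra F D] [Algebra.IsCentral F D]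
  [IsQuadraticDivisionAlgebra F D]
  [TopologicalSpace D] [IsTopologicalRing D] [IsModuleTopology F D] [IsAlgClosed k]
  (hD : Module.finrank F D = 4) (hp : valuation F (p : F) < 1)

/-- The representation `π_χ` attached to an admissible pair `(E, χ)` and an embedding of `E`. -/
noncomputable def AdmissiblePair.irrRep (P : AdmissiblePair F k) (ι : P.E →ₐ[F] D) : IrrRep D k where
  V := IndSpace (dagger ι P.χ)
  ρ := piRep ι P.χ
  irreducible := (isIrreducible_piRep_iff hD (P.isUnramifiedExt hp) hp ι P.χ).2 P.not_factor
  admissible := isAdmissible_piRep hD (P.isUnramifiedExt hp) ι P.χ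
  one_lt_rank := one_lt_rank_of_finrank_eq_two (V := IndSpace (dagger ι P.χ))
    (finrank_indSpace (isOpen_groupJ ι) (index_groupJ hD (P.isUnramifiedExt hp) ι) (dagger ι P.χ))

include hD hp in
theorem exists_pairClasses_equiv_irrClasses [CharP 𝓀[F] p] {E : Type u} [Field E] [ValuativeRel E]
    [TopologicalSpace E] [IsNonarchimedeanLocalField E] [Algebra F E] [ValuativeExtension F E]
    [Algebra.IsQuadraticExtension F E] (hE : IsUnramifiedExt F E) :
    ∃ Φ : PairClasses F k ≃ IrrClasses D k, ∀ P : AdmissiblePair F k,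
      IsUnramifiedExt F P.E ∧ Nonempty (P.E →ₐ[F] D) ∧ ∀ (ι : P.E →ₐ[F] D) (R : IrrRep D k),
        Φ (Quotient.mk _ P) = Quotient.mk _ R ↔ Nonempty (R.ρ.Equiv (piRep ι P.χ)) := by
  have hι : ∀ P : AdmissiblePair F k, Nonempty (P.E →ₐ[F] D) := fun P =>
    nonempty_algHom_quaternion (P.isUnramifiedExt hp) hD
  let ι := fun P => (hι P).some
  let Ψ : PairClasses F k → IrrClasses D k := Quotient.lift
    (fun P => Quotient.mk _ (P.irrRep hD hp (ι P))) fun P Q hPQ => by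
      obtain ⟨j, hj⟩ := hPQ
      exact Quotient.sound (nonempty_piRep_equiv hD (P.isUnramifiedExt hp) (Q.isUnramifiedExt hp)
        hp (ι P) (ι Q) j hj)
  have hΨ : ∀ P, Ψ (Quotient.mk _ P) = Quotient.mk _ (P.irrRep hD hp (ι P)) := fun _ => rfl
  have hinj : Function.Injective Ψ := by
    intro x y
    refine Quotient.inductionOn₂ x y fun P Q h => ?_
    rw [hΨ, hΨ] at h
    exact Quotient.sound (exists_algEquiv_of_piRep_equiv hD (P.isUnramifiedExt hp) hp
      (Q.isUnramifiedExt hp) (ι P) (ι Q) (Quotient.exact h))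
  have hsurj : Function.Surjective Ψ := by
    intro x
    refine Quotient.inductionOn x fun R => ?_
    obtain ⟨ι₀⟩ := nonempty_algHom_quaternion (D := D) hE hD
    obtain h | ⟨-, ξ, hξ, ⟨φ⟩⟩ :=
      finrank_eq_one_or_exists_equiv hD hE hp R.irreducible R.admissible ι₀
    · have hfd : FiniteDimensional k R.V := Module.finite_of_finrank_pos (by omega)
      have := R.one_lt_rank
      rw [← Module.finrank_eq_rank, h, Nat.cast_one] at this
      exact absurd this (lt_irrefl _)
    let P : AdmissiblePair F k :=
      { E := E
        tame := by
          rw [IsTameExt, show ramIdx F E = 1 from hE, ringChar.eq 𝓀[F] p, Nat.dvd_one]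
          exact (Fact.out : p.Prime).ne_one
        χ := ξ
        not_factor := hξ
        unram_of_factor := fun _ => hE }
    refine ⟨Quotient.mk _ P, ?_⟩
    rw [hΨ]
    obtain ⟨φ'⟩ := nonempty_piRep_equiv hD hE hE hp (ι P) ι₀ AlgEquiv.refl (ξ := ξ) (ξ' := ξ) rfl
    exact Quotient.sound ⟨φ'.trans φ.symm⟩
  have hbij : Function.Bijective Ψ := ⟨hinj, hsurj⟩
  refine ⟨Equiv.ofBijective Ψ hbij, fun P => ⟨P.isUnramifiedExt hp, hι P, fun ι' R => ?_⟩⟩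
  rw [Equiv.ofBijective_apply, hΨ]
  obtain ⟨φ⟩ := nonempty_piRep_equiv hD (P.isUnramifiedExt hp) (P.isUnramifiedExt hp) hp
    (ι P) ι' AlgEquiv.refl (ξ := P.χ) (ξ' := P.χ) rfl
  constructor
  · intro h
    obtain ⟨φ'⟩ := Quotient.exact h
    exact ⟨φ'.symm.trans φ⟩
  · rintro ⟨φ'⟩
    exact Quotient.sound ⟨φ.trans φ'.symm⟩

end Pairs

end QuatModP

theorem mainTheorem3 {p : ℕ} [Fact p.Prime]
    -- a non-Archimedean local field of residue characteristic `p`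
    {F : Type u} [Field F] [ValuativeRel F] [TopologicalSpace F] [IsNonarchimedeanLocalField F]
    [CharP 𝓀[F] p]
    -- a quaternion division algebra over `F`, with its topology as an `F`-vector space
    {D : Type u} [DivisionRing D] [Algebra F D] [Algebra.IsCentral F D]
    (hD : Module.finrank F D = 4)
    [TopologicalSpace D] [IsTopologicalRing D] [IsModuleTopology F D]
    -- an unramified quadratic extension of `F`
    {E : Type u} [Field E] [ValuativeRel E] [TopologicalSpace E] [IsNonarchimedeanLocalField E]
    [Algebra F E] [ValuativeExtension F E] [Algebra.IsQuadraticExtension F E]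
    (hE : IsUnramifiedExt F E) :
    -- the objects are well defined
    Nonempty (E →ₐ[F] D) ∧
    (∀ ι : E →ₐ[F] D,
      (groupJ ι : Set Dˣ) = Set.range (embUnits ι) * unitsD1 F D ∧
      (groupJ ι : Set Dˣ) = Set.range (Units.map (algebraMap F D : F →* D)) * unitsD F D) ∧
    (∀ (ι : E →ₐ[F] D) (ξ : SmoothChar Eˣ (AlgebraicClosure (ZMod p))),
      (∃! χ, IsDagger ι ξ χ) ∧ IsAdmissible (piRep ι ξ)) ∧
    -- (1) independence of the embedding
    (∀ (ι ι' : E →ₐ[F] D) (ξ : SmoothChar Eˣ (AlgebraicClosure (ZMod p))),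
      Nonempty ((piRep ι ξ).Equiv (piRep ι' ξ))) ∧
    -- (2) irreducibility, exhaustion, isomorphisms
    (∀ (ι : E →ₐ[F] D) (ξ : SmoothChar Eˣ (AlgebraicClosure (ZMod p))),
      (piRep ι ξ).IsIrreducible ↔ IsRegularChar F ξ) ∧
    (∀ (ι : E →ₐ[F] D) (V : Type w) [AddCommGroup V] [Module (AlgebraicClosure (ZMod p)) V]
      (ρ : Representation (AlgebraicClosure (ZMod p)) Dˣ V),
      ρ.IsIrreducible → IsAdmissible ρ → 1 < Module.rank (AlgebraicClosure (ZMod p)) V →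
      ∃ ξ : SmoothChar Eˣ (AlgebraicClosure (ZMod p)),
        IsRegularChar F ξ ∧ Nonempty (ρ.Equiv (piRep ι ξ))) ∧
    (∀ (ι : E →ₐ[F] D) (ξ ξ' : SmoothChar Eˣ (AlgebraicClosure (ZMod p))),
      IsRegularChar F ξ → IsRegularChar F ξ' →
      (Nonempty ((piRep ι ξ).Equiv (piRep ι ξ')) ↔ ∃ θ : E ≃ₐ[F] E, galConj θ ξ = ξ'.1)) ∧
    -- the induced bijection `[(E'/F, χ)] ↦ [π_χ]`
    (∃ Φ : PairClasses F (AlgebraicClosure (ZMod p)) ≃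
          IrrClasses D (AlgebraicClosure (ZMod p)),
      ∀ P : AdmissiblePair F (AlgebraicClosure (ZMod p)),
        IsUnramifiedExt F P.E ∧ Nonempty (P.E →ₐ[F] D) ∧
        ∀ (ι : P.E →ₐ[F] D) (R : IrrRep D (AlgebraicClosure (ZMod p))),
          Φ (Quotient.mk _ P) = Quotient.mk _ R ↔ Nonempty (R.ρ.Equiv (piRep ι P.χ))) ∧
    -- irreducible admissible representations have dimension one or two
    (∀ (V : Type w) [AddCommGroup V] [Module (AlgebraicClosure (ZMod p)) V]
      (ρ : Representation (AlgebraicClosure (ZMod p)) Dˣ V),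
      ρ.IsIrreducible → IsAdmissible ρ →
      Module.finrank (AlgebraicClosure (ZMod p)) V = 1 ∨
        Module.finrank (AlgebraicClosure (ZMod p)) V = 2) ∧
    -- (3) irregular characters
    (∀ (ι : E →ₐ[F] D) (ξ : SmoothChar Eˣ (AlgebraicClosure (ZMod p))), ¬ IsRegularChar F ξ →
      (p ≠ 2 → ∃ χ₁ χ₂ : SmoothChar Dˣ (AlgebraicClosure (ZMod p)), χ₁ ≠ χ₂ ∧
        (∀ χ, ExtendsDagger ι ξ χ ↔ χ = χ₁ ∨ χ = χ₂) ∧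
        Nonempty ((piRep ι ξ).Equiv ((charRep χ₁).prod (charRep χ₂)))) ∧
      (p = 2 → ∃ χ : SmoothChar Dˣ (AlgebraicClosure (ZMod p)),
        (∀ χ', ExtendsDagger ι ξ χ' ↔ χ' = χ) ∧
        IsNonsplitSelfExtension χ (piRep ι ξ))) := by
  have := isQuadraticDivisionAlgebra_of_finrank_eq_four (F := F) (D := D) hD
  have hp : valuation F (p : F) < 1 := valuation_natCast_lt_one F
  have : CharP (AlgebraicClosure (ZMod p)) p :=
    charP_of_injective_algebraMap (algebraMap (ZMod p) _).injective p
  have hemb : Nonempty (E →ₐ[F] D) := nonempty_algHom_quaternion hE hD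
  refine ⟨hemb, fun ι => ⟨coe_groupJ_eq_range_embUnits_mul hD hE ι,
    coe_groupJ_eq_range_algebraMap_mul hD hE ι⟩, fun ι ξ => ⟨?_, isAdmissible_piRep hD hE ι ξ⟩,
    fun ι ι' ξ => nonempty_piRep_equiv hD hE hE hp ι ι' AlgEquiv.refl rfl,
    fun ι ξ => isIrreducible_piRep_iff hD hE hp ι ξ, ?_,
    fun ι ξ ξ' _ _ => nonempty_piRep_equiv_iff hD hE hp ι ξ ξ',
    exists_pairClasses_equiv_irrClasses hD hp hE, ?_, fun ι ξ hξ =>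
    ⟨fun hp2 => exists_two_extensions hD hE hp hp2 ι hξ,
      fun hp2 => exists_unique_extension_of_two hD hE hp hp2 ι hξ⟩⟩
  · obtain ⟨χ, hχ⟩ := exists_isDagger hD hE hp ι ξ
    exact ⟨χ, hχ, fun χ' hχ' => hχ'.unique hD hE hχ⟩
  · intro ι V _ _ ρ hirr hadm hrank
    obtain h | ⟨-, h⟩ := finrank_eq_one_or_exists_equiv hD hE hp hirr hadm ι
    · have : FiniteDimensional (AlgebraicClosure (ZMod p)) V :=
        Module.finite_of_finrank_pos (by omega)
      rw [← Module.finrank_eq_rank, h, Nat.cast_one] at hrank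
      exact absurd hrank (lt_irrefl _)
    · exact h
  · intro V _ _ ρ hirr hadm
    obtain ⟨ι⟩ := hemb
    exact (finrank_eq_one_or_exists_equiv hD hE hp hirr hadm ι).imp_right fun h => h.1
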